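/- **Setting.** Let $d,n\ge1$, $1\le k\le d$, $x_-:=(-x_1,x_2,\dots,x_d)$, $\mathbb Z^d_+=\{x\in\mathbb Z^d: x_1\ge 0\}$, $\mathbb T^d=\mathbb R^d/(2\pi\mathbb Z)^d$, and let $V:\mathbb Z^d\to\mathbb R^{n\times n}$ satisfy $\|V(x)\|\le Ce^{-\gamma|x|}$ for some $C,\gamma>0$, $V(-x)=V(x)^T$, $V(x_-)=V(x)$, $\hat V(\theta)=\sum_x e^{i(x,\theta)}V(x)\ge0$ for all $\theta$, and $\int_{\mathbb T^d}\sin^2(\theta_1)\|\hat V(\theta)^{-1}\|\,d\theta<\infty$ (in particular $\hat V(\theta)$ is invertible for a.e. $\theta$). The half-space crystal is $\ddot u(x)=-\sum_{y\in\mathbb Z^d_+}(V(x-y)-V(x-y_-))u(y)$ with $u|_{x_1=0}=0$. Let $\Omega=\hat V^{1/2}$, with distinct eigenvalues $\omega_\sigma(\theta)$, $\sigma=1,\dots,s$, spectral projections $\Pi_\sigma(\theta)$ and multiplicities $r_\sigma=\operatorname{tr}\Pi_\sigma$ (bands and derivatives being taken for a.e. $\theta$). Let $\mathcal N^k_+$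 be the set of $\mathbf n=(n_1,\dots,n_k)$ with $n_1=2$, $n_j\in\{1,2\}$. For $\mathbf n\in\mathcal N^k_+$ let $\mu_{\mathbf n}$ be a translation-invariant probability measure on configurations $Y=(Y^0,Y^1)=(u,\dot u)$ on $\mathbb Z^d$ with zero mean, finite second moments and absolutely summable correlation matrix $q_{\mathbf n}(x-y)=\mathbb E_{\mathbf n}\,Y(x)\otimes Y(y)$. Put $$S^{\rm even/odd}_{\mathbf n,\sigma}=\sum_{\substack{\emptyset\ne P\subset\{1,\dots,k\}\\ |P|\ \rm even/odd}}\ \prod_{p\in P}(-1)^{n_p}\operatorname{sgn}(\partial_{\theta_p}\omega_\sigma),\qquad C=\begin{pmatrix}0&\Omega^{-1}\\-\Omega&0\end{pmatrix},$$ $$\hat q^+_\infty=\sum_\sigma\Pi_\sigma\,\frac1{2^k}\sum_{\mathbf n\in\mathcal N^k_+}\Big[\tfrac12(\hat q_{\mathbf n}+C\hat q_{\mathbf n}C^*)(1+S^{\rm even}_{\mathbf n,\sigma})+\tfrac i2(C\hat q_{\mathbf n}-\hat q_{\mathbf n}C^*)S^{\rm odd}_{\mathbf n,\sigma}\Big]\Pi_\sigma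 ,$$ $$Q^+_\infty(x,y)=q^+_\infty(x-y)-q^+_\infty(x-y_-)-q^+_\infty(x_--y)+q^+_\infty(x_--y_-),$$ the four inverse Fourier transforms being combined into one (convergent) integral. This $Q^+_\infty$ is the limiting covariance of the half-space crystal with reservoirs $\mu_{\mathbf n}$. The energy current density of a configuration $Y=(u,\dot u)$ at $x\in\mathbb Z^d_+$ in the direction $e_l$ is $$J^l_+(x;Y)=\tfrac12\Big(\sum_{m\le-1,\ y_l\ge x_l}-\sum_{m\ge0,\ y_l<x_l}\Big)\big(\dot u(X),(V(X-y)-V(X-y_-))u(y)\big),\qquad X=x+me_l,$$ the sums being over $m\in\mathbb Z$, $y\in\mathbb Z^d_+$ with $X\in\mathbb Z^d_+$. The limiting energy current density $\mathbf J_{+,\infty}=(J^1_{+,\infty},\dots,J^d_{+,\infty})$ is defined by the same sums with each term replaced by $\operatorname{tr}\big[Q^{+,10}_\infty(X,y)(V(X-y)-V(X-y_-))^T\big]$. **Claim.** The integrals defining $Q^+_\infty$ and the series defining $\mathbf J_{+,\infty}$ converge absolutely, $\mathbf J_{+,\infty}(x)$ is real, and for every probability measure on configurations which has finite second moments and $\mathbb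 E\,Y(x)\otimes Y(y)=Q^+_\infty(x,y)$ on $\mathbb Z^d_+$, one has $\mathbb E\,J^l_+(x;Y)=J^l_{+,\infty}(x)$. Moreover: 1. If $d=1$, then $\mathbf J_{+,\infty}=0$. 2. For every $d$, $J^1_{+,\infty}(x)=0$ for all $x\in\mathbb Z^d_+$. 3. For $l=2,\dots,d$, $J^l_{+,\infty}$ depends only on $x_1$, and $$J^l_{+,\infty}(x_1)=-\frac{2i}{(2\pi)^d}\int_{\mathbb T^d}\sin^2(\theta_1x_1)\operatorname{tr}\big[(\hat q^+_\infty(\theta))^{10}\,\partial_{\theta_l}\hat V(\theta)\big]\,d\theta ,$$ the integral being absolutely convergent. In particular $\mathbf J_{+,\infty}(0)=0$. 4. Suppose in addition that $\det\hat V(\theta)\ne0$ for all $\theta$, that the reservoirs have Gibbs correlations with temperatures $T_{\mathbf n}>0$, i.e. $\hat q^{00}_{\mathbf n}=T_{\mathbf n}\hat V^{-1}$, $\hat q^{11}_{\mathbf n}=T_{\mathbf n}I$, $\hat q^{01}_{\mathbf n}=\hat q^{10}_{\mathbf n}=0$, and that one of the following symmetry conditions (SC) holds: (a) each $\omega_\sigma$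 is even in each of $\theta_{k+1},\dots,\theta_d$ and, if $k\ge2$, even in some $k-1$ of $\theta_1,\dots,\theta_k$; (b) each $\omega_\sigma$ is even in each of $\theta_1,\dots,\theta_k$; (c) for $p=1,\dots,k$, $\operatorname{sgn}\partial_{\theta_p}\omega_\sigma$ depends only on $\theta_p$ and, if $k\ge3$, each $\omega_\sigma$ is even in some $k-1$ of $\theta_1,\dots,\theta_k$. Let $$c_l(x_1)=\frac2{(2\pi)^d}\sum_\sigma\int_{\mathbb T^d}r_\sigma\sin^2(\theta_1x_1)\,|\partial_{\theta_l}\omega_\sigma|\,d\theta,\qquad c_l=\frac1{(2\pi)^d}\sum_\sigma\int_{\mathbb T^d}r_\sigma\,|\partial_{\theta_l}\omega_\sigma|\,d\theta .$$ Then for $x_1\ge0$ $$J^l_{+,\infty}(x_1)=\begin{cases}-c_l(x_1)\,\dfrac1{2^{k-1}}\sum'\big(T_{\mathbf n}|_{n_l=2}-T_{\mathbf n}|_{n_l=1}\big),& l=2,\dots,k,\\ 0,& l=1,k+1,\dots,d,\end{cases}$$ and for $l=2,\dots,k$ $$J^l_{+,\infty}(x_1)\to-c_l\,\frac1{2^{k-1}}\sum\nolimits'\big(T_{\mathbf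 n}|_{n_l=2}-T_{\mathbf n}|_{n_l=1}\big)\qquad(x_1\to+\infty),$$ where $\sum'$ is over $n_2,\dots,n_{l-1},n_{l+1},\dots,n_k\in\{1,2\}$ (and $n_1=2$). If moreover no $\partial_{\theta_j}\omega_\sigma$ ($1\le j\le d$) vanishes identically, then $c_l>0$ and $c_l(x_1)>0$ for $x_1\ge1$, $l=2,\dots,k$. -/

import Mathlib

open MeasureTheory Matrix
open scoped ComplexOrder

noncomputable section

namespace HarmonicCrystal

/-- Points of the lattice `ℤ^d`. The first coordinate `x_1` of the text is `x 0`. -/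
abbrev Lattice (d : ℕ) := Fin d → ℤ

/-- Lattice configurations `Y = (u, v)`; at a site `x` the value `Y x (Sum.inl a)` is the displacement
`u_a(x)` and `Y x (Sum.inr a)` is the velocity `v_a(x)`. The product sigma-algebra is used. -/
abbrev Config (d n : ℕ) := Lattice d → Fin n ⊕ Fin n → ℝ

/-- The Euclidean length of a lattice vector. -/
def latticeNorm {d : ℕ} (x : Lattice d) : ℝ := √(∑ j, (x j : ℝ) ^ 2)

/-- The pairing `(x, θ)`. -/
def pairing {d : ℕ} (x : Lattice d) (θ : Fin d → ℝ) : ℝ := ∑ j, (x j : ℝ) * θ j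

/-- A fundamental domain of the torus `ℝ^d / (2π ℤ)^d`. -/
def torus (d : ℕ) : Set (Fin d → ℝ) := Set.Icc (fun _ => -Real.pi) (fun _ => Real.pi)

/-- The Fourier transform `∑_x e^{i (x, θ)} f(x)` of a matrix-valued function, entry by entry. -/
def fourier {d : ℕ} {ι : Type*} (f : Lattice d → Matrix ι ι ℝ) (θ : Fin d → ℝ) : Matrix ι ι ℂ :=
  Matrix.of fun a b => ∑' x, Complex.exp (Complex.I * (pairing x θ : ℂ)) * (f x a b : ℂ)

section Interaction

variable {d n : ℕ}

/-- Exponential decay of the interaction (all matrix norms are equivalent). -/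
def ExpDecay (V : Lattice d → Matrix (Fin n) (Fin n) ℝ) : Prop :=
  ∃ C > 0, ∃ γ > 0, ∀ x a b, |V x a b| ≤ C * Real.exp (-γ * latticeNorm x)

/-- `V_{lk}(-x) = V_{kl}(x)`. -/
def SymmetricInteraction (V : Lattice d → Matrix (Fin n) (Fin n) ℝ) : Prop :=
  ∀ x, V (-x) = (V x)ᵀ

/-- The reflection `x ↦ x_- = (-x_1, x_2, …, x_d)`. -/
def reflect [NeZero d] (x : Lattice d) : Lattice d := Function.update x 0 (-x 0)

/-- `sin²(θ_1) ‖V̂(θ)⁻¹‖` is integrable over the torus; in particular `V̂(θ)` is invertible for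
almost every `θ`. -/
def WeakInverseIntegrability [NeZero d] (V : Lattice d → Matrix (Fin n) (Fin n) ℝ) : Prop :=
  (∀ᵐ θ : Fin d → ℝ, (fourier V θ).det ≠ 0) ∧
    ∀ a b, IntegrableOn (fun θ : Fin d → ℝ => Real.sin (θ 0) ^ 2 * ‖(fourier V θ)⁻¹ a b‖) (torus d)

/-- The entrywise partial derivative `∂_{θ_l} V̂(θ)`. -/
def dFourier (V : Lattice d → Matrix (Fin n) (Fin n) ℝ) (l : Fin d) (θ : Fin d → ℝ) :
    Matrix (Fin n) (Fin n) ℂ :=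
  Matrix.of fun a b => deriv (fun t : ℝ => fourier V (Function.update θ l t) a b) (θ l)

/-- `Ω(θ) = V̂(θ)^{1/2}`, by the functional calculus of Hermitian matrices. -/
def Omega (V : Lattice d → Matrix (Fin n) (Fin n) ℝ) (θ : Fin d → ℝ) : Matrix (Fin n) (Fin n) ℂ :=
  cfc Real.sqrt (fourier V θ)

/-- The dispersion relations: the eigenvalues `ω_0(θ) ≤ ω_1(θ) ≤ … ≤ ω_{n-1}(θ)` of `Ω(θ)` in
nondecreasing order and repeated according to multiplicity, that is the square roots of the
eigenvalues of `V̂(θ)`. (Mathlib's `eigenvalues₀` is nonincreasing, hence the reversal.) -/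
def omega (V : Lattice d → Matrix (Fin n) (Fin n) ℝ) (i : Fin n) (θ : Fin d → ℝ) : ℝ :=
  if h : (fourier V θ).IsHermitian then
    √(h.eigenvalues₀ (Fin.cast (Fintype.card_fin n).symm i.rev))
  else 0

/-- The indices of the distinct eigenvalues of `Ω(θ)`: from each group of equal eigenvalues the
smallest index is kept. Where the number of distinct eigenvalues is locally constant, this is
the set of the bands `σ = 1, …, s`. -/
def bands (V : Lattice d → Matrix (Fin n) (Fin n) ℝ) (θ : Fin d → ℝ) : Finset (Fin n) :=
  Finset.univ.filter fun i => ∀ j < i, omega V j θ ≠ omega V i θ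

open Classical in
/-- The spectral projection of `Ω(θ)` for its eigenvalue `ω_i(θ)`. -/
def bandProj (V : Lattice d → Matrix (Fin n) (Fin n) ℝ) (i : Fin n) (θ : Fin d → ℝ) :
    Matrix (Fin n) (Fin n) ℂ :=
  cfc (fun t : ℝ => if t = omega V i θ then (1 : ℝ) else 0) (Omega V θ)

/-- The multiplicity `r = tr Π` of the eigenvalue `ω_i(θ)`. -/
def bandMult (V : Lattice d → Matrix (Fin n) (Fin n) ℝ) (i : Fin n) (θ : Fin d → ℝ) : ℕ :=
  (Finset.univ.filter fun j => omega V j θ = omega V i θ).card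

/-- The partial derivative `∂ω_i/∂θ_l`. -/
def dOmega (V : Lattice d → Matrix (Fin n) (Fin n) ℝ) (i : Fin n) (l : Fin d)
    (θ : Fin d → ℝ) : ℝ :=
  deriv (fun t : ℝ => omega V i (Function.update θ l t)) (θ l)

/-- No `∂_{θ_l} ω_i` vanishes identically (outside the null set of band crossings). -/
def NonflatBands (V : Lattice d → Matrix (Fin n) (Fin n) ℝ) : Prop :=
  ∀ (l : Fin d) (i : Fin n), ¬ ∀ᵐ θ : Fin d → ℝ, dOmega V i l θ = 0

end Interaction

section Reservoirs

variable {d n : ℕ}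

/-- A translation-invariant probability measure on configurations on `ℤ^d`, with zero mean and
finite second moments. -/
structure IsReservoir (μ : Measure (Config d n)) : Prop where
  prob : IsProbabilityMeasure μ
  invariant : ∀ h : Lattice d, μ.map (fun Y x => Y (x - h)) = μ
  memLp : ∀ x a, MemLp (fun Y : Config d n => Y x a) 2 μ
  mean_zero : ∀ x a, ∫ Y, Y x a ∂μ = 0

/-- The correlation matrix `q(z) = E (Y(z) ⊗ Y(0))`, so that `E (Y(x) ⊗ Y(y)) = q(x - y)`. -/
def corr (μ : Measure (Config d n)) (z : Lattice d) : Matrix (Fin n ⊕ Fin n) (Fin n ⊕ Fin n) ℝ :=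
  Matrix.of fun a b => ∫ Y, Y z a * Y 0 b ∂μ

/-- The Fourier transform of the correlation matrix of the Gibbs measure at temperature `T`. -/
def gibbsHat (V : Lattice d → Matrix (Fin n) (Fin n) ℝ) (T : ℝ) (θ : Fin d → ℝ) :
    Matrix (Fin n ⊕ Fin n) (Fin n ⊕ Fin n) ℂ :=
  Matrix.fromBlocks ((T : ℂ) • (fourier V θ)⁻¹) 0 0 ((T : ℂ) • 1)

end Reservoirs

section LimitCovariance

variable {d n k : ℕ}

/-- The index set `𝒩^k_+` of all `𝐧 = (n_1, …, n_k)` with `n_1 = 2` and `n_j ∈ {1, 2}`. -/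
def halfIndex (k : ℕ) [NeZero k] : Finset (Fin k → ℕ) :=
  Fintype.piFinset fun j => if j = 0 then {2} else {1, 2}

/-- For `P = {p_1, …, p_m}`: the product of all `sgn(∂ω_i/∂θ_{p})` and all `(-1)^{n_{p}}`, `p ∈ P`. -/
def signProd (hk : k ≤ d) (V : Lattice d → Matrix (Fin n) (Fin n) ℝ) (nn : Fin k → ℕ)
    (i : Fin n) (P : Finset (Fin k)) (θ : Fin d → ℝ) : ℝ :=
  (∏ p ∈ P, Real.sign (dOmega V i (Fin.castLE hk p) θ)) * (-1) ^ (∑ p ∈ P, nn p)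

/-- The sum of the sign products over all `m`-combinations with `m ∈ {1, …, k}` even. -/
def Seven (hk : k ≤ d) (V : Lattice d → Matrix (Fin n) (Fin n) ℝ) (nn : Fin k → ℕ)
    (i : Fin n) (θ : Fin d → ℝ) : ℝ :=
  ∑ m ∈ (Finset.Icc 1 k).filter Even,
    ∑ P ∈ Finset.powersetCard m (Finset.univ : Finset (Fin k)), signProd hk V nn i P θ

/-- The sum of the sign products over all `m`-combinations with `m ∈ {1, …, k}` odd. -/
def Sodd (hk : k ≤ d) (V : Lattice d → Matrix (Fin n) (Fin n) ℝ) (nn : Fin k → ℕ)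
    (i : Fin n) (θ : Fin d → ℝ) : ℝ :=
  ∑ m ∈ (Finset.Icc 1 k).filter Odd,
    ∑ P ∈ Finset.powersetCard m (Finset.univ : Finset (Fin k)), signProd hk V nn i P θ

/-- `C(θ)`, with rows `(0, Ω⁻¹)` and `(-Ω, 0)`. -/
def Cmat (V : Lattice d → Matrix (Fin n) (Fin n) ℝ) (θ : Fin d → ℝ) :
    Matrix (Fin n ⊕ Fin n) (Fin n ⊕ Fin n) ℂ :=
  Matrix.fromBlocks 0 (Omega V θ)⁻¹ (-Omega V θ) 0

/-- `C*(θ)`, with rows `(0, -Ω)` and `(Ω⁻¹, 0)`. -/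
def CmatStar (V : Lattice d → Matrix (Fin n) (Fin n) ℝ) (θ : Fin d → ℝ) :
    Matrix (Fin n ⊕ Fin n) (Fin n ⊕ Fin n) ℂ :=
  Matrix.fromBlocks 0 (-Omega V θ) (Omega V θ)⁻¹ 0

/-- `L_1^+(q̂) = (q̂ + C q̂ C*) / 2`. -/
def L1plus (V : Lattice d → Matrix (Fin n) (Fin n) ℝ) (θ : Fin d → ℝ)
    (q : Matrix (Fin n ⊕ Fin n) (Fin n ⊕ Fin n) ℂ) : Matrix (Fin n ⊕ Fin n) (Fin n ⊕ Fin n) ℂ :=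
  (1 / 2 : ℂ) • (q + Cmat V θ * q * CmatStar V θ)

/-- `L_2^-(q̂) = (C q̂ - q̂ C*) / 2`. -/
def L2minus (V : Lattice d → Matrix (Fin n) (Fin n) ℝ) (θ : Fin d → ℝ)
    (q : Matrix (Fin n ⊕ Fin n) (Fin n ⊕ Fin n) ℂ) : Matrix (Fin n ⊕ Fin n) (Fin n ⊕ Fin n) ℂ :=
  (1 / 2 : ℂ) • (Cmat V θ * q - q * CmatStar V θ)

/-- `𝐌^+_{k,σ}(θ)`, with the sum over `𝒩^k_+`. -/
def Mplus [NeZero k] (hk : k ≤ d) (V : Lattice d → Matrix (Fin n) (Fin n) ℝ)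
    (μ : (Fin k → ℕ) → Measure (Config d n)) (i : Fin n) (θ : Fin d → ℝ) :
    Matrix (Fin n ⊕ Fin n) (Fin n ⊕ Fin n) ℂ :=
  (1 / 2 ^ k : ℂ) • ∑ nn ∈ halfIndex k,
    ((1 + Seven hk V nn i θ : ℝ) : ℂ) • L1plus V θ (fourier (corr (μ nn)) θ)

/-- `𝐌^-_{k,σ}(θ)`, with the sum over `𝒩^k_+`. -/
def Mminus [NeZero k] (hk : k ≤ d) (V : Lattice d → Matrix (Fin n) (Fin n) ℝ)
    (μ : (Fin k → ℕ) → Measure (Config d n)) (i : Fin n) (θ : Fin d → ℝ) :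
    Matrix (Fin n ⊕ Fin n) (Fin n ⊕ Fin n) ℂ :=
  (1 / 2 ^ k : ℂ) • ∑ nn ∈ halfIndex k,
    ((Sodd hk V nn i θ : ℝ) : ℂ) • L2minus V θ (fourier (corr (μ nn)) θ)

/-- `q̂^+_∞(θ) = ∑_σ Π_σ (𝐌^+_{k,σ} + i 𝐌^-_{k,σ}) Π_σ`, where `Π_σ` acts on both components. -/
def qInfHat [NeZero k] (hk : k ≤ d) (V : Lattice d → Matrix (Fin n) (Fin n) ℝ)
    (μ : (Fin k → ℕ) → Measure (Config d n)) (θ : Fin d → ℝ) :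
    Matrix (Fin n ⊕ Fin n) (Fin n ⊕ Fin n) ℂ :=
  ∑ i ∈ bands V θ,
    Matrix.fromBlocks (bandProj V i θ) 0 0 (bandProj V i θ) *
      (Mplus hk V μ i θ + Complex.I • Mminus hk V μ i θ) *
      Matrix.fromBlocks (bandProj V i θ) 0 0 (bandProj V i θ)

/-- The Fourier multiplier of the four image terms. -/
def imagePhase [NeZero d] (x y : Lattice d) (θ : Fin d → ℝ) : ℂ :=
  Complex.exp (-Complex.I * (pairing (x - y) θ : ℂ))
    - Complex.exp (-Complex.I * (pairing (x - reflect y) θ : ℂ))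
    - Complex.exp (-Complex.I * (pairing (reflect x - y) θ : ℂ))
    + Complex.exp (-Complex.I * (pairing (reflect x - reflect y) θ : ℂ))

/-- The limit covariance
`Q^+_∞(x,y) = q^+_∞(x-y) - q^+_∞(x-y_-) - q^+_∞(x_- - y) + q^+_∞(x_- - y_-)`. The four inverse Fourier
transforms are written as one integral: its integrand is always integrable, also when `q̂^+_∞`
alone is not. -/
def QInf [NeZero d] [NeZero k] (hk : k ≤ d) (V : Lattice d → Matrix (Fin n) (Fin n) ℝ)
    (μ : (Fin k → ℕ) → Measure (Config d n)) (x y : Lattice d) :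
    Matrix (Fin n ⊕ Fin n) (Fin n ⊕ Fin n) ℂ :=
  Matrix.of fun a b =>
    (1 / (2 * Real.pi) ^ d : ℂ) * ∫ θ in torus d, imagePhase x y θ * qInfHat hk V μ θ a b

end LimitCovariance

section Current

variable {d n k : ℕ} [NeZero d]

/-- The interaction kernel `V(x-y) - V(x-y_-)` of the half-space dynamics
`ü(x) = -∑_{y ∈ ℤ^d_+} (V(x-y) - V(x-y_-)) u(y)`. -/
def halfKernel (V : Lattice d → Matrix (Fin n) (Fin n) ℝ) (x y : Lattice d) :
    Matrix (Fin n) (Fin n) ℝ :=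
  V (x - y) - V (x - reflect y)

/-- The site `x + m e_l`. -/
def shift (l : Fin d) (x : Lattice d) (m : ℤ) : Lattice d := Function.update x l (x l + m)

open Classical in
/-- The weight of the pair `x + m e_l`, `y = y' + p e_l` (where `y'_l = x_l`) in the current at `x`
in the direction `e_l`: it is `1` if `m ≤ -1` and `p ≥ 0`, it is `-1` if `m ≥ 0` and `p ≤ -1`, and
only sites of the half-space `{x_1 ≥ 0}` count. -/
def cutSign (l : Fin d) (x : Lattice d) (m : ℤ) (y : Lattice d) : ℝ :=
  if 0 ≤ shift l x m 0 ∧ 0 ≤ y 0 then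
    if m ≤ -1 ∧ 0 ≤ y l - x l then 1
    else if 0 ≤ m ∧ y l - x l ≤ -1 then -1
    else 0
  else 0

/-- The energy current density of a configuration `Y = (u, u̇)` at the site `x` in the direction `e_l`:
half the signed sum of `(u̇(x + m e_l), (V(x + m e_l - y) - V(x + m e_l - y_-)) u(y))`. -/
def energyCurrent (V : Lattice d → Matrix (Fin n) (Fin n) ℝ) (l : Fin d) (x : Lattice d)
    (Y : Config d n) : ℝ :=
  1 / 2 * ∑' my : ℤ × Lattice d, cutSign l x my.1 my.2 *
    ∑ a, ∑ b, Y (shift l x my.1) (Sum.inr a) * halfKernel V (shift l x my.1) my.2 a b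
      * Y my.2 (Sum.inl b)

/-- A term of the limiting current:
`tr [Q^{10}_∞(X, y) (V(X-y) - V(X-y_-))^T]` with its weight, where `X = x + m e_l`. -/
def currentTerm [NeZero k] (hk : k ≤ d) (V : Lattice d → Matrix (Fin n) (Fin n) ℝ)
    (μ : (Fin k → ℕ) → Measure (Config d n)) (l : Fin d) (x : Lattice d)
    (my : ℤ × Lattice d) : ℂ :=
  (cutSign l x my.1 my.2 : ℂ) *
    ((QInf hk V μ (shift l x my.1) my.2).toBlocks₂₁ *
      ((halfKernel V (shift l x my.1) my.2)ᵀ.map Complex.ofReal)).trace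

/-- The limiting energy current density `J^l_{+,∞}` at the site `x`. -/
def limitCurrent [NeZero k] (hk : k ≤ d) (V : Lattice d → Matrix (Fin n) (Fin n) ℝ)
    (μ : (Fin k → ℕ) → Measure (Config d n)) (l : Fin d) (x : Lattice d) : ℂ :=
  1 / 2 * ∑' my : ℤ × Lattice d, currentTerm hk V μ l x my

/-- The coefficient `c_l(x_1)` of the half-space. -/
def cHalf (V : Lattice d → Matrix (Fin n) (Fin n) ℝ) (l : Fin d) (x1 : ℤ) : ℝ :=
  2 / (2 * Real.pi) ^ d * ∫ θ in torus d, ∑ i ∈ bands V θ,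
    (bandMult V i θ : ℝ) * Real.sin (θ 0 * x1) ^ 2 * |dOmega V i l θ|

/-- The coefficient `c_l` of the full space. -/
def cFull (V : Lattice d → Matrix (Fin n) (Fin n) ℝ) (l : Fin d) : ℝ :=
  1 / (2 * Real.pi) ^ d * ∫ θ in torus d, ∑ i ∈ bands V θ,
    (bandMult V i θ : ℝ) * |dOmega V i l θ|

/-- The sum over `n_2, …, n_{l-1}, n_{l+1}, …, n_k ∈ {1, 2}` (with `n_1 = 2`) of
`T_𝐧|_{n_l = 2} - T_𝐧|_{n_l = 1}`. -/
def tempDiff [NeZero k] (T : (Fin k → ℕ) → ℝ) (l : Fin k) : ℝ :=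
  ∑ nn ∈ (halfIndex k).filter (fun nn => nn l = 2), (T nn - T (Function.update nn l 1))

end Current

section Symmetry

variable {d n k : ℕ}

/-- `ω_i` is even in the variable `θ_l`. -/
def EvenIn (V : Lattice d → Matrix (Fin n) (Fin n) ℝ) (i : Fin n) (l : Fin d) : Prop :=
  ∀ θ : Fin d → ℝ, omega V i (Function.update θ l (-θ l)) = omega V i θ

/-- `ω_i` is even in some `k - 1` of the variables `θ_1, …, θ_k`. -/
def EvenInAllButOne (hk : k ≤ d) (V : Lattice d → Matrix (Fin n) (Fin n) ℝ) (i : Fin n) : Prop :=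
  ∃ P : Finset (Fin k), P.card = k - 1 ∧ ∀ p ∈ P, EvenIn V i (Fin.castLE hk p)

/-- The symmetry condition on the dispersion relations: one of the cases (a), (b), (c). -/
def SymmetryCondition (hk : k ≤ d) (V : Lattice d → Matrix (Fin n) (Fin n) ℝ) : Prop :=
  (∀ i, (∀ l : Fin d, k ≤ l.val → EvenIn V i l) ∧ (2 ≤ k → EvenInAllButOne hk V i)) ∨
  (∀ i, ∀ p : Fin k, EvenIn V i (Fin.castLE hk p)) ∨
  (∀ i, (∀ p : Fin k, ∃ s : ℝ → ℝ, ∀ᵐ θ : Fin d → ℝ,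
      Real.sign (dOmega V i (Fin.castLE hk p) θ) = s (θ (Fin.castLE hk p))) ∧
    (3 ≤ k → EvenInAllButOne hk V i))

end Symmetry

end HarmonicCrystal

end

/-! The four image terms combine into one Fourier multiplier, `4 sin(x_1 θ_1) sin(y_1 θ_1)` times a
phase in the other variables (`imagePhase_eq`). Its modulus is at most `4 |x_1| |y_1| sin²(θ_1)`.
Since `Ω⁻¹ Ω⁻¹ = V̂⁻¹` and `C` enters `q̂^+_∞` at most quadratically, `q̂^+_∞` is bounded by a
multiple of `1 + ‖V̂⁻¹‖` (`entrySum_qInfHat_le`). So the covariance integral converges and grows at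
most like `|x_1| |y_1|`, which the exponential decay of `V` absorbs: a bond crossing the cut is at
least as long as the distance of its first end from `x` (`exists_summable_current_bound`). The same
majorant justifies the interchange of expectation and series.

In the direction `e_1`, exchanging the first coordinates of `X` and `y` preserves the covariance and
the kernel and reverses the sign of the crossing, so the current equals its own negative.

In a transverse direction everything is invariant under translation along `e_l`. Summing over the
translates of a bond counts its crossings and gives the weight `w_l - x_l`. Because the covariance
is odd under reflection of one site, the image part of the kernel unfolds the half-space sum into a
sum over the whole lattice (`tsum_densityCurrentTerm`). Summed against `V` under the integral, the
image phases produce `4 sin²(θ_1 x_1) ∂_l V̂` up to a factor `-i` (`hasSum_imagePhase_mul`,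
`tsum_coord_bondTerm`).

For Gibbs reservoirs the velocity-displacement block of `q̂^+_∞` is a sum of terms `Π_σ Ω⁻¹ Π_σ`
with sign coefficients, and `tr (Π_σ Ω⁻¹ Π_σ ∂_l V̂) = 2 r_σ ∂_l ω_σ` by the Hellmann–Feynman
formula. No smooth choice of bands is needed: the ordered eigenvalues are Lipschitz by Ky Fan's
principle, hence so are the `ω_i` when `det V̂` has no zeros, and Rademacher's theorem gives
differentiability almost everywhere. At such a point Hellmann–Feynman holds even at a crossing,
because the Ky Fan inequalities become equalities there (`deriv_sortedEig`).

It remains to integrate `sin²(θ_1 x_1) ∂_l ω ∏_{p ∈ P} sgn ∂_p ω` for sets `P` of odd size. Under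
the symmetry condition this vanishes unless `P = {l}` (`setIntegral_signDensity_eq_zero`), either by
a reflection of one variable or because `∂_l ω` has mean zero over a period in `θ_l`. For `P = {l}`
the product is `|∂_l ω|`, and the alternating sum over the reservoirs gives the temperature
differences. The limit `x_1 → ∞` is the Riemann–Lebesgue lemma. -/

noncomputable section

namespace HarmonicCrystal

/-! ### Ordered eigenvalues: Ky Fan's principle, Lipschitz dependence, Hellmann–Feynman. -/

section SpectralTheory

variable {n : ℕ}

/-- The eigenvalues of a Hermitian matrix in nondecreasing order. -/
def sortedEig (A : Matrix (Fin n) (Fin n) ℂ) (i : Fin n) : ℝ :=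
  if h : A.IsHermitian then h.eigenvalues₀ (Fin.cast (Fintype.card_fin n).symm i.rev) else 0

lemma sortedEig_mono (A : Matrix (Fin n) (Fin n) ℂ) : Monotone (sortedEig A) := by
  intro i j hij
  unfold sortedEig
  split_ifs with h
  · apply h.eigenvalues₀_antitone
    simpa using Fin.rev_le_rev.2 hij
  · exact le_rfl

lemma sortedEig_eq_of_charpoly_eq {A B : Matrix (Fin n) (Fin n) ℂ} (hA : A.IsHermitian)
    (hB : B.IsHermitian) (h : A.charpoly = B.charpoly) : sortedEig A = sortedEig B := by
  have h0 : hA.eigenvalues₀ = hB.eigenvalues₀ := by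
    simp_rw [← List.ofFn_inj, ← Matrix.IsHermitian.sort_roots_charpoly_eq_eigenvalues₀, h]
  funext i
  simp [sortedEig, hA, hB, h0]

/-- A unitary matrix diagonalizing `A` with the eigenvalues in nondecreasing order. -/
structure Diagonalizes (U A : Matrix (Fin n) (Fin n) ℂ) : Prop where
  star_mul : Uᴴ * U = 1
  mul_star : U * Uᴴ = 1
  cfc_eq : ∀ f : ℝ → ℝ, cfc f A = U * diagonal (fun j => (f (sortedEig A j) : ℂ)) * Uᴴ

lemma exists_diagonalizes {A : Matrix (Fin n) (Fin n) ℂ} (hA : A.IsHermitian) :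
    ∃ U, Diagonalizes U A := by
  -- The eigenvector basis is indexed through an auxiliary bijection, and `eigenvalues₀` is
  -- nonincreasing. The permutation `e` undoes both, so that column `j` belongs to the `j`-th
  -- eigenvalue in nondecreasing order.
  let e : Fin n ≃ Fin n := Fin.revPerm.trans ((finCongr (Fintype.card_fin n).symm).trans
    (Fintype.equivOfCardEq (Fintype.card_fin _)))
  have he : ∀ j, hA.eigenvalues (e j) = sortedEig A j := by
    intro j
    simp [Matrix.IsHermitian.eigenvalues, sortedEig, hA, e]
  let W : Matrix (Fin n) (Fin n) ℂ := hA.eigenvectorUnitary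
  have hW1 : Wᴴ * W = 1 := Unitary.coe_star_mul_self hA.eigenvectorUnitary
  have hW2 : W * Wᴴ = 1 := Unitary.coe_mul_star_self hA.eigenvectorUnitary
  refine ⟨W.submatrix id e, ?_, ?_, ?_⟩
  · rw [conjTranspose_submatrix, ← submatrix_mul _ _ _ _ _ Function.bijective_id, hW1]
    simp
  · rw [conjTranspose_submatrix, ← submatrix_mul _ _ _ _ _ e.bijective, hW2]
    simp
  · intro f
    rw [hA.cfc_eq f, Matrix.IsHermitian.cfc, Unitary.conjStarAlgAut_apply]
    have hd : diagonal (fun j => (f (sortedEig A j) : ℂ))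
        = (diagonal (RCLike.ofReal ∘ f ∘ hA.eigenvalues)).submatrix e e := by
      rw [submatrix_diagonal _ _ e.injective]
      congr 1
      funext j
      simp [he]
    rw [hd, conjTranspose_submatrix, ← submatrix_mul _ _ _ _ _ e.bijective,
      ← submatrix_mul _ _ _ _ _ e.bijective]
    rfl

namespace Diagonalizes

variable {U A : Matrix (Fin n) (Fin n) ℂ}

lemma eq (h : Diagonalizes U A) (hA : A.IsHermitian) :
    A = U * diagonal (fun j => (sortedEig A j : ℂ)) * Uᴴ := by
  exact (cfc_id ℝ A hA).symm.trans (h.cfc_eq id)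

lemma conj_mul (h : Diagonalizes U A) (B C : Matrix (Fin n) (Fin n) ℂ) :
    (U * B * Uᴴ) * (U * C * Uᴴ) = U * (B * C) * Uᴴ := by
  calc _ = U * B * (Uᴴ * U) * C * Uᴴ := by simp only [Matrix.mul_assoc]
    _ = _ := by rw [h.star_mul]; simp only [Matrix.mul_assoc, Matrix.one_mul]

lemma conj_self (h : Diagonalizes U A) (hA : A.IsHermitian) :
    Uᴴ * A * U = diagonal (fun j => (sortedEig A j : ℂ)) := by
  conv_lhs => rw [h.eq hA]
  calc _ = (Uᴴ * U) * diagonal (fun j => (sortedEig A j : ℂ)) * (Uᴴ * U) := by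
        simp only [Matrix.mul_assoc]
    _ = _ := by rw [h.star_mul]; simp

end Diagonalizes

/-- The average of a nondecreasing sequence with weights `c i ∈ [0,1]` of total mass `m`
dominates the sum of its first `m` entries. -/
lemma sum_filter_le_weighted {lam c : Fin n → ℝ} (hl : Monotone lam) (hc0 : ∀ i, 0 ≤ c i)
    (hc1 : ∀ i, c i ≤ 1) (m : ℕ)
    (hc : ∑ i, c i = ((Finset.univ.filter fun i : Fin n => i.val < m).card : ℝ)) :
    ∑ i ∈ Finset.univ.filter (fun i : Fin n => i.val < m), lam i ≤ ∑ i, c i * lam i := by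
  rcases Nat.lt_or_ge m n with hm | hm
  -- Comparison with the threshold value `lam m`: below `m` the weight 1 exceeds `c i` and `lam i -
  -- lam m ≤ 0`; from `m` on the weight 0 is below `c i` and the difference is nonnegative. The
  -- equal total masses remove the threshold after summation.
  · have key : ∀ i, (if i.val < m then (1 : ℝ) else 0) * (lam i - lam ⟨m, hm⟩)
        ≤ c i * (lam i - lam ⟨m, hm⟩) := by
      intro i
      split_ifs with h
      · have : lam i ≤ lam ⟨m, hm⟩ := hl (by rw [Fin.le_def]; exact h.le)
        nlinarith [hc1 i]
      · have : lam ⟨m, hm⟩ ≤ lam i := hl (by rw [Fin.le_def]; simpa using h)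
        nlinarith [hc0 i]
    have hs := Finset.sum_le_sum fun i (_ : i ∈ Finset.univ) => key i
    simp only [mul_sub, Finset.sum_sub_distrib, ← Finset.sum_mul, hc] at hs
    rw [Finset.sum_boole] at hs
    simp only [ite_mul, one_mul, zero_mul] at hs
    rw [Finset.sum_filter]
    linarith
  · have hf : (Finset.univ.filter fun i : Fin n => i.val < m) = Finset.univ :=
      Finset.filter_true_of_mem fun i _ => i.2.trans_le hm
    rw [hf] at hc ⊢
    have h0 : ∑ i, (1 - c i) = 0 := by simp [hc]
    have h1 : ∀ i, c i = 1 := by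
      intro i
      have := (Finset.sum_eq_zero_iff_of_nonneg fun i _ => sub_nonneg.2 (hc1 i)).1 h0 i (by simp)
      linarith
    simp [h1]

/-- With `lam = 1` this expresses the squared norm of a column, which is how unitarity is used in
the sequel. -/
lemma diag_conj_diagonal (W : Matrix (Fin n) (Fin n) ℂ) (lam : Fin n → ℝ) (j : Fin n) :
    ((Wᴴ * diagonal (fun i => (lam i : ℂ)) * W) j j).re = ∑ i, ‖W i j‖ ^ 2 * lam i := by
  rw [Matrix.mul_apply]
  simp only [mul_diagonal, conjTranspose_apply, Complex.re_sum]
  refine Finset.sum_congr rfl fun i _ => ?_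
  have : star (W i j) * (lam i : ℂ) * W i j = ((‖W i j‖ ^ 2 * lam i : ℝ) : ℂ) := by
    push_cast
    rw [← Complex.conj_mul']
    simp only [Complex.star_def]; ring
  rw [this, Complex.ofReal_re]

/-- Ky Fan's minimum principle. -/
lemma sum_sortedEig_le {U A A' : Matrix (Fin n) (Fin n) ℂ} (hU : Diagonalizes U A)
    (hA' : A'.IsHermitian) (m : ℕ) :
    ∑ j ∈ Finset.univ.filter (fun i : Fin n => i.val < m), sortedEig A' j ≤
      ∑ j ∈ Finset.univ.filter (fun i : Fin n => i.val < m), ((Uᴴ * A' * U) j j).re := by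
  obtain ⟨U', hU'⟩ := exists_diagonalizes hA'
  -- `W` is unitary, so the numbers `‖W i j‖²` form a doubly stochastic matrix. The partial trace is
  -- then an average of the eigenvalues of `A'` whose weights, the partial row sums, lie in `[0,
  -- 1]`, while the column sums fix their total mass.
  set W := U'ᴴ * U with hW
  have hW1 : Wᴴ * W = 1 := by
    rw [hW, conjTranspose_mul, conjTranspose_conjTranspose]
    calc _ = Uᴴ * (U' * U'ᴴ) * U := by simp only [Matrix.mul_assoc]
      _ = 1 := by rw [hU'.mul_star, Matrix.mul_one, hU.star_mul]
  have hW2 : W * Wᴴ = 1 := by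
    rw [hW, conjTranspose_mul, conjTranspose_conjTranspose]
    calc _ = U'ᴴ * (U * Uᴴ) * U' := by simp only [Matrix.mul_assoc]
      _ = 1 := by rw [hU.mul_star, Matrix.mul_one, hU'.star_mul]
  have hcol : ∀ j, ∑ i, ‖W i j‖ ^ 2 = 1 := by
    intro j
    have := diag_conj_diagonal W (fun _ => 1) j
    simp only [Complex.ofReal_one, diagonal_one, hW1, mul_one] at this
    simpa using this.symm
  have hrow : ∀ i, ∑ j, ‖W i j‖ ^ 2 = 1 := by
    intro i
    have := diag_conj_diagonal Wᴴ (fun _ => 1) i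
    simp only [Complex.ofReal_one, diagonal_one, conjTranspose_conjTranspose, hW2,
      mul_one] at this
    simpa using this.symm
  have hconj : Uᴴ * A' * U = Wᴴ * diagonal (fun i => (sortedEig A' i : ℂ)) * W := by
    conv_lhs => rw [hU'.eq hA']
    rw [hW, conjTranspose_mul, conjTranspose_conjTranspose]
    simp only [Matrix.mul_assoc]
  simp_rw [hconj, diag_conj_diagonal]
  rw [Finset.sum_comm]
  simp_rw [← Finset.sum_mul]
  refine sum_filter_le_weighted (sortedEig_mono A') (fun i => by positivity) (fun i => ?_) m ?_
  · rw [← hrow i]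
    exact Finset.sum_le_sum_of_subset_of_nonneg (Finset.filter_subset _ _) fun _ _ _ => by positivity
  · rw [Finset.sum_comm]
    simp [hcol]

lemma Diagonalizes.norm_apply_le_one {U A : Matrix (Fin n) (Fin n) ℂ} (hU : Diagonalizes U A)
    (a j : Fin n) : ‖U a j‖ ≤ 1 := by
  have h := diag_conj_diagonal U (fun _ => 1) j
  simp only [Complex.ofReal_one, diagonal_one, hU.star_mul, mul_one] at h
  have h1 : ‖U a j‖ ^ 2 ≤ 1 := by
    have h2 : ∑ i, ‖U i j‖ ^ 2 = 1 := by simpa using h.symm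
    rw [← h2]
    exact Finset.single_le_sum (f := fun i => ‖U i j‖ ^ 2) (fun i _ => by positivity)
      (Finset.mem_univ a)
  nlinarith [norm_nonneg (U a j)]

lemma Diagonalizes.abs_conj_diag_le {U A : Matrix (Fin n) (Fin n) ℂ} (hU : Diagonalizes U A)
    (B : Matrix (Fin n) (Fin n) ℂ) (j : Fin n) :
    |((Uᴴ * B * U) j j).re| ≤ ∑ a, ∑ b, ‖B a b‖ := by
  refine (Complex.abs_re_le_norm _).trans ?_
  simp only [Matrix.mul_apply, conjTranspose_apply]
  refine (norm_sum_le _ _).trans ?_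
  rw [Finset.sum_comm (f := fun a b => ‖B a b‖)]
  refine Finset.sum_le_sum fun b _ => ?_
  rw [norm_mul]
  have h1 : ‖∑ a, star (U a j) * B a b‖ ≤ ∑ a, ‖B a b‖ := by
    refine (norm_sum_le _ _).trans (Finset.sum_le_sum fun a _ => ?_)
    rw [norm_mul, norm_star]
    exact mul_le_of_le_one_left (norm_nonneg _) (hU.norm_apply_le_one a j)
  calc _ ≤ (∑ a, ‖B a b‖) * 1 := by
        gcongr
        exact hU.norm_apply_le_one b j
    _ = _ := mul_one _

/-- The eigenbasis of `A` serves as a trial frame for `A'` in Ky Fan's principle; the factor `n` is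
a crude count of the diagonal entries. -/
lemma sum_sortedEig_sub_le {A A' : Matrix (Fin n) (Fin n) ℂ} (hA : A.IsHermitian)
    (hA' : A'.IsHermitian) (m : ℕ) :
    ∑ j ∈ Finset.univ.filter (fun i : Fin n => i.val < m), sortedEig A' j -
      ∑ j ∈ Finset.univ.filter (fun i : Fin n => i.val < m), sortedEig A j
      ≤ n * ∑ a, ∑ b, ‖A' a b - A a b‖ := by
  obtain ⟨U, hU⟩ := exists_diagonalizes hA
  have h1 := sum_sortedEig_le hU hA' m
  have h2 : ∀ j, ((Uᴴ * A * U) j j).re = sortedEig A j := by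
    intro j; rw [hU.conj_self hA]; simp
  have h3 : ∀ j, ((Uᴴ * A' * U) j j).re - sortedEig A j ≤ ∑ a, ∑ b, ‖A' a b - A a b‖ := by
    intro j
    have := hU.abs_conj_diag_le (A' - A) j
    rw [Matrix.mul_sub, Matrix.sub_mul, Matrix.sub_apply, Complex.sub_re, h2] at this
    exact (le_abs_self _).trans this
  calc _ ≤ ∑ j ∈ Finset.univ.filter (fun i : Fin n => i.val < m),
        (((Uᴴ * A' * U) j j).re - sortedEig A j) := by
        rw [Finset.sum_sub_distrib]; linarith
    _ ≤ ∑ j ∈ Finset.univ.filter (fun i : Fin n => i.val < m), ∑ a, ∑ b, ‖A' a b - A a b‖ :=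
        Finset.sum_le_sum fun j _ => h3 j
    _ ≤ ∑ j : Fin n, ∑ a, ∑ b, ‖A' a b - A a b‖ :=
        Finset.sum_le_sum_of_subset_of_nonneg (Finset.filter_subset _ _)
          fun _ _ _ => by positivity
    _ = _ := by simp

lemma sum_filter_lt_succ (f : Fin n → ℝ) (j : Fin n) :
    ∑ i ∈ Finset.univ.filter (fun i : Fin n => i.val < j.val + 1), f i
      = ∑ i ∈ Finset.univ.filter (fun i : Fin n => i.val < j.val), f i + f j := by
  have : (Finset.univ.filter fun i : Fin n => i.val < j.val + 1)
      = insert j (Finset.univ.filter fun i : Fin n => i.val < j.val) := by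
    ext i
    simp only [Finset.mem_filter, Finset.mem_univ, true_and, Finset.mem_insert, Fin.ext_iff]
    omega
  rw [this, Finset.sum_insert (by simp), add_comm]

/-- The sorted eigenvalues depend on the matrix in a Lipschitz way. -/
lemma abs_sortedEig_sub_le {A A' : Matrix (Fin n) (Fin n) ℂ} (hA : A.IsHermitian)
    (hA' : A'.IsHermitian) (j : Fin n) :
    |sortedEig A' j - sortedEig A j| ≤ 2 * n * ∑ a, ∑ b, ‖A' a b - A a b‖ := by
  -- A single eigenvalue is the difference of two consecutive partial sums, hence the factor 2.
  have h1 := sum_sortedEig_sub_le hA hA' (j.val + 1)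
  have h2 := sum_sortedEig_sub_le hA hA' j.val
  have h3 := sum_sortedEig_sub_le hA' hA (j.val + 1)
  have h4 := sum_sortedEig_sub_le hA' hA j.val
  simp only [sum_filter_lt_succ] at h1 h3
  simp only [norm_sub_rev (A _ _) (A' _ _)] at h3 h4
  rw [abs_le]
  constructor <;> linarith

/-- The Hellmann–Feynman formula, at a point where all sorted eigenvalues are differentiable. -/
lemma deriv_sortedEig {A : ℝ → Matrix (Fin n) (Fin n) ℂ} {A' : Matrix (Fin n) (Fin n) ℂ} {t₀ : ℝ}
    (hA : ∀ t, (A t).IsHermitian) (hA' : ∀ a b, HasDerivAt (fun t => A t a b) (A' a b) t₀)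
    (hd : ∀ j, DifferentiableAt ℝ (fun t => sortedEig (A t) j) t₀)
    {U : Matrix (Fin n) (Fin n) ℂ} (hU : Diagonalizes U (A t₀)) (j : Fin n) :
    deriv (fun t => sortedEig (A t) j) t₀ = ((Uᴴ * A' * U) j j).re := by
  have hB : ∀ j, HasDerivAt (fun t => ((Uᴴ * A t * U) j j).re) ((Uᴴ * A' * U) j j).re t₀ := by
    intro j
    have : HasDerivAt (fun t => (Uᴴ * A t * U) j j) ((Uᴴ * A' * U) j j) t₀ := by
      simp only [Matrix.mul_apply]
      refine HasDerivAt.fun_sum fun b _ => HasDerivAt.mul_const (HasDerivAt.fun_sum fun a _ => ?_) _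
      exact (hA' a b).const_mul _
    exact Complex.reCLM.hasFDerivAt.comp_hasDerivAt t₀ this
  -- By Ky Fan, the partial trace in the frame frozen at `t₀` exceeds the partial sum of eigenvalues
  -- for every `t`, with equality at `t₀`. So `t₀` is a minimum of the difference and its derivative
  -- vanishes. Multiple eigenvalues cause no difficulty.
  have hF : ∀ m : ℕ, ∑ j ∈ Finset.univ.filter (fun i : Fin n => i.val < m),
      (((Uᴴ * A' * U) j j).re - deriv (fun t => sortedEig (A t) j) t₀) = 0 := by
    intro m
    refine IsLocalMin.hasDerivAt_eq_zero (f := fun t =>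
      ∑ j ∈ Finset.univ.filter (fun i : Fin n => i.val < m),
        (((Uᴴ * A t * U) j j).re - sortedEig (A t) j)) (a := t₀) ?_
      (HasDerivAt.fun_sum fun j _ => (hB j).sub (hd j).hasDerivAt)
    refine Filter.Eventually.of_forall fun t => ?_
    have h0 : ∀ j, ((Uᴴ * A t₀ * U) j j).re = sortedEig (A t₀) j := by
      intro j; rw [hU.conj_self (hA t₀)]; simp
    simp only [h0, sub_self, Finset.sum_const_zero]
    rw [Finset.sum_sub_distrib, sub_nonneg]
    exact sum_sortedEig_le hU (hA t) m
  have h1 := hF (j.val + 1)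
  rw [sum_filter_lt_succ, hF j.val] at h1
  linarith

/-- Two sorted eigenvalues which agree at a point of differentiability have the same derivative. -/
lemma deriv_eq_of_le {f g : ℝ → ℝ} {t₀ : ℝ} (hfg : ∀ t, f t ≤ g t) (h0 : f t₀ = g t₀)
    (hf : DifferentiableAt ℝ f t₀) (hg : DifferentiableAt ℝ g t₀) : deriv f t₀ = deriv g t₀ := by
  have : deriv g t₀ - deriv f t₀ = 0 := by
    refine IsLocalMin.hasDerivAt_eq_zero (f := fun t => g t - f t) (a := t₀) ?_
      (hg.hasDerivAt.sub hf.hasDerivAt)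
    exact Filter.Eventually.of_forall fun t => by simp [h0, hfg t]
  linarith

end SpectralTheory

/-! ### Summable product weights on the lattice. -/

section LatticeSums

variable {d : ℕ}

/-- The product weight `∏_j r^{|x_j|}`. -/
def expWeight (r : ℝ) (x : Lattice d) : ℝ := ∏ j, r ^ (x j).natAbs

/-- The product weight `∏_j (1 + |x_j|)^2 r^{|x_j|}`. -/
def polyWeight (r : ℝ) (x : Lattice d) : ℝ := ∏ j, ((1 + |(x j : ℝ)|) ^ 2 * r ^ (x j).natAbs)

lemma summable_poly_geometric {r : ℝ} (h0 : 0 ≤ r) (h1 : r < 1) :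
    Summable fun t : ℤ => (1 + |(t : ℝ)|) ^ 2 * r ^ t.natAbs := by
  have hn : Summable fun t : ℕ => (1 + (t : ℝ)) ^ 2 * r ^ t := by
    have hr : ‖r‖ < 1 := by rwa [Real.norm_of_nonneg h0]
    have e : (fun t : ℕ => (1 + (t : ℝ)) ^ 2 * r ^ t)
        = fun t : ℕ => (t : ℝ) ^ 0 * r ^ t + 2 * ((t : ℝ) ^ 1 * r ^ t) + (t : ℝ) ^ 2 * r ^ t := by
      funext t; ring
    rw [e]
    exact ((summable_pow_mul_geometric_of_norm_lt_one 0 hr).add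
      ((summable_pow_mul_geometric_of_norm_lt_one 1 hr).mul_left 2)).add
      (summable_pow_mul_geometric_of_norm_lt_one 2 hr)
  refine Summable.of_nat_of_neg ?_ ?_
  · simpa using hn
  · simpa using hn

/-- A finite set of lattice points lies in a box, and over a box the sum of the product factorizes.
-/
lemma summable_pi_prod {g : ℤ → ℝ} (hg0 : ∀ t, 0 ≤ g t) (hg : Summable g) :
    Summable fun x : Lattice d => ∏ j, g (x j) := by
  classical
  refine summable_of_sum_le (c := (∑' t, g t) ^ d)
    (fun x => Finset.prod_nonneg fun j _ => hg0 _) fun u => ?_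
  let t : Fin d → Finset ℤ := fun j => u.image fun x => x j
  have hu : u ⊆ Fintype.piFinset t := fun x hx => by
    simp only [Fintype.mem_piFinset]
    exact fun j => Finset.mem_image_of_mem (fun x : Lattice d => x j) hx
  calc ∑ x ∈ u, ∏ j, g (x j) ≤ ∑ x ∈ Fintype.piFinset t, ∏ j, g (x j) :=
        Finset.sum_le_sum_of_subset_of_nonneg hu fun _ _ _ => Finset.prod_nonneg fun j _ => hg0 _
    _ = ∏ j, ∑ s ∈ t j, g s := (Finset.prod_univ_sum t fun _ s => g s).symm
    _ ≤ ∏ _j : Fin d, ∑' s, g s := Finset.prod_le_prod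
        (fun j _ => Finset.sum_nonneg fun s _ => hg0 s)
        fun j _ => hg.sum_le_tsum _ fun s _ => hg0 s
    _ = _ := by simp

lemma summable_polyWeight {r : ℝ} (h0 : 0 ≤ r) (h1 : r < 1) :
    Summable fun x : Lattice d => polyWeight r x := by
  unfold polyWeight
  exact summable_pi_prod (g := fun t : ℤ => (1 + |(t : ℝ)|) ^ 2 * r ^ t.natAbs)
    (fun t => by positivity) (summable_poly_geometric h0 h1)

lemma expWeight_nonneg {r : ℝ} (h0 : 0 ≤ r) (x : Lattice d) : 0 ≤ expWeight r x :=
  Finset.prod_nonneg fun _ _ => by positivity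

/-- The square in `polyWeight` leaves room for two linear factors even when `i = j`. -/
lemma mul_expWeight_le_polyWeight {r : ℝ} (h0 : 0 ≤ r) (x : Lattice d) (i j : Fin d) :
    (1 + |(x i : ℝ)|) * (1 + |(x j : ℝ)|) * expWeight r x ≤ polyWeight r x := by
  rw [polyWeight, Finset.prod_mul_distrib, expWeight]
  refine mul_le_mul_of_nonneg_right ?_ (Finset.prod_nonneg fun _ _ => by positivity)
  have h1 : ∀ j : Fin d, (1 : ℝ) ≤ 1 + |(x j : ℝ)| := fun j => by
    have := abs_nonneg (x j : ℝ); linarith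
  have hs : ∀ i : Fin d, 1 + |(x i : ℝ)| ≤ ∏ j, (1 + |(x j : ℝ)|) := fun i => by
    rw [← Finset.mul_prod_erase _ _ (Finset.mem_univ i)]
    refine le_mul_of_one_le_right (by positivity) ?_
    exact Finset.one_le_prod fun j _ => h1 j
  calc _ ≤ (∏ j, (1 + |(x j : ℝ)|)) * ∏ j, (1 + |(x j : ℝ)|) :=
        mul_le_mul (hs i) (hs j) (by positivity) (Finset.prod_nonneg fun _ _ => by positivity)
    _ = _ := by rw [Finset.prod_pow, sq]

lemma expWeight_le_polyWeight {r : ℝ} (h0 : 0 ≤ r) (x : Lattice d) :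
    expWeight r x ≤ polyWeight r x := by
  refine Finset.prod_le_prod (fun j _ => by positivity) fun j _ => ?_
  refine le_mul_of_one_le_left (by positivity) ?_
  have := abs_nonneg (x j : ℝ)
  nlinarith

lemma expWeight_sq (r : ℝ) (x : Lattice d) : expWeight (r ^ 2) x = expWeight r x * expWeight r x := by
  simp only [expWeight, ← Finset.prod_mul_distrib]
  exact Finset.prod_congr rfl fun j _ => by ring

lemma expWeight_le_pow {r : ℝ} (h0 : 0 ≤ r) (h1 : r ≤ 1) (x : Lattice d) (l : Fin d) {m : ℕ}
    (hm : m ≤ (x l).natAbs) : expWeight r x ≤ r ^ m := by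
  rw [expWeight, ← Finset.mul_prod_erase _ _ (Finset.mem_univ l)]
  calc _ ≤ r ^ (x l).natAbs * 1 := by
        gcongr
        exact Finset.prod_le_one (fun _ _ => by positivity) fun _ _ => pow_le_one₀ h0 h1
    _ ≤ r ^ m := by rw [mul_one]; exact pow_le_pow_of_le_one h0 h1 hm

lemma expWeight_mono {r : ℝ} (h0 : 0 ≤ r) (h1 : r ≤ 1) {x y : Lattice d}
    (h : ∀ j, (y j).natAbs ≤ (x j).natAbs) : expWeight r x ≤ expWeight r y :=
  Finset.prod_le_prod (fun _ _ => by positivity) fun j _ => pow_le_pow_of_le_one h0 h1 (h j)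

lemma abs_le_latticeNorm (x : Lattice d) (j : Fin d) : |(x j : ℝ)| ≤ latticeNorm x := by
  rw [latticeNorm, ← Real.sqrt_sq_eq_abs]
  exact Real.sqrt_le_sqrt (Finset.single_le_sum (f := fun j => (x j : ℝ) ^ 2)
    (fun _ _ => by positivity) (Finset.mem_univ j))

/-- The bound is stated with `r ^ 2` so that the decay can be split into two equal factors, one
spent on the distance from the cut and one on polynomial growth and summability. -/
lemma ExpDecay.exists_expWeight [NeZero d] {n : ℕ} {V : Lattice d → Matrix (Fin n) (Fin n) ℝ}
    (h : ExpDecay V) : ∃ C > 0, ∃ r, 0 < r ∧ r < 1 ∧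
      ∀ x a b, |V x a b| ≤ C * expWeight (r ^ 2) x := by
  obtain ⟨C, hC, γ, hγ, hV⟩ := h
  have hd : (0 : ℝ) < d := Nat.cast_pos.2 (NeZero.pos d)
  -- The sum of the `|x_j|` is at most `d` times the Euclidean length, whence the `d`; the 2 is
  -- there because `r` gets squared.
  refine ⟨C, hC, Real.exp (-γ / (2 * d)), Real.exp_pos _, ?_, fun x a b => (hV x a b).trans ?_⟩
  · rw [Real.exp_lt_one_iff, neg_div, neg_lt_zero]; positivity
  · gcongr
    have h1 : expWeight (Real.exp (-γ / (2 * d)) ^ 2) x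
        = Real.exp (∑ j, (-γ / d) * |(x j : ℝ)|) := by
      rw [expWeight, Real.exp_sum]
      refine Finset.prod_congr rfl fun j _ => ?_
      rw [← pow_mul, ← Real.exp_nat_mul]
      congr 1
      push_cast
      rw [Nat.cast_natAbs]
      push_cast
      field_simp
    rw [h1, Real.exp_le_exp, ← Finset.mul_sum]
    have h2 : ∑ j, |(x j : ℝ)| ≤ d * latticeNorm x := by
      calc _ ≤ ∑ _j : Fin d, latticeNorm x := Finset.sum_le_sum fun j _ => abs_le_latticeNorm x j
        _ = _ := by simp
    have h3 := mul_le_mul_of_nonneg_left h2 (show 0 ≤ γ / d by positivity)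
    have h4 : γ / d * (d * latticeNorm x) = γ * latticeNorm x := by field_simp
    rw [neg_div]
    linarith

end LatticeSums

/-! ### Fourier series of summable real matrix functions. -/

section Fourier

variable {d : ℕ} {ι : Type*}

lemma pairing_add_left (x y : Lattice d) (θ : Fin d → ℝ) :
    pairing (x + y) θ = pairing x θ + pairing y θ := by
  simp [pairing, add_mul, Finset.sum_add_distrib]

lemma pairing_neg_left (x : Lattice d) (θ : Fin d → ℝ) : pairing (-x) θ = -pairing x θ := by
  simp [pairing]

lemma pairing_sub_left (x y : Lattice d) (θ : Fin d → ℝ) :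
    pairing (x - y) θ = pairing x θ - pairing y θ := by
  rw [sub_eq_add_neg, pairing_add_left, pairing_neg_left, sub_eq_add_neg]

lemma pairing_neg_right (x : Lattice d) (θ : Fin d → ℝ) : pairing x (-θ) = -pairing x θ := by
  simp [pairing]

lemma continuous_pairing (x : Lattice d) : Continuous (pairing x) := by
  unfold pairing; fun_prop

lemma norm_exp_I_mul (t : ℝ) : ‖Complex.exp (Complex.I * t)‖ = 1 := by
  rw [mul_comm]; exact Complex.norm_exp_ofReal_mul_I t

lemma norm_fourier_term (x : Lattice d) (θ : Fin d → ℝ) (c : ℝ) :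
    ‖Complex.exp (Complex.I * (pairing x θ : ℂ)) * (c : ℂ)‖ = |c| := by
  rw [norm_mul, norm_exp_I_mul, one_mul, Complex.norm_real, Real.norm_eq_abs]

variable {f : Lattice d → Matrix ι ι ℝ}

lemma summable_fourier_term {g : Lattice d → ℝ} (hg : Summable g) (θ : Fin d → ℝ) :
    Summable fun x => Complex.exp (Complex.I * (pairing x θ : ℂ)) * (g x : ℂ) := by
  refine Summable.of_norm ?_
  simp only [norm_fourier_term]
  exact hg.abs

lemma norm_fourier_le (hf : ∀ a b, Summable fun x => f x a b) (θ : Fin d → ℝ) (a b : ι) :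
    ‖fourier f θ a b‖ ≤ ∑' x, |f x a b| := by
  refine (norm_tsum_le_tsum_norm ?_).trans_eq ?_
  · simp only [norm_fourier_term]; exact (hf a b).abs
  · simp only [norm_fourier_term]

lemma continuous_fourier (hf : ∀ a b, Summable fun x => f x a b) (a b : ι) :
    Continuous fun θ => fourier f θ a b := by
  refine continuous_tsum (u := fun x => |f x a b|) (fun x => ?_) (hf a b).abs
    fun x θ => (norm_fourier_term x θ _).le
  have := continuous_pairing x
  fun_prop

lemma fourier_neg (θ : Fin d → ℝ) (a b : ι) :
    fourier f (-θ) a b = star (fourier f θ a b) := by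
  simp only [fourier, of_apply, Complex.star_def]
  rw [Complex.conj_tsum]
  refine tsum_congr fun x => ?_
  rw [map_mul, ← Complex.exp_conj, map_mul, Complex.conj_I, Complex.conj_ofReal, Complex.conj_ofReal,
    pairing_neg_right]
  push_cast
  ring_nf

lemma fourier_add_two_pi (θ : Fin d → ℝ) (m : Fin d → ℤ) :
    fourier f (fun j => θ j + m j * (2 * Real.pi)) = fourier f θ := by
  ext a b
  simp only [fourier, of_apply]
  refine tsum_congr fun x => ?_
  congr 1
  rw [Complex.exp_eq_exp_iff_exists_int]
  refine ⟨∑ j, x j * m j, ?_⟩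
  simp only [pairing]
  push_cast
  rw [Finset.mul_sum, Finset.mul_sum, Finset.sum_mul, ← Finset.sum_add_distrib]
  exact Finset.sum_congr rfl fun j _ => by ring

lemma pairing_update (x : Lattice d) (θ : Fin d → ℝ) (l : Fin d) (t : ℝ) :
    pairing x (Function.update θ l t) = pairing x (Function.update θ l 0) + x l * t := by
  simp only [pairing]
  rw [← Finset.add_sum_erase _ _ (Finset.mem_univ l),
    ← Finset.add_sum_erase _ (fun j => (x j : ℝ) * Function.update θ l 0 j) (Finset.mem_univ l)]
  simp only [Function.update_self, mul_zero, zero_add]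
  rw [add_comm]
  congr 1
  exact Finset.sum_congr rfl fun j hj => by
    simp [Function.update_of_ne (Finset.ne_of_mem_erase hj)]

lemma norm_dFourier_term (x : Lattice d) (l : Fin d) (θ : Fin d → ℝ) (c : ℝ) :
    ‖Complex.I * (x l : ℂ) * (Complex.exp (Complex.I * (pairing x θ : ℂ)) * (c : ℂ))‖
      = |(x l : ℝ)| * |c| := by
  rw [norm_mul, norm_fourier_term, norm_mul, Complex.norm_I, one_mul, ← Complex.ofReal_intCast,
    Complex.norm_real, Real.norm_eq_abs]

lemma norm_exp_sub_exp_le (s t : ℝ) :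
    ‖Complex.exp (Complex.I * s) - Complex.exp (Complex.I * t)‖ ≤ |s - t| := by
  have h1 : Complex.exp (Complex.I * s) - Complex.exp (Complex.I * t)
      = Complex.exp (Complex.I * t) * (Complex.exp (Complex.I * ((s - t : ℝ) : ℂ)) - 1) := by
    rw [mul_sub, ← Complex.exp_add, mul_one]
    push_cast; ring_nf
  rw [h1, norm_mul, norm_exp_I_mul, one_mul]
  exact Real.norm_exp_I_mul_ofReal_sub_one_le

lemma abs_pairing_sub_le (x : Lattice d) (θ η : Fin d → ℝ) :
    |pairing x θ - pairing x η| ≤ (∑ j, |(x j : ℝ)|) * ‖θ - η‖ := by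
  rw [pairing, pairing, ← Finset.sum_sub_distrib, Finset.sum_mul]
  refine (Finset.abs_sum_le_sum_abs _ _).trans (Finset.sum_le_sum fun j _ => ?_)
  rw [← mul_sub, abs_mul]
  gcongr
  exact norm_le_pi_norm (θ - η) j

end Fourier

/-! ### Regularity of the symbol of an exponentially decaying interaction. -/

section InteractionFourier

variable {d n : ℕ} [NeZero d] {V : Lattice d → Matrix (Fin n) (Fin n) ℝ}

lemma ExpDecay.summable_mul (hV : ExpDecay V) (i j : Fin d) (a b : Fin n) :
    Summable fun x => (1 + |(x i : ℝ)|) * (1 + |(x j : ℝ)|) * |V x a b| := by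
  obtain ⟨C, hC, r, hr0, hr1, h⟩ := hV.exists_expWeight
  refine Summable.of_nonneg_of_le (fun x => by positivity) (fun x => ?_)
    ((summable_polyWeight (sq_nonneg r) (by nlinarith)).mul_left C)
  calc _ ≤ (1 + |(x i : ℝ)|) * (1 + |(x j : ℝ)|) * (C * expWeight (r ^ 2) x) := by
        gcongr; exact h x a b
    _ = C * ((1 + |(x i : ℝ)|) * (1 + |(x j : ℝ)|) * expWeight (r ^ 2) x) := by ring
    _ ≤ _ := by gcongr; exact mul_expWeight_le_polyWeight (sq_nonneg r) x i j

lemma ExpDecay.summable_coord_mul (hV : ExpDecay V) (j : Fin d) (a b : Fin n) :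
    Summable fun x => |(x j : ℝ)| * |V x a b| := by
  refine Summable.of_nonneg_of_le (fun x => by positivity) (fun x => ?_) (hV.summable_mul j j a b)
  gcongr
  have := abs_nonneg (x j : ℝ)
  nlinarith

lemma ExpDecay.summable (hV : ExpDecay V) (a b : Fin n) : Summable fun x => V x a b := by
  refine Summable.of_abs (Summable.of_nonneg_of_le (fun x => by positivity) (fun x => ?_)
    (hV.summable_mul 0 0 a b))
  refine le_mul_of_one_le_left (abs_nonneg _) ?_
  have := abs_nonneg (x 0 : ℝ)
  nlinarith

/-- The first moments of `V` are summable and `t ↦ e^{it}` is 1-Lipschitz. The constants of all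
entries are added up so that one `L` serves for every entry. -/
lemma ExpDecay.exists_lipschitz (hV : ExpDecay V) :
    ∃ L : NNReal, ∀ a b, LipschitzWith L fun θ => fourier V θ a b := by
  have hS : ∀ a b, Summable fun x => (∑ j, |(x j : ℝ)|) * |V x a b| := fun a b => by
    simp_rw [Finset.sum_mul]
    exact summable_sum fun j _ => hV.summable_coord_mul j a b
  have key : ∀ a b θ η, ‖fourier V θ a b - fourier V η a b‖
      ≤ (∑' x, (∑ j, |(x j : ℝ)|) * |V x a b|) * ‖θ - η‖ := by
    intro a b θ η
    simp only [fourier, of_apply]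
    rw [← (summable_fourier_term (hV.summable a b) θ).tsum_sub
      (summable_fourier_term (hV.summable a b) η), ← tsum_mul_right]
    refine tsum_of_norm_bounded ((hS a b).mul_right _).hasSum fun x => ?_
    rw [← sub_mul, norm_mul, Complex.norm_real, Real.norm_eq_abs]
    calc _ ≤ ((∑ j, |(x j : ℝ)|) * ‖θ - η‖) * |V x a b| := by
          gcongr
          exact (norm_exp_sub_exp_le _ _).trans (abs_pairing_sub_le x θ η)
      _ = _ := by ring
  refine ⟨∑ a, ∑ b, Real.toNNReal (∑' x, (∑ j, |(x j : ℝ)|) * |V x a b|), fun a b => ?_⟩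
  refine LipschitzWith.of_dist_le_mul fun θ η => ?_
  rw [dist_eq_norm, dist_eq_norm]
  refine (key a b θ η).trans ?_
  gcongr
  refine (Real.le_coe_toNNReal _).trans ?_
  exact NNReal.coe_le_coe.2 (le_trans (Finset.single_le_sum (f := fun b => Real.toNNReal
    (∑' x, (∑ j, |(x j : ℝ)|) * |V x a b|)) (fun _ _ => zero_le) (Finset.mem_univ b))
    (Finset.single_le_sum (f := fun a => ∑ b, Real.toNNReal
    (∑' x, (∑ j, |(x j : ℝ)|) * |V x a b|)) (fun _ _ => zero_le) (Finset.mem_univ a)))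

lemma ExpDecay.hasDerivAt_fourier (hV : ExpDecay V) (θ : Fin d → ℝ) (l : Fin d) (a b : Fin n)
    (t : ℝ) : HasDerivAt (fun t => fourier V (Function.update θ l t) a b)
      (∑' x, Complex.I * (x l : ℂ) *
        (Complex.exp (Complex.I * (pairing x (Function.update θ l t) : ℂ)) * (V x a b : ℂ))) t := by
  simp only [fourier, of_apply]
  refine hasDerivAt_tsum (𝕜 := ℝ) (F := ℂ)
    (g := fun x t => Complex.exp (Complex.I * (pairing x (Function.update θ l t) : ℂ)) *
      (V x a b : ℂ))
    (g' := fun x t => Complex.I * (x l : ℂ) *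
      (Complex.exp (Complex.I * (pairing x (Function.update θ l t) : ℂ)) * (V x a b : ℂ)))
    (u := fun x => |(x l : ℝ)| * |V x a b|) (hV.summable_coord_mul l a b)
    (fun x s => ?_) (fun x s => ?_) (y₀ := 0) ?_ t
  · have h1 : HasDerivAt (fun s : ℝ => (pairing x (Function.update θ l s) : ℂ)) (x l : ℂ) s := by
      have h2 : HasDerivAt (fun s : ℝ => pairing x (Function.update θ l 0) + (x l : ℝ) * s)
          (x l : ℝ) s := by
        have h3 := ((hasDerivAt_id s).const_mul (x l : ℝ)).const_add
          (pairing x (Function.update θ l 0))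
        rw [mul_one] at h3
        exact h3
      have h4 := h2.ofReal_comp
      simp only [← pairing_update] at h4
      rwa [Complex.ofReal_intCast] at h4
    have h3 := ((h1.const_mul Complex.I).cexp).mul_const (V x a b : ℂ)
    refine h3.congr_deriv ?_
    ring
  · rw [norm_mul, norm_fourier_term, norm_mul, Complex.norm_I, one_mul, ← Complex.ofReal_intCast,
      Complex.norm_real, Real.norm_eq_abs]
  · exact summable_fourier_term (hV.summable a b) _

lemma ExpDecay.dFourier_eq (hV : ExpDecay V) (θ : Fin d → ℝ) (l : Fin d) (a b : Fin n) :
    dFourier V l θ a b = ∑' x : Lattice d, Complex.I * (x l : ℂ) *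
      (Complex.exp (Complex.I * (pairing x θ : ℂ)) * (V x a b : ℂ)) := by
  have := (hV.hasDerivAt_fourier θ l a b (θ l)).deriv
  rw [Function.update_eq_self] at this
  exact this

lemma ExpDecay.hasDerivAt_dFourier (hV : ExpDecay V) (θ : Fin d → ℝ) (l : Fin d) (a b : Fin n) :
    HasDerivAt (fun t => fourier V (Function.update θ l t) a b) (dFourier V l θ a b) (θ l) :=
  (hV.hasDerivAt_fourier θ l a b (θ l)).differentiableAt.hasDerivAt

lemma ExpDecay.norm_dFourier_le (hV : ExpDecay V) (θ : Fin d → ℝ) (l : Fin d) (a b : Fin n) :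
    ‖dFourier V l θ a b‖ ≤ ∑' x : Lattice d, |(x l : ℝ)| * |V x a b| := by
  rw [hV.dFourier_eq]
  refine tsum_of_norm_bounded (hV.summable_coord_mul l a b).hasSum fun x => ?_
  rw [norm_dFourier_term]

lemma ExpDecay.continuous_dFourier (hV : ExpDecay V) (l : Fin d) (a b : Fin n) :
    Continuous fun θ => dFourier V l θ a b := by
  simp_rw [hV.dFourier_eq]
  refine continuous_tsum (u := fun x => |(x l : ℝ)| * |V x a b|) (fun x => ?_)
    (hV.summable_coord_mul l a b) fun x θ => (norm_dFourier_term x l θ _).le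
  have := continuous_pairing x
  fun_prop

end InteractionFourier

/-! ### Functional calculus of Hermitian matrices with arbitrary functions. -/

section FunctionalCalculus

variable {n : ℕ} {A : Matrix (Fin n) (Fin n) ℂ}

lemma cfc_congr_sortedEig (hA : A.IsHermitian) {f g : ℝ → ℝ}
    (h : ∀ i, f (sortedEig A i) = g (sortedEig A i)) : cfc f A = cfc g A := by
  obtain ⟨U, hU⟩ := exists_diagonalizes hA
  simp [hU.cfc_eq, h]

lemma matrix_cfc_mul (hA : A.IsHermitian) (f g : ℝ → ℝ) :
    cfc (fun t => f t * g t) A = cfc f A * cfc g A := by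
  obtain ⟨U, hU⟩ := exists_diagonalizes hA
  simp [hU.cfc_eq, hU.conj_mul, diagonal_mul_diagonal]

lemma matrix_cfc_sum (hA : A.IsHermitian) {κ : Type*} (s : Finset κ) (f : κ → ℝ → ℝ) :
    cfc (fun t => ∑ k ∈ s, f k t) A = ∑ k ∈ s, cfc (f k) A := by
  obtain ⟨U, hU⟩ := exists_diagonalizes hA
  simp only [hU.cfc_eq]
  rw [← Finset.sum_mul, ← Finset.mul_sum]
  congr 2
  ext i j
  rw [Matrix.sum_apply]
  by_cases h : i = j
  · subst h; simp
  · simp [h]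

lemma matrix_cfc_affine (hA : A.IsHermitian) (c e : ℝ) :
    cfc (fun t => e * (t - c)) A = (e : ℂ) • (A - (c : ℂ) • 1) := by
  obtain ⟨U, hU⟩ := exists_diagonalizes hA
  have h1 : (1 : Matrix (Fin n) (Fin n) ℂ) = U * 1 * Uᴴ := by rw [Matrix.mul_one, hU.mul_star]
  rw [hU.cfc_eq]
  conv_rhs => rw [hU.eq hA]
  conv_rhs => rw [h1]
  rw [← smul_mul_assoc, ← mul_smul_comm, ← sub_mul, ← mul_sub, ← smul_mul_assoc, ← mul_smul_comm]
  congr 2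
  ext i j
  by_cases h : i = j
  · subst h; simp
  · simp [h]

lemma matrix_cfc_const_mul (hA : A.IsHermitian) (c : ℝ) (f : ℝ → ℝ) :
    cfc (fun t => c * f t) A = (c : ℂ) • cfc f A := by
  obtain ⟨U, hU⟩ := exists_diagonalizes hA
  rw [hU.cfc_eq, hU.cfc_eq, ← smul_mul_assoc, ← mul_smul_comm]
  congr 2
  ext i j
  by_cases h : i = j
  · subst h; simp
  · simp [h]

lemma matrix_cfc_one (hA : A.IsHermitian) : cfc (fun _ => (1 : ℝ)) A = 1 := by
  obtain ⟨U, hU⟩ := exists_diagonalizes hA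
  simp [hU.cfc_eq, hU.mul_star]

/-- The spectrum is finite, so every function is continuous on it and on its image; in particular
indicator functions are allowed. -/
lemma matrix_cfc_comp (hA : A.IsHermitian) (g f : ℝ → ℝ) :
    cfc g (cfc f A) = cfc (fun t => g (f t)) A := by
  have hfin : (spectrum ℝ A).Finite := Matrix.finite_real_spectrum
  exact (cfc_comp' g f A ((hfin.image f).continuousOn g) (hfin.continuousOn f) hA).symm

lemma matrix_cfc_isHermitian (f : ℝ → ℝ) (A : Matrix (Fin n) (Fin n) ℂ) :
    (cfc f A).IsHermitian :=
  cfc_predicate f A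

/-- Entrywise complex conjugation as a star algebra homomorphism over the reals. -/
def conjHom (n : ℕ) : Matrix (Fin n) (Fin n) ℂ →⋆ₐ[ℝ] Matrix (Fin n) (Fin n) ℂ where
  toAlgHom := AlgHom.mapMatrix Complex.conjAe.toAlgHom
  map_star' := fun A => by
    ext i j
    simp [star_eq_conjTranspose]

lemma matrix_cfc_map_star (hA : A.IsHermitian) (f : ℝ → ℝ) :
    cfc f (A.map star) = (cfc f A).map star := by
  have hfin : (spectrum ℝ A).Finite := Matrix.finite_real_spectrum
  have hc : Continuous (conjHom n) := by
    refine continuous_matrix fun i j => ?_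
    exact Complex.continuous_conj.comp (continuous_id.matrix_elem i j)
  have hA' : IsSelfAdjoint (conjHom n A) := IsSelfAdjoint.map hA (conjHom n)
  exact (StarAlgHom.map_cfc (conjHom n) f A (hfin.continuousOn f) hc hA hA').symm

/-- For a Hermitian matrix conjugation is transposition, which preserves the characteristic
polynomial. This is the source of `ω_i(-θ) = ω_i(θ)`. -/
lemma sortedEig_map_star (hA : A.IsHermitian) : sortedEig (A.map star) = sortedEig A := by
  have h1 : A.map star = Aᵀ := by
    conv_rhs => rw [← hA.eq]
    ext i j; simp
  rw [h1]
  exact sortedEig_eq_of_charpoly_eq hA.transpose hA (charpoly_transpose A)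

lemma sortedEig_nonneg (hA : A.PosSemidef) (j : Fin n) : 0 ≤ sortedEig A j := by
  obtain ⟨U, hU⟩ := exists_diagonalizes hA.isHermitian
  have h := (hA.conjTranspose_mul_mul_same U).diag_nonneg (i := j)
  rw [hU.conj_self hA.isHermitian, diagonal_apply_eq] at h
  exact_mod_cast h

lemma det_eq_prod_sortedEig (hA : A.IsHermitian) : A.det = ∏ j, (sortedEig A j : ℂ) := by
  obtain ⟨U, hU⟩ := exists_diagonalizes hA
  conv_lhs => rw [hU.eq hA]
  rw [det_mul, det_mul, mul_right_comm, ← det_mul, hU.mul_star, det_one, one_mul, det_diagonal]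

lemma sortedEig_pos (hA : A.PosSemidef) (hdet : A.det ≠ 0) (j : Fin n) : 0 < sortedEig A j := by
  refine (sortedEig_nonneg hA j).lt_of_ne' fun h => hdet ?_
  rw [det_eq_prod_sortedEig hA.isHermitian]
  exact Finset.prod_eq_zero (Finset.mem_univ j) (by simp [h])

lemma norm_sq_apply_le (M : Matrix (Fin n) (Fin n) ℂ) (a b : Fin n) :
    ‖M a b‖ ^ 2 ≤ ((M * Mᴴ) a a).re := by
  have h := diag_conj_diagonal Mᴴ (fun _ => 1) a
  simp only [Complex.ofReal_one, diagonal_one, conjTranspose_conjTranspose, mul_one] at h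
  rw [h]
  simpa using Finset.single_le_sum (f := fun i => ‖Mᴴ i a‖ ^ 2) (fun i _ => by positivity)
    (Finset.mem_univ b)

/-- Row `a` of a Hermitian projection has squared norm `P a a`; comparison with the entry `b = a`
itself gives `‖P a a‖ ≤ 1`. -/
lemma norm_projection_apply_le_one {P : Matrix (Fin n) (Fin n) ℂ} (hP : P.IsHermitian)
    (hPP : P * P = P) (a b : Fin n) : ‖P a b‖ ≤ 1 := by
  have h : ∀ b, ‖P a b‖ ^ 2 ≤ ‖P a a‖ := fun b => by
    have := norm_sq_apply_le P a b
    rw [hP.eq, hPP] at this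
    exact this.trans ((le_abs_self _).trans (Complex.abs_re_le_norm _))
  have h1 := h a
  have h2 := h b
  have h3 : ‖P a a‖ ≤ 1 := by nlinarith [norm_nonneg (P a a)]
  nlinarith [norm_nonneg (P a b)]

end FunctionalCalculus

/-! ### A submultiplicative norm given by the sum of absolute entries. -/

section EntrySum

variable {ι κ : Type*} [Fintype ι] [Fintype κ]

/-- The sum of the absolute values of the entries of a matrix. -/
def entrySum (M : Matrix ι ι ℂ) : ℝ := ∑ a, ∑ b, ‖M a b‖

lemma entrySum_nonneg (M : Matrix ι ι ℂ) : 0 ≤ entrySum M :=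
  Finset.sum_nonneg fun _ _ => Finset.sum_nonneg fun _ _ => norm_nonneg _

lemma norm_apply_le_entrySum (M : Matrix ι ι ℂ) (a b : ι) : ‖M a b‖ ≤ entrySum M :=
  (Finset.single_le_sum (f := fun b => ‖M a b‖) (fun _ _ => norm_nonneg _)
    (Finset.mem_univ b)).trans
  (Finset.single_le_sum (f := fun a => ∑ b, ‖M a b‖)
    (fun _ _ => Finset.sum_nonneg fun _ _ => norm_nonneg _) (Finset.mem_univ a))

lemma entrySum_le (M : Matrix ι ι ℂ) {c : ℝ} (h : ∀ a b, ‖M a b‖ ≤ c) :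
    entrySum M ≤ (Fintype.card ι : ℝ) ^ 2 * c := by
  calc entrySum M ≤ ∑ _a : ι, ∑ _b : ι, c :=
        Finset.sum_le_sum fun a _ => Finset.sum_le_sum fun b _ => h a b
    _ = _ := by simp; ring

lemma entrySum_add_le (M N : Matrix ι ι ℂ) : entrySum (M + N) ≤ entrySum M + entrySum N := by
  simp only [entrySum, ← Finset.sum_add_distrib]
  exact Finset.sum_le_sum fun a _ => Finset.sum_le_sum fun b _ => norm_add_le _ _

lemma entrySum_smul (c : ℂ) (M : Matrix ι ι ℂ) : entrySum (c • M) = ‖c‖ * entrySum M := by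
  simp [entrySum, Finset.mul_sum]

lemma entrySum_neg (M : Matrix ι ι ℂ) : entrySum (-M) = entrySum M := by
  simp [entrySum]

lemma entrySum_zero : entrySum (0 : Matrix ι ι ℂ) = 0 := by
  simp [entrySum]

lemma entrySum_sum_le {σ : Type*} (s : Finset σ) (M : σ → Matrix ι ι ℂ) :
    entrySum (∑ i ∈ s, M i) ≤ ∑ i ∈ s, entrySum (M i) := by
  classical
  induction s using Finset.induction_on with
  | empty => simp [entrySum_zero]
  | insert i s hi ih =>
    rw [Finset.sum_insert hi, Finset.sum_insert hi]
    exact (entrySum_add_le _ _).trans (by gcongr)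

lemma entrySum_mul_le (M N : Matrix ι ι ℂ) : entrySum (M * N) ≤ entrySum M * entrySum N := by
  have h : ∀ a b, ‖(M * N) a b‖ ≤ ∑ c, ‖M a c‖ * ‖N c b‖ := fun a b => by
    rw [Matrix.mul_apply]
    refine (norm_sum_le _ _).trans_eq ?_
    simp
  calc entrySum (M * N) ≤ ∑ a, ∑ b, ∑ c, ‖M a c‖ * ‖N c b‖ :=
        Finset.sum_le_sum fun a _ => Finset.sum_le_sum fun b _ => h a b
    _ = ∑ a, ∑ c, ‖M a c‖ * ∑ b, ‖N c b‖ := by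
        refine Finset.sum_congr rfl fun a _ => ?_
        rw [Finset.sum_comm]
        simp_rw [Finset.mul_sum]
    _ ≤ ∑ a, ∑ c, ‖M a c‖ * entrySum N := by
        refine Finset.sum_le_sum fun a _ => Finset.sum_le_sum fun c _ => ?_
        gcongr
        exact Finset.single_le_sum (f := fun a => ∑ b, ‖N a b‖)
          (fun _ _ => Finset.sum_nonneg fun _ _ => norm_nonneg _) (Finset.mem_univ c)
    _ = _ := by simp only [entrySum, Finset.sum_mul]

lemma entrySum_fromBlocks (A B C D : Matrix ι ι ℂ) :
    entrySum (fromBlocks A B C D) = entrySum A + entrySum B + entrySum C + entrySum D := by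
  simp only [entrySum, Fintype.sum_sum_type, fromBlocks_apply₁₁, fromBlocks_apply₁₂,
    fromBlocks_apply₂₁, fromBlocks_apply₂₂, Finset.sum_add_distrib]
  ring

end EntrySum

/-! ### Measurability of matrix families and of their functional calculus. -/

section MeasurableEntries

variable {α ι : Type*} [MeasurableSpace α]

/-- A matrix-valued function all of whose entries are measurable. -/
def MeasurableEntries (M : α → Matrix ι ι ℂ) : Prop := ∀ a b, Measurable fun θ => M θ a b

namespace MeasurableEntries

variable {M N : α → Matrix ι ι ℂ}

lemma const (A : Matrix ι ι ℂ) : MeasurableEntries fun _ : α => A := fun _ _ => measurable_const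

lemma add (hM : MeasurableEntries M) (hN : MeasurableEntries N) :
    MeasurableEntries fun θ => M θ + N θ := fun a b => (hM a b).add (hN a b)

lemma sub (hM : MeasurableEntries M) (hN : MeasurableEntries N) :
    MeasurableEntries fun θ => M θ - N θ := fun a b => (hM a b).sub (hN a b)

lemma neg (hM : MeasurableEntries M) : MeasurableEntries fun θ => -M θ := fun a b => (hM a b).neg

lemma smul {c : α → ℂ} (hc : Measurable c) (hM : MeasurableEntries M) :
    MeasurableEntries fun θ => c θ • M θ := fun a b => hc.mul (hM a b)

lemma sum {σ : Type*} (s : Finset σ) {F : σ → α → Matrix ι ι ℂ}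
    (hF : ∀ i ∈ s, MeasurableEntries (F i)) : MeasurableEntries fun θ => ∑ i ∈ s, F i θ := by
  intro a b
  simp only [Matrix.sum_apply]
  exact Finset.measurable_sum s fun i hi => hF i hi a b

lemma mul [Fintype ι] (hM : MeasurableEntries M) (hN : MeasurableEntries N) :
    MeasurableEntries fun θ => M θ * N θ := by
  intro a b
  simp only [Matrix.mul_apply]
  exact Finset.measurable_sum _ fun i _ => (hM a i).mul (hN i b)

lemma inv [Fintype ι] [DecidableEq ι] (hM : MeasurableEntries M) :
    MeasurableEntries fun θ => (M θ)⁻¹ := by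
  have hm : Measurable fun θ => (fun a b => M θ a b : ι → ι → ℂ) :=
    measurable_pi_iff.2 fun a => measurable_pi_iff.2 fun b => hM a b
  have hdet : Measurable fun θ => (M θ).det := by
    have hc : Continuous fun p : ι → ι → ℂ => (Matrix.of p).det :=
      Continuous.matrix_det continuous_id
    exact hc.measurable.comp hm
  intro a b
  have hadj : Measurable fun θ => (M θ).adjugate a b := by
    have hc : Continuous fun p : ι → ι → ℂ => (Matrix.of p).adjugate a b :=
      (Continuous.matrix_adjugate (A := fun p : ι → ι → ℂ => Matrix.of p)
        continuous_id).matrix_elem a b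
    exact hc.measurable.comp hm
  simp only [Matrix.inv_def, Ring.inverse_eq_inv', Matrix.smul_apply, smul_eq_mul]
  exact hdet.inv.mul hadj

lemma fromBlocks {A B C D : α → Matrix ι ι ℂ} (hA : MeasurableEntries A)
    (hB : MeasurableEntries B) (hC : MeasurableEntries C) (hD : MeasurableEntries D) :
    MeasurableEntries fun θ => Matrix.fromBlocks (A θ) (B θ) (C θ) (D θ) := by
  rintro (a | a) (b | b)
  exacts [hA a b, hB a b, hC a b, hD a b]

/-- The functional calculus of a measurable family of Hermitian matrices. -/
lemma cfc {n : ℕ} {A : α → Matrix (Fin n) (Fin n) ℂ} (hA : ∀ θ, (A θ).IsHermitian)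
    (hAm : MeasurableEntries A) (hs : ∀ i, Measurable fun θ => sortedEig (A θ) i)
    {f : α → ℝ → ℝ} (hf : ∀ i, Measurable fun θ => f θ (sortedEig (A θ) i)) :
    MeasurableEntries fun θ => cfc (f θ) (A θ) := by
  classical
  have hset : ∀ i j, MeasurableSet {θ | sortedEig (A θ) j = sortedEig (A θ) i} := fun i j =>
    measurableSet_eq_fun (hs j) (hs i)
  -- Lagrange interpolation: each factor is affine in `t`, equals 1 at eigenvalue `i` and 0 at
  -- eigenvalue `j`, and is replaced by 1 if the two coincide. The spectral projections thus become
  -- polynomials in `A` with measurable coefficients, and no measurable choice of eigenvectors is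
  -- needed.
  let g : α → Fin n → Fin n → ℝ → ℝ := fun θ i j t =>
    if sortedEig (A θ) j = sortedEig (A θ) i then 1
    else (sortedEig (A θ) i - sortedEig (A θ) j)⁻¹ * (t - sortedEig (A θ) j)
  have hg : ∀ i (s : Finset (Fin n)),
      MeasurableEntries fun θ => _root_.cfc (fun t => ∏ j ∈ s, g θ i j t) (A θ) := by
    intro i s
    induction s using Finset.induction_on with
    | empty =>
      simp only [Finset.prod_empty, matrix_cfc_one (hA _)]
      exact const 1
    | insert j s hj ih =>
      simp only [Finset.prod_insert hj, matrix_cfc_mul (hA _)]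
      refine mul ?_ ih
      have he : ∀ θ, _root_.cfc (g θ i j) (A θ) = if sortedEig (A θ) j = sortedEig (A θ) i then 1
          else (((sortedEig (A θ) i - sortedEig (A θ) j)⁻¹ : ℝ) : ℂ) •
            (A θ - (sortedEig (A θ) j : ℂ) • 1) := by
        intro θ
        by_cases h : sortedEig (A θ) j = sortedEig (A θ) i
        · simp only [g, h, if_true]
          exact matrix_cfc_one (hA θ)
        · simp only [g, h, if_false]
          exact matrix_cfc_affine (hA θ) _ _
      intro a b
      simp only [he]
      have h1 : ∀ θ, (if sortedEig (A θ) j = sortedEig (A θ) i then (1 : Matrix (Fin n) (Fin n) ℂ)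
          else (((sortedEig (A θ) i - sortedEig (A θ) j)⁻¹ : ℝ) : ℂ) •
            (A θ - (sortedEig (A θ) j : ℂ) • 1)) a b
          = if sortedEig (A θ) j = sortedEig (A θ) i then (1 : Matrix (Fin n) (Fin n) ℂ) a b
          else ((((sortedEig (A θ) i - sortedEig (A θ) j)⁻¹ : ℝ) : ℂ) •
            (A θ - (sortedEig (A θ) j : ℂ) • 1)) a b := fun θ => by split_ifs <;> rfl
      simp only [h1]
      refine Measurable.ite (hset i j) measurable_const ?_
      refine smul ?_ (hAm.sub (smul ?_ (const 1))) a b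
      · exact Complex.measurable_ofReal.comp ((hs i).sub (hs j)).inv
      · exact Complex.measurable_ofReal.comp (hs j)
  -- In the sum over all indices each spectral projection occurs once for every repetition of its
  -- eigenvalue; dividing by `mult` corrects this.
  let mult : α → Fin n → ℝ := fun θ i =>
    ∑ j, if sortedEig (A θ) j = sortedEig (A θ) i then (1 : ℝ) else 0
  have hprod : ∀ θ i k, ∏ j, g θ i j (sortedEig (A θ) k)
      = if sortedEig (A θ) i = sortedEig (A θ) k then 1 else 0 := by
    intro θ i k
    by_cases h : sortedEig (A θ) i = sortedEig (A θ) k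
    · rw [if_pos h]
      refine Finset.prod_eq_one fun j _ => ?_
      by_cases hj : sortedEig (A θ) j = sortedEig (A θ) i
      · simp [g, hj]
      · simp only [g, hj, if_false, ← h]
        exact inv_mul_cancel₀ (sub_ne_zero.2 (Ne.symm hj))
    · rw [if_neg h]
      refine Finset.prod_eq_zero (Finset.mem_univ k) ?_
      simp [g, Ne.symm h]
  have hmult : ∀ θ i, mult θ i ≠ 0 := by
    intro θ i
    simp only [mult, Finset.sum_boole]
    exact Nat.cast_ne_zero.2 (Finset.card_ne_zero_of_mem (a := i) (by simp))
  have hfin : ∀ θ, _root_.cfc (f θ) (A θ) = ∑ i, ((f θ (sortedEig (A θ) i) / mult θ i : ℝ) : ℂ) •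
      _root_.cfc (fun t => ∏ j, g θ i j t) (A θ) := by
    intro θ
    simp_rw [← matrix_cfc_const_mul (hA θ)]
    rw [← matrix_cfc_sum (hA θ)]
    refine cfc_congr_sortedEig (hA θ) fun k => ?_
    simp only [hprod, mul_ite, mul_one, mul_zero]
    have h2 : ∀ i, (if sortedEig (A θ) i = sortedEig (A θ) k then
        f θ (sortedEig (A θ) i) / mult θ i else 0)
        = f θ (sortedEig (A θ) k) / mult θ k *
          if sortedEig (A θ) i = sortedEig (A θ) k then 1 else 0 := by
      intro i
      split_ifs with h
      · simp only [mult, h, mul_one]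
      · simp
    simp only [h2]
    rw [← Finset.mul_sum]
    exact (div_mul_cancel₀ _ (hmult θ k)).symm
  simp only [hfin]
  refine sum _ fun i _ => smul (Complex.measurable_ofReal.comp ((hf i).div ?_)) (hg i _)
  exact Finset.measurable_sum _ fun j _ => Measurable.ite (hset i j) measurable_const
    measurable_const

end MeasurableEntries

end MeasurableEntries

/-! ### Dispersion relations, spectral projections and the square root of the symbol. -/

section Bands

variable {d n : ℕ} {V : Lattice d → Matrix (Fin n) (Fin n) ℝ}

lemma omega_eq (V : Lattice d → Matrix (Fin n) (Fin n) ℝ) (i : Fin n) (θ : Fin d → ℝ) :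
    omega V i θ = √(sortedEig (fourier V θ) i) := by
  unfold omega sortedEig
  split_ifs <;> simp

lemma omega_mono (V : Lattice d → Matrix (Fin n) (Fin n) ℝ) (θ : Fin d → ℝ) :
    Monotone fun i => omega V i θ := fun i j h => by
  simp only [omega_eq]
  exact Real.sqrt_le_sqrt (sortedEig_mono _ h)

lemma fourier_neg_eq_map (θ : Fin d → ℝ) : fourier V (-θ) = (fourier V θ).map star := by
  ext a b
  simp [fourier_neg]

lemma omega_neg (hH : ∀ θ, (fourier V θ).IsHermitian) (i : Fin n) (θ : Fin d → ℝ) :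
    omega V i (-θ) = omega V i θ := by
  rw [omega_eq, omega_eq, fourier_neg_eq_map, sortedEig_map_star (hH θ)]

lemma omega_add_two_pi (i : Fin n) (θ : Fin d → ℝ) (m : Fin d → ℤ) :
    omega V i (fun j => θ j + m j * (2 * Real.pi)) = omega V i θ := by
  rw [omega_eq, omega_eq, fourier_add_two_pi]

lemma dOmega_neg (hH : ∀ θ, (fourier V θ).IsHermitian) (i : Fin n) (l : Fin d) (θ : Fin d → ℝ) :
    dOmega V i l (-θ) = -dOmega V i l θ := by
  have h : (fun t : ℝ => omega V i (Function.update (-θ) l t))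
      = fun t : ℝ => (fun t => omega V i (Function.update θ l t)) (-t) := by
    funext t
    rw [← omega_neg hH]
    congr 1
    funext j
    by_cases hj : j = l
    · subst hj; simp
    · simp [hj]
  rw [dOmega, h]
  refine (deriv_comp_neg (fun t => omega V i (Function.update θ l t)) ((-θ) l)).trans ?_
  rw [Pi.neg_apply, neg_neg]
  rfl

lemma dOmega_add_two_pi (i : Fin n) (l : Fin d) (θ : Fin d → ℝ) (m : Fin d → ℤ) :
    dOmega V i l (fun j => θ j + m j * (2 * Real.pi)) = dOmega V i l θ := by
  have h : (fun t : ℝ => omega V i (Function.update (fun j => θ j + m j * (2 * Real.pi)) l t))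
      = fun t : ℝ => (fun t => omega V i (Function.update θ l t)) (t + -(m l * (2 * Real.pi))) := by
    funext t
    simp only []
    rw [← omega_add_two_pi i (Function.update θ l (t + -(m l * (2 * Real.pi)))) m]
    congr 1
    funext j
    by_cases hj : j = l
    · subst hj; simp
    · simp [hj]
  rw [dOmega, h]
  refine (deriv_comp_add_const (fun t => omega V i (Function.update θ l t))
    (-(m l * (2 * Real.pi))) (θ l + m l * (2 * Real.pi))).trans ?_
  simp [dOmega]

lemma continuous_sortedEig_fourier (hS : ∀ a b, Summable fun x => V x a b)
    (hH : ∀ θ, (fourier V θ).IsHermitian) (i : Fin n) :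
    Continuous fun θ => sortedEig (fourier V θ) i := by
  rw [continuous_iff_continuousAt]
  intro θ
  rw [ContinuousAt, tendsto_iff_dist_tendsto_zero]
  have hlim : Filter.Tendsto (fun η => 2 * (n : ℝ) *
      ∑ a, ∑ b, ‖fourier V η a b - fourier V θ a b‖) (nhds θ) (nhds 0) := by
    have hc : Continuous fun η => 2 * (n : ℝ) *
        ∑ a, ∑ b, ‖fourier V η a b - fourier V θ a b‖ :=
      continuous_const.mul (continuous_finsetSum _ fun a _ => continuous_finsetSum _ fun b _ =>
        ((continuous_fourier hS a b).sub continuous_const).norm)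
    have := hc.tendsto θ
    simpa using this
  refine squeeze_zero (fun _ => dist_nonneg) (fun η => ?_) hlim
  rw [Real.dist_eq]
  exact abs_sortedEig_sub_le (hH θ) (hH η) i

lemma continuous_omega (hS : ∀ a b, Summable fun x => V x a b)
    (hH : ∀ θ, (fourier V θ).IsHermitian) (i : Fin n) : Continuous (omega V i) := by
  have : omega V i = fun θ => √(sortedEig (fourier V θ) i) := funext (omega_eq V i)
  rw [this]
  exact (continuous_sortedEig_fourier hS hH i).sqrt

/-- The derivative of a jointly continuous family is jointly measurable, including at points of
nondifferentiability, where `deriv` is 0. `dOmega` is its restriction to the graph `t = θ l`. -/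
lemma measurable_dOmega (hS : ∀ a b, Summable fun x => V x a b)
    (hH : ∀ θ, (fourier V θ).IsHermitian) (i : Fin n) (l : Fin d) :
    Measurable (dOmega V i l) := by
  have hc : Continuous (Function.uncurry fun (θ : Fin d → ℝ) (t : ℝ) =>
      omega V i (Function.update θ l t)) :=
    (continuous_omega hS hH i).comp (continuous_fst.update l continuous_snd)
  have h1 : Measurable fun p : (Fin d → ℝ) × ℝ =>
      deriv (fun t => omega V i (Function.update p.1 l t)) p.2 := measurable_deriv_with_param hc
  have h2 : Measurable fun θ : Fin d → ℝ => (θ, θ l) :=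
    Measurable.prodMk measurable_id (measurable_pi_apply l)
  have h3 : dOmega V i l = (fun p : (Fin d → ℝ) × ℝ =>
      deriv (fun t => omega V i (Function.update p.1 l t)) p.2) ∘ fun θ => (θ, θ l) := by
    funext θ
    simp only [dOmega, Function.comp]
  rw [h3]
  exact h1.comp h2

lemma measurableEntries_fourier {ι : Type*} {f : Lattice d → Matrix ι ι ℝ}
    (hf : ∀ a b, Summable fun x => f x a b) : MeasurableEntries (fourier f) :=
  fun a b => (continuous_fourier hf a b).measurable

lemma measurableEntries_Omega (hS : ∀ a b, Summable fun x => V x a b)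
    (hH : ∀ θ, (fourier V θ).IsHermitian) : MeasurableEntries (Omega V) := by
  have h : MeasurableEntries fun θ => cfc Real.sqrt (fourier V θ) :=
    MeasurableEntries.cfc (A := fourier V) (f := fun _ : Fin d → ℝ => Real.sqrt) hH
      (measurableEntries_fourier hS)
      (fun i => (continuous_sortedEig_fourier hS hH i).measurable)
      (fun i => Real.continuous_sqrt.measurable.comp
        (continuous_sortedEig_fourier hS hH i).measurable)
  exact h

open Classical in
lemma bandProj_eq (hH : ∀ θ, (fourier V θ).IsHermitian) (i : Fin n) (θ : Fin d → ℝ) :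
    bandProj V i θ = cfc (fun t : ℝ => if √t = omega V i θ then (1 : ℝ) else 0) (fourier V θ) :=
  matrix_cfc_comp (hH θ) _ _

lemma measurableEntries_bandProj (hS : ∀ a b, Summable fun x => V x a b)
    (hH : ∀ θ, (fourier V θ).IsHermitian) (i : Fin n) : MeasurableEntries (bandProj V i) := by
  classical
  have : bandProj V i = fun θ => cfc (fun t : ℝ => if √t = omega V i θ then (1 : ℝ) else 0)
      (fourier V θ) := by
    funext θ
    rw [bandProj_eq hH]
  rw [this]
  refine MeasurableEntries.cfc hH (measurableEntries_fourier hS)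
    (fun i => (continuous_sortedEig_fourier hS hH i).measurable) fun j => ?_
  refine Measurable.ite (measurableSet_eq_fun ?_ ?_) measurable_const measurable_const
  · exact (continuous_sortedEig_fourier hS hH j).measurable.sqrt
  · exact (continuous_omega hS hH i).measurable

lemma measurableSet_mem_bands (hS : ∀ a b, Summable fun x => V x a b)
    (hH : ∀ θ, (fourier V θ).IsHermitian) (i : Fin n) : MeasurableSet {θ | i ∈ bands V θ} := by
  simp only [bands, Finset.mem_filter, Finset.mem_univ, true_and]
  have : {θ | ∀ j < i, omega V j θ ≠ omega V i θ}
      = ⋂ j, ⋂ (_ : j < i), {θ | omega V j θ = omega V i θ}ᶜ := by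
    ext θ; simp
  rw [this]
  exact MeasurableSet.iInter fun j => MeasurableSet.iInter fun _ =>
    (measurableSet_eq_fun (continuous_omega hS hH j).measurable
      (continuous_omega hS hH i).measurable).compl

lemma sum_bands_eq {M : Type*} [AddCommMonoid M] (θ : Fin d → ℝ) (F : Fin n → M) :
    ∑ i ∈ bands V θ, F i = ∑ i, if i ∈ bands V θ then F i else 0 := by
  rw [Finset.sum_ite_mem, Finset.univ_inter]

lemma bandProj_isHermitian (i : Fin n) (θ : Fin d → ℝ) : (bandProj V i θ).IsHermitian :=
  matrix_cfc_isHermitian _ _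

lemma bandProj_mul_self (i : Fin n) (θ : Fin d → ℝ) :
    bandProj V i θ * bandProj V i θ = bandProj V i θ := by
  unfold bandProj
  rw [← matrix_cfc_mul (A := Omega V θ) (matrix_cfc_isHermitian _ _)]
  congr 1
  funext t
  split_ifs <;> simp

lemma entrySum_bandProj_le (i : Fin n) (θ : Fin d → ℝ) : entrySum (bandProj V i θ) ≤ n ^ 2 := by
  refine (entrySum_le _ (norm_projection_apply_le_one (bandProj_isHermitian i θ)
    (bandProj_mul_self i θ))).trans_eq ?_
  simp

lemma Omega_isHermitian (θ : Fin d → ℝ) : (Omega V θ).IsHermitian :=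
  matrix_cfc_isHermitian _ _

lemma Omega_mul_self {θ : Fin d → ℝ} (hP : (fourier V θ).PosSemidef) :
    Omega V θ * Omega V θ = fourier V θ := by
  unfold Omega
  rw [← matrix_cfc_mul hP.isHermitian]
  rw [cfc_congr_sortedEig (g := id) hP.isHermitian
    fun i => Real.mul_self_sqrt (sortedEig_nonneg hP i)]
  exact cfc_id ℝ _ hP.isHermitian

/-- Also true where the symbol is singular: both inverses are then zero by convention. -/
lemma Omega_inv_mul_self {θ : Fin d → ℝ} (hP : (fourier V θ).PosSemidef) :
    (Omega V θ)⁻¹ * (Omega V θ)⁻¹ = (fourier V θ)⁻¹ := by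
  rw [← Matrix.mul_inv_rev, Omega_mul_self hP]

/-- The squared norm of a row of a Hermitian `M` is a diagonal entry of `M * M`. Applied to `Ω⁻¹`,
it makes an expression quadratic in `Ω⁻¹` cost only one power of `V̂⁻¹`. -/
lemma sq_entrySum_le_of_isHermitian {M : Matrix (Fin n) (Fin n) ℂ} (hM : M.IsHermitian) :
    entrySum M ^ 2 ≤ (n : ℝ) ^ 4 * entrySum (M * M) := by
  have h1 : ∀ a b, ‖M a b‖ ≤ √(entrySum (M * M)) := fun a b => by
    refine Real.le_sqrt_of_sq_le ((norm_sq_apply_le M a b).trans ?_)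
    rw [hM.eq]
    exact (le_abs_self _).trans ((Complex.abs_re_le_norm _).trans (norm_apply_le_entrySum _ _ _))
  have h2 := entrySum_le M h1
  rw [Fintype.card_fin] at h2
  calc entrySum M ^ 2 ≤ ((n : ℝ) ^ 2 * √(entrySum (M * M))) ^ 2 := by
        have := entrySum_nonneg M
        gcongr
    _ = _ := by rw [mul_pow, Real.sq_sqrt (entrySum_nonneg _)]; ring

end Bands

/-! ### Entrywise conjugation of matrices. -/

section ComplexConjugation

variable {ι : Type*}

lemma map_star_mul [Fintype ι] (M N : Matrix ι ι ℂ) :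
    (M * N).map star = M.map star * N.map star := by
  ext a b; simp [Matrix.mul_apply]

lemma map_star_add (M N : Matrix ι ι ℂ) : (M + N).map star = M.map star + N.map star := by
  ext a b; simp

lemma map_star_sub (M N : Matrix ι ι ℂ) : (M - N).map star = M.map star - N.map star := by
  ext a b; simp

lemma map_star_neg (M : Matrix ι ι ℂ) : (-M).map star = -M.map star := by
  ext a b; simp

lemma map_star_zero : (0 : Matrix ι ι ℂ).map star = 0 := by
  ext a b; simp

lemma map_star_smul (c : ℂ) (M : Matrix ι ι ℂ) : (c • M).map star = star c • M.map star := by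
  ext a b; simp

lemma map_star_sum {σ : Type*} (s : Finset σ) (M : σ → Matrix ι ι ℂ) :
    (∑ i ∈ s, M i).map star = ∑ i ∈ s, (M i).map star := by
  ext a b; simp [Matrix.sum_apply]

lemma map_star_inv [Fintype ι] [DecidableEq ι] (M : Matrix ι ι ℂ) :
    (M.map star)⁻¹ = M⁻¹.map star := by
  have h : ∀ N : Matrix ι ι ℂ, N.map star = Nᴴᵀ := fun N => by ext a b; simp
  rw [h, h, conjTranspose_nonsing_inv, transpose_nonsing_inv]

end ComplexConjugation

/-! ### Reality and measurability of the limiting symbol. -/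

section LimitMatrix

variable {d n k : ℕ} {V : Lattice d → Matrix (Fin n) (Fin n) ℝ}

lemma Omega_neg (hH : ∀ θ, (fourier V θ).IsHermitian) (θ : Fin d → ℝ) :
    Omega V (-θ) = (Omega V θ).map star := by
  rw [Omega, Omega, fourier_neg_eq_map, matrix_cfc_map_star (hH θ)]

lemma bandProj_neg (hH : ∀ θ, (fourier V θ).IsHermitian) (i : Fin n) (θ : Fin d → ℝ) :
    bandProj V i (-θ) = (bandProj V i θ).map star := by
  rw [bandProj, bandProj, Omega_neg hH, omega_neg hH, matrix_cfc_map_star (Omega_isHermitian θ)]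

lemma bands_neg (hH : ∀ θ, (fourier V θ).IsHermitian) (θ : Fin d → ℝ) :
    bands V (-θ) = bands V θ := by
  simp only [bands, omega_neg hH]

lemma Cmat_neg (hH : ∀ θ, (fourier V θ).IsHermitian) (θ : Fin d → ℝ) :
    Cmat V (-θ) = (Cmat V θ).map star := by
  rw [Cmat, Cmat, fromBlocks_map, Omega_neg hH, map_star_inv, map_star_neg, map_star_zero]

lemma CmatStar_neg (hH : ∀ θ, (fourier V θ).IsHermitian) (θ : Fin d → ℝ) :
    CmatStar V (-θ) = (CmatStar V θ).map star := by
  rw [CmatStar, CmatStar, fromBlocks_map, Omega_neg hH, map_star_inv, map_star_neg, map_star_zero]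

lemma L1plus_neg (hH : ∀ θ, (fourier V θ).IsHermitian) (θ : Fin d → ℝ)
    (q : Matrix (Fin n ⊕ Fin n) (Fin n ⊕ Fin n) ℂ) :
    L1plus V (-θ) (q.map star) = (L1plus V θ q).map star := by
  simp only [L1plus, Cmat_neg hH, CmatStar_neg hH, map_star_smul, map_star_add, map_star_mul]
  simp

lemma L2minus_neg (hH : ∀ θ, (fourier V θ).IsHermitian) (θ : Fin d → ℝ)
    (q : Matrix (Fin n ⊕ Fin n) (Fin n ⊕ Fin n) ℂ) :
    L2minus V (-θ) (q.map star) = (L2minus V θ q).map star := by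
  simp only [L2minus, Cmat_neg hH, CmatStar_neg hH, map_star_smul, map_star_sub, map_star_mul]
  simp

lemma signProd_neg (hk : k ≤ d) (hH : ∀ θ, (fourier V θ).IsHermitian) (nn : Fin k → ℕ) (i : Fin n)
    (P : Finset (Fin k)) (θ : Fin d → ℝ) :
    signProd hk V nn i P (-θ) = (-1) ^ P.card * signProd hk V nn i P θ := by
  simp only [signProd, dOmega_neg hH, Real.sign_neg]
  rw [Finset.prod_neg, mul_assoc]

lemma Seven_neg (hk : k ≤ d) (hH : ∀ θ, (fourier V θ).IsHermitian) (nn : Fin k → ℕ) (i : Fin n)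
    (θ : Fin d → ℝ) : Seven hk V nn i (-θ) = Seven hk V nn i θ := by
  refine Finset.sum_congr rfl fun m hm => Finset.sum_congr rfl fun P hP => ?_
  rw [signProd_neg hk hH, (Finset.mem_powersetCard.1 hP).2, (Finset.mem_filter.1 hm).2.neg_one_pow,
    one_mul]

lemma Sodd_neg (hk : k ≤ d) (hH : ∀ θ, (fourier V θ).IsHermitian) (nn : Fin k → ℕ) (i : Fin n)
    (θ : Fin d → ℝ) : Sodd hk V nn i (-θ) = -Sodd hk V nn i θ := by
  simp only [Sodd, ← Finset.sum_neg_distrib]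
  refine Finset.sum_congr rfl fun m hm => Finset.sum_congr rfl fun P hP => ?_
  rw [signProd_neg hk hH, (Finset.mem_powersetCard.1 hP).2, (Finset.mem_filter.1 hm).2.neg_one_pow,
    neg_one_mul]

lemma fourier_neg_eq_map_star {ι : Type*} {f : Lattice d → Matrix ι ι ℝ} (θ : Fin d → ℝ) :
    fourier f (-θ) = (fourier f θ).map star := by
  ext a b
  simp [fourier_neg]

/-- `q̂^+_∞(-θ)` is the complex conjugate of `q̂^+_∞(θ)`, so that `Q^+_∞` is real. -/
lemma qInfHat_neg [NeZero k] (hk : k ≤ d) (hH : ∀ θ, (fourier V θ).IsHermitian)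
    (μ : (Fin k → ℕ) → Measure (Config d n)) (θ : Fin d → ℝ) :
    qInfHat hk V μ (-θ) = (qInfHat hk V μ θ).map star := by
  have hM1 : ∀ i, Mplus hk V μ i (-θ) = (Mplus hk V μ i θ).map star := fun i => by
    simp only [Mplus, Seven_neg hk hH, map_star_smul, map_star_sum, fourier_neg_eq_map_star,
      L1plus_neg hH]
    simp
  -- The odd sign sums change sign under `θ ↦ -θ`, which compensates the conjugation of the factor
  -- `i`.
  have hM2 : ∀ i, Complex.I • Mminus hk V μ i (-θ) = (Complex.I • Mminus hk V μ i θ).map star :=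
      fun i => by
    simp only [Mminus, Sodd_neg hk hH, map_star_smul, map_star_sum, fourier_neg_eq_map_star,
      L2minus_neg hH]
    simp
  simp only [qInfHat, bands_neg hH, hM1, hM2, bandProj_neg hH, map_star_sum, map_star_mul,
    map_star_add, fromBlocks_map, map_star_zero]

lemma abs_signProd_le (hk : k ≤ d) (nn : Fin k → ℕ) (i : Fin n) (P : Finset (Fin k))
    (θ : Fin d → ℝ) : |signProd hk V nn i P θ| ≤ 1 := by
  rw [signProd, abs_mul, abs_pow, abs_neg, abs_one, one_pow, mul_one, Finset.abs_prod]
  refine Finset.prod_le_one (fun _ _ => abs_nonneg _) fun p _ => ?_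
  rcases Real.sign_apply_eq (dOmega V i (Fin.castLE hk p) θ) with h | h | h <;> simp [h]

lemma abs_Seven_le (hk : k ≤ d) (nn : Fin k → ℕ) (i : Fin n) (θ : Fin d → ℝ) :
    |Seven hk V nn i θ| ≤ ∑ m ∈ (Finset.Icc 1 k).filter Even,
      ((Finset.powersetCard m (Finset.univ : Finset (Fin k))).card : ℝ) := by
  refine (Finset.abs_sum_le_sum_abs _ _).trans (Finset.sum_le_sum fun m _ => ?_)
  refine (Finset.abs_sum_le_sum_abs _ _).trans ?_
  refine (Finset.sum_le_sum fun P _ => abs_signProd_le hk nn i P θ).trans ?_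
  simp

lemma abs_Sodd_le (hk : k ≤ d) (nn : Fin k → ℕ) (i : Fin n) (θ : Fin d → ℝ) :
    |Sodd hk V nn i θ| ≤ ∑ m ∈ (Finset.Icc 1 k).filter Odd,
      ((Finset.powersetCard m (Finset.univ : Finset (Fin k))).card : ℝ) := by
  refine (Finset.abs_sum_le_sum_abs _ _).trans (Finset.sum_le_sum fun m _ => ?_)
  refine (Finset.abs_sum_le_sum_abs _ _).trans ?_
  refine (Finset.sum_le_sum fun P _ => abs_signProd_le hk nn i P θ).trans ?_
  simp

lemma measurable_real_sign : Measurable Real.sign := by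
  unfold Real.sign
  exact Measurable.ite measurableSet_Iio measurable_const
    (Measurable.ite measurableSet_Ioi measurable_const measurable_const)

lemma measurable_signProd (hk : k ≤ d) (hS : ∀ a b, Summable fun x => V x a b)
    (hH : ∀ θ, (fourier V θ).IsHermitian) (nn : Fin k → ℕ) (i : Fin n) (P : Finset (Fin k)) :
    Measurable (signProd hk V nn i P) :=
  (Finset.measurable_prod P fun _ _ =>
    measurable_real_sign.comp (measurable_dOmega hS hH i _)).mul_const _

lemma measurable_Seven (hk : k ≤ d) (hS : ∀ a b, Summable fun x => V x a b)
    (hH : ∀ θ, (fourier V θ).IsHermitian) (nn : Fin k → ℕ) (i : Fin n) :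
    Measurable (Seven hk V nn i) :=
  Finset.measurable_sum _ fun _ _ => Finset.measurable_sum _ fun P _ =>
    measurable_signProd hk hS hH nn i P

lemma measurable_Sodd (hk : k ≤ d) (hS : ∀ a b, Summable fun x => V x a b)
    (hH : ∀ θ, (fourier V θ).IsHermitian) (nn : Fin k → ℕ) (i : Fin n) :
    Measurable (Sodd hk V nn i) :=
  Finset.measurable_sum _ fun _ _ => Finset.measurable_sum _ fun P _ =>
    measurable_signProd hk hS hH nn i P

lemma measurableEntries_qInfHat [NeZero k] (hk : k ≤ d) (hS : ∀ a b, Summable fun x => V x a b)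
    (hH : ∀ θ, (fourier V θ).IsHermitian) {μ : (Fin k → ℕ) → Measure (Config d n)}
    (hq : ∀ nn ∈ halfIndex k, ∀ a b, Summable fun z => corr (μ nn) z a b) :
    MeasurableEntries (qInfHat hk V μ) := by
  have hO := measurableEntries_Omega hS hH
  have hC : MeasurableEntries (Cmat V) :=
    MeasurableEntries.fromBlocks (.const 0) hO.inv hO.neg (.const 0)
  have hC' : MeasurableEntries (CmatStar V) :=
    MeasurableEntries.fromBlocks (.const 0) hO.neg hO.inv (.const 0)
  have hM1 : ∀ i, MeasurableEntries (Mplus hk V μ i) := fun i =>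
    .smul measurable_const <| .sum _ fun nn hn =>
      .smul (Complex.measurable_ofReal.comp ((measurable_Seven hk hS hH nn i).const_add 1)) <|
      .smul measurable_const <| (measurableEntries_fourier (hq nn hn)).add
        ((hC.mul (measurableEntries_fourier (hq nn hn))).mul hC')
  have hM2 : ∀ i, MeasurableEntries (Mminus hk V μ i) := fun i =>
    .smul measurable_const <| .sum _ fun nn hn =>
      .smul (Complex.measurable_ofReal.comp (measurable_Sodd hk hS hH nn i)) <|
      .smul measurable_const <| (hC.mul (measurableEntries_fourier (hq nn hn))).sub
        ((measurableEntries_fourier (hq nn hn)).mul hC')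
  intro a b
  -- The set of bands varies with `θ`; the sum is taken over all indices instead, with the indicator
  -- of the measurable event that `i` is a band.
  simp only [qInfHat, sum_bands_eq, Matrix.sum_apply]
  refine Finset.measurable_sum _ fun i _ => ?_
  have hB := MeasurableEntries.fromBlocks (measurableEntries_bandProj hS hH i) (.const 0)
    (.const 0) (measurableEntries_bandProj hS hH i)
  have hm := (hB.mul ((hM1 i).add (.smul (measurable_const (a := Complex.I)) (hM2 i)))).mul hB
  exact Measurable.ite (measurableSet_mem_bands hS hH i) (hm a b) measurable_const

end LimitMatrix

/-! ### Coordinate reflections of the torus. -/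

section Torus

variable {d : ℕ}

/-- Change of sign of the coordinates in `s`. -/
def flip (s : Finset (Fin d)) (θ : Fin d → ℝ) : Fin d → ℝ := fun j => if j ∈ s then -θ j else θ j

lemma flip_flip (s : Finset (Fin d)) (θ : Fin d → ℝ) : flip s (flip s θ) = θ := by
  funext j; simp only [flip]; split_ifs <;> simp

lemma flip_univ (θ : Fin d → ℝ) : flip Finset.univ θ = -θ := by
  funext j; simp [flip]

lemma measurePreserving_flip (s : Finset (Fin d)) : MeasurePreserving (flip s) volume volume := by
  have := volume_preserving_pi (α' := fun _ : Fin d => ℝ) (β' := fun _ : Fin d => ℝ)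
    (f := fun j t => if j ∈ s then -t else t) (fun j => by
      by_cases h : j ∈ s
      · simpa [h] using Measure.measurePreserving_neg (volume : Measure ℝ)
      · simp only [h, if_false]
        exact MeasurePreserving.id (volume : Measure ℝ))
  exact this

lemma measurableEmbedding_flip (s : Finset (Fin d)) : MeasurableEmbedding (flip s) := by
  let e : (Fin d → ℝ) ≃ᵐ (Fin d → ℝ) :=
    { toFun := flip s
      invFun := flip s
      left_inv := flip_flip s
      right_inv := flip_flip s
      measurable_toFun := (measurePreserving_flip s).measurable
      measurable_invFun := (measurePreserving_flip s).measurable }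
  exact e.measurableEmbedding

lemma flip_preimage_torus (s : Finset (Fin d)) : flip s ⁻¹' torus d = torus d := by
  ext θ
  simp only [torus, Set.mem_preimage, Set.mem_Icc, Pi.le_def, ← forall_and]
  refine forall_congr' fun j => ?_
  simp only [flip]
  split_ifs
  · constructor <;> rintro ⟨h1, h2⟩ <;> constructor <;> linarith
  · rfl

lemma setIntegral_torus_flip {E : Type*} [NormedAddCommGroup E] [NormedSpace ℝ E]
    (s : Finset (Fin d)) (f : (Fin d → ℝ) → E) :
    ∫ θ in torus d, f (flip s θ) = ∫ θ in torus d, f θ := by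
  have := (measurePreserving_flip s).setIntegral_preimage_emb (measurableEmbedding_flip s) f
    (torus d)
  rwa [flip_preimage_torus] at this

lemma measurableSet_torus : MeasurableSet (torus d) := measurableSet_Icc

lemma isCompact_torus : IsCompact (torus d) := isCompact_Icc

lemma volume_torus_lt_top : volume (torus d) < ⊤ := isCompact_torus.measure_lt_top

instance : IsFiniteMeasure (volume.restrict (torus d)) := ⟨by
  rw [Measure.restrict_apply_univ]; exact volume_torus_lt_top⟩

end Torus

/-! ### Factorization of the image multiplier into sines. -/

section ImagePhase

lemma abs_sin_nat_mul_le (m : ℕ) (t : ℝ) : |Real.sin (m * t)| ≤ m * |Real.sin t| := by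
  induction m with
  | zero => simp
  | succ m ih =>
    push_cast
    rw [add_mul, one_mul, Real.sin_add]
    calc _ ≤ |Real.sin (m * t) * Real.cos t| + |Real.cos (m * t) * Real.sin t| := abs_add_le _ _
      _ ≤ |Real.sin (m * t)| * 1 + 1 * |Real.sin t| := by
        rw [abs_mul, abs_mul]
        gcongr
        · exact Real.abs_cos_le_one _
        · exact Real.abs_cos_le_one _
      _ ≤ _ := by linarith

/-- Through this bound the weight `sin²(θ_1)` of the integrability hypothesis serves every pair of
sites, at the price of the factors `|x_1|` and `|y_1|`. -/
lemma abs_sin_int_mul_le (m : ℤ) (t : ℝ) : |Real.sin (m * t)| ≤ |(m : ℝ)| * |Real.sin t| := by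
  rcases Int.natAbs_eq m with h | h
  · rw [h]; push_cast; rw [abs_abs]
    have := abs_sin_nat_mul_le m.natAbs t
    rwa [Nat.cast_natAbs, Int.cast_abs] at this
  · rw [h]; push_cast; rw [abs_neg, abs_abs, neg_mul, Real.sin_neg, abs_neg]
    have := abs_sin_nat_mul_le m.natAbs t
    rwa [Nat.cast_natAbs, Int.cast_abs] at this

variable {d : ℕ} [NeZero d]

lemma reflect_reflect (x : Lattice d) : reflect (reflect x) = x := by
  simp [reflect]

lemma reflect_apply_zero (x : Lattice d) : reflect x 0 = -x 0 := by simp [reflect]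

lemma reflect_apply_of_ne (x : Lattice d) {j : Fin d} (h : j ≠ 0) : reflect x j = x j := by
  simp [reflect, h]

lemma reflect_add_of_zero (x v : Lattice d) (hv : v 0 = 0) :
    reflect (x + v) = reflect x + v := by
  funext j
  by_cases h : j = 0
  · subst h; simp [reflect_apply_zero, hv]
  · simp [reflect_apply_of_ne _ h]

/-- Reflection as a permutation of the lattice. -/
def reflectEquiv (d : ℕ) [NeZero d] : Lattice d ≃ Lattice d :=
  ⟨reflect, reflect, reflect_reflect, reflect_reflect⟩

/-- The pairing of all coordinates but the first. -/
def tailPairing (x : Lattice d) (θ : Fin d → ℝ) : ℝ := ∑ j ∈ Finset.univ.erase 0, (x j : ℝ) * θ j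

lemma pairing_eq_add_tail (x : Lattice d) (θ : Fin d → ℝ) :
    pairing x θ = x 0 * θ 0 + tailPairing x θ := by
  rw [pairing, tailPairing, ← Finset.add_sum_erase _ _ (Finset.mem_univ 0)]

lemma tailPairing_congr {x y : Lattice d} (h : ∀ j, j ≠ 0 → x j = y j) (θ : Fin d → ℝ) :
    tailPairing x θ = tailPairing y θ :=
  Finset.sum_congr rfl fun j hj => by rw [h j (Finset.ne_of_mem_erase hj)]

/-- Reflection affects only the first coordinate, so the four terms share the phase of the other
coordinates, and with `s = x_1 θ_1`, `t = y_1 θ_1` they factor as `(e^{-is} - e^{is}) (e^{it} -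
e^{-it})`. The result is symmetric in the two first coordinates, which is what annihilates the
current along `e_1`. -/
lemma imagePhase_eq (x y : Lattice d) (θ : Fin d → ℝ) :
    imagePhase x y θ = ((4 * Real.sin (x 0 * θ 0) * Real.sin (y 0 * θ 0) : ℝ) : ℂ) *
      Complex.exp (Complex.I * ((-tailPairing (x - y) θ : ℝ) : ℂ)) := by
  have h1 : ∀ z w : Lattice d, tailPairing (z - reflect w) θ = tailPairing (z - w) θ := fun z w =>
    tailPairing_congr (fun j hj => by simp [reflect_apply_of_ne w hj]) θ
  have h2 : ∀ z w : Lattice d, tailPairing (reflect z - w) θ = tailPairing (z - w) θ := fun z w =>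
    tailPairing_congr (fun j hj => by simp [reflect_apply_of_ne z hj]) θ
  simp only [imagePhase, pairing_eq_add_tail, h1, h2, Pi.sub_apply, reflect_apply_zero]
  push_cast
  rw [Complex.sin, Complex.sin]
  have e : ∀ s t : ℂ, Complex.exp (-Complex.I * (s + t))
      = Complex.exp (-s * Complex.I) * Complex.exp (Complex.I * (-t)) := fun s t => by
    rw [← Complex.exp_add]; congr 1; ring
  rw [e, e, e, e]
  have f : ∀ s t : ℂ, Complex.exp (-((s - t) * (θ 0 : ℂ)) * Complex.I)
      = Complex.exp (-(s * (θ 0 : ℂ)) * Complex.I) * Complex.exp ((t * (θ 0 : ℂ)) * Complex.I) :=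
    fun s t => by rw [← Complex.exp_add]; congr 1; ring
  have g : ∀ s : ℂ, Complex.exp ((-s * (θ 0 : ℂ)) * Complex.I)
      = Complex.exp (-(s * (θ 0 : ℂ)) * Complex.I) := fun s => by congr 1; ring
  have g' : ∀ s : ℂ, Complex.exp (-(-s * (θ 0 : ℂ)) * Complex.I)
      = Complex.exp ((s * (θ 0 : ℂ)) * Complex.I) := fun s => by congr 1; ring
  rw [f, f, f, f, g, g']
  linear_combination (-(Complex.exp (-(x 0 * θ 0 : ℂ) * Complex.I)
    - Complex.exp ((x 0 * θ 0 : ℂ) * Complex.I)) * (Complex.exp (-(y 0 * θ 0 : ℂ) * Complex.I)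
    - Complex.exp ((y 0 * θ 0 : ℂ) * Complex.I)) *
    Complex.exp (Complex.I * -(tailPairing (x - y) θ : ℂ))) * Complex.I_sq

lemma norm_imagePhase_le (x y : Lattice d) (θ : Fin d → ℝ) :
    ‖imagePhase x y θ‖ ≤ 4 * |(x 0 : ℝ)| * |(y 0 : ℝ)| * Real.sin (θ 0) ^ 2 := by
  rw [imagePhase_eq, norm_mul, norm_exp_I_mul, mul_one, Complex.norm_real, Real.norm_eq_abs,
    abs_mul, abs_mul, abs_of_pos (by norm_num : (0 : ℝ) < 4)]
  calc _ ≤ 4 * (|(x 0 : ℝ)| * |Real.sin (θ 0)|) * (|(y 0 : ℝ)| * |Real.sin (θ 0)|) := by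
        gcongr
        · exact abs_sin_int_mul_le _ _
        · exact abs_sin_int_mul_le _ _
    _ = _ := by rw [← sq_abs (Real.sin (θ 0))]; ring

lemma imagePhase_reflect_right (x y : Lattice d) (θ : Fin d → ℝ) :
    imagePhase x (reflect y) θ = -imagePhase x y θ := by
  simp only [imagePhase, reflect_reflect]; ring

lemma imagePhase_add (x y v : Lattice d) (hv : v 0 = 0) (θ : Fin d → ℝ) :
    imagePhase (x + v) (y + v) θ = imagePhase x y θ := by
  simp only [imagePhase, reflect_add_of_zero _ v hv, add_sub_add_right_eq_sub]

lemma imagePhase_neg (x y : Lattice d) (θ : Fin d → ℝ) :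
    imagePhase x y (-θ) = star (imagePhase x y θ) := by
  have h : ∀ z : Lattice d, Complex.exp (-Complex.I * (pairing z (-θ) : ℂ))
      = star (Complex.exp (-Complex.I * (pairing z θ : ℂ))) := fun z => by
    rw [Complex.star_def, ← Complex.exp_conj, pairing_neg_right]
    simp
  simp only [imagePhase, h, star_add, star_sub]

lemma continuous_imagePhase (x y : Lattice d) : Continuous (imagePhase x y) := by
  have h := fun z : Lattice d => continuous_pairing z
  unfold imagePhase
  fun_prop

end ImagePhase

/-! ### Weighted integrability of the limiting symbol. -/

section Bounds

variable {d n k : ℕ} [NeZero d] [NeZero k] {V : Lattice d → Matrix (Fin n) (Fin n) ℝ}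

omit [NeZero d] in
lemma exists_corr_bound {μ : (Fin k → ℕ) → Measure (Config d n)}
    (hq : ∀ nn ∈ halfIndex k, ∀ a b, Summable fun z => corr (μ nn) z a b) :
    ∃ q : ℝ, 0 ≤ q ∧ ∀ nn ∈ halfIndex k, ∀ θ, entrySum (fourier (corr (μ nn)) θ) ≤ q := by
  have h0 : ∀ nn, 0 ≤ ∑ a, ∑ b, ∑' x, |corr (μ nn) x a b| := fun nn =>
    Finset.sum_nonneg fun _ _ => Finset.sum_nonneg fun _ _ => tsum_nonneg fun _ => abs_nonneg _
  refine ⟨∑ nn ∈ halfIndex k, ∑ a, ∑ b, ∑' x, |corr (μ nn) x a b|,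
    Finset.sum_nonneg fun _ _ => h0 _, fun nn hn θ => ?_⟩
  refine le_trans ?_ (Finset.single_le_sum (f := fun nn => ∑ a, ∑ b, ∑' x, |corr (μ nn) x a b|)
    (fun _ _ => h0 _) hn)
  exact Finset.sum_le_sum fun a _ => Finset.sum_le_sum fun b _ => norm_fourier_le (hq nn hn) θ a b

omit [NeZero d] [NeZero k] in
lemma exists_sign_bound (hk : k ≤ d) (V : Lattice d → Matrix (Fin n) (Fin n) ℝ) :
    ∃ S : ℝ, 0 ≤ S ∧ (∀ nn (i : Fin n) θ, |1 + Seven hk V nn i θ| ≤ S) ∧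
      ∀ nn (i : Fin n) θ, |Sodd hk V nn i θ| ≤ S := by
  have h1 : 0 ≤ ∑ m ∈ (Finset.Icc 1 k).filter Even,
      ((Finset.powersetCard m (Finset.univ : Finset (Fin k))).card : ℝ) :=
    Finset.sum_nonneg fun _ _ => Nat.cast_nonneg _
  have h2 : 0 ≤ ∑ m ∈ (Finset.Icc 1 k).filter Odd,
      ((Finset.powersetCard m (Finset.univ : Finset (Fin k))).card : ℝ) :=
    Finset.sum_nonneg fun _ _ => Nat.cast_nonneg _
  refine ⟨_, add_nonneg (add_nonneg zero_le_one h1) h2, fun nn i θ => ?_, fun nn i θ => ?_⟩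
  · refine (abs_add_le _ _).trans ?_
    rw [abs_one]
    linarith [abs_Seven_le hk (V := V) nn i θ]
  · linarith [abs_Sodd_le hk (V := V) nn i θ]

omit [NeZero d] in
-- The reservoir symbols, the sign sums and the projections are bounded uniformly in `θ`. The only
-- unbounded ingredient is `C(θ)`, which enters at most quadratically.
lemma entrySum_qInfHat_le (hk : k ≤ d) (hS : ∀ a b, Summable fun x => V x a b)
    (hP : ∀ θ, (fourier V θ).PosSemidef) {μ : (Fin k → ℕ) → Measure (Config d n)}
    (hq : ∀ nn ∈ halfIndex k, ∀ a b, Summable fun z => corr (μ nn) z a b) :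
    ∃ C, 0 ≤ C ∧ ∀ θ, entrySum (qInfHat hk V μ θ) ≤ C * (1 + entrySum (fourier V θ)⁻¹) := by
  obtain ⟨q, hq0, hqb⟩ := exists_corr_bound hq
  obtain ⟨B, hB0, hB⟩ : ∃ B : ℝ, 0 ≤ B ∧ ∀ θ, entrySum (fourier V θ) ≤ B :=
    ⟨∑ a, ∑ b, ∑' x, |V x a b|, Finset.sum_nonneg fun _ _ => Finset.sum_nonneg fun _ _ =>
      tsum_nonneg fun _ => abs_nonneg _, fun θ => Finset.sum_le_sum fun a _ =>
      Finset.sum_le_sum fun b _ => norm_fourier_le hS θ a b⟩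
  obtain ⟨S, hS0, hS1, hS2⟩ := exists_sign_bound hk V
  set N : ℝ := ((halfIndex k).card : ℝ) with hN
  -- The blocks of `C` are `Ω⁻¹` and `-Ω`, and their squared norms are controlled by `V̂⁻¹` and by
  -- the bounded symbol `V̂`.
  have hκ : ∀ θ, entrySum (Cmat V θ) ^ 2 ≤ 2 * n ^ 4 * (B + entrySum (fourier V θ)⁻¹) := fun θ => by
    have h1 := sq_entrySum_le_of_isHermitian (Omega_isHermitian (V := V) θ)
    have h2 := sq_entrySum_le_of_isHermitian (Omega_isHermitian (V := V) θ).inv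
    rw [Omega_mul_self (hP θ)] at h1
    rw [Omega_inv_mul_self (hP θ)] at h2
    have h3 : (n : ℝ) ^ 4 * entrySum (fourier V θ) ≤ n ^ 4 * B := by gcongr; exact hB θ
    rw [Cmat, entrySum_fromBlocks, entrySum_zero, entrySum_neg]
    nlinarith [sq_nonneg (entrySum (Omega V θ)⁻¹ - entrySum (Omega V θ))]
  have hstar : ∀ θ, entrySum (CmatStar V θ) = entrySum (Cmat V θ) := fun θ => by
    rw [Cmat, CmatStar, entrySum_fromBlocks, entrySum_fromBlocks]; ring
  have hL1 : ∀ θ, ∀ nn ∈ halfIndex k, entrySum (L1plus V θ (fourier (corr (μ nn)) θ))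
      ≤ (1 + entrySum (Cmat V θ) ^ 2) * q := fun θ nn hn => by
    rw [L1plus, entrySum_smul]
    have h0 := hqb nn hn θ
    have h1 := entrySum_add_le (fourier (corr (μ nn)) θ)
      (Cmat V θ * fourier (corr (μ nn)) θ * CmatStar V θ)
    have h2 : entrySum (Cmat V θ * fourier (corr (μ nn)) θ * CmatStar V θ)
        ≤ entrySum (Cmat V θ) * q * entrySum (Cmat V θ) := by
      have hc := entrySum_nonneg (Cmat V θ)
      refine (entrySum_mul_le _ _).trans ?_
      rw [hstar]
      gcongr
      exact (entrySum_mul_le _ _).trans (by gcongr)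
    have h3 : ‖(1 / 2 : ℂ)‖ = 1 / 2 := by norm_num
    rw [h3]
    have h4 : 0 ≤ entrySum (Cmat V θ) ^ 2 * q := by positivity
    nlinarith
  have hL2 : ∀ θ, ∀ nn ∈ halfIndex k, entrySum (L2minus V θ (fourier (corr (μ nn)) θ))
      ≤ (1 + entrySum (Cmat V θ) ^ 2) * q := fun θ nn hn => by
    rw [L2minus, entrySum_smul, sub_eq_add_neg]
    have h0 := hqb nn hn θ
    have hc := entrySum_nonneg (Cmat V θ)
    have h1 := entrySum_add_le (Cmat V θ * fourier (corr (μ nn)) θ)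
      (-(fourier (corr (μ nn)) θ * CmatStar V θ))
    rw [entrySum_neg] at h1
    have h2 : entrySum (Cmat V θ * fourier (corr (μ nn)) θ) ≤ entrySum (Cmat V θ) * q :=
      (entrySum_mul_le _ _).trans (by gcongr)
    have h2' : entrySum (fourier (corr (μ nn)) θ * CmatStar V θ) ≤ q * entrySum (Cmat V θ) := by
      refine (entrySum_mul_le _ _).trans ?_
      rw [hstar]; gcongr
    have h3 : ‖(1 / 2 : ℂ)‖ = 1 / 2 := by norm_num
    rw [h3]
    -- `L2minus` is linear in `C`; it is brought under the same quadratic bound by `2c ≤ 1 + c²`.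
    have h4 : 0 ≤ (1 - entrySum (Cmat V θ)) ^ 2 * q := by positivity
    nlinarith
  have hpow : ‖(1 / 2 ^ k : ℂ)‖ ≤ 1 := by
    rw [norm_div, norm_one, norm_pow, Complex.norm_ofNat]
    exact div_le_one_of_le₀ (one_le_pow₀ (by norm_num)) (by positivity)
  have hsum : ∀ θ (c : (Fin k → ℕ) → ℝ)
      (L : (Fin k → ℕ) → Matrix (Fin n ⊕ Fin n) (Fin n ⊕ Fin n) ℂ),
      (∀ nn ∈ halfIndex k, |c nn| ≤ S) →
      (∀ nn ∈ halfIndex k, entrySum (L nn) ≤ (1 + entrySum (Cmat V θ) ^ 2) * q) →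
      entrySum ((1 / 2 ^ k : ℂ) • ∑ nn ∈ halfIndex k, (c nn : ℂ) • L nn)
        ≤ N * (S * ((1 + entrySum (Cmat V θ) ^ 2) * q)) := by
    intro θ c L hc hL
    rw [entrySum_smul]
    refine (mul_le_of_le_one_left (entrySum_nonneg _) hpow).trans ?_
    refine (entrySum_sum_le _ _).trans ?_
    rw [hN, ← nsmul_eq_mul]
    refine Finset.sum_le_card_nsmul _ _ _ fun nn hn => ?_
    rw [entrySum_smul, Complex.norm_real, Real.norm_eq_abs]
    have := entrySum_nonneg (L nn)
    exact mul_le_mul (hc nn hn) (hL nn hn) this hS0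
  have hmain : ∀ θ, entrySum (qInfHat hk V μ θ)
      ≤ n * ((2 * n ^ 2) * (2 * (N * (S * ((1 + entrySum (Cmat V θ) ^ 2) * q)))) * (2 * n ^ 2)) := by
    intro θ
    refine (entrySum_sum_le _ _).trans ?_
    have hX : 0 ≤ 2 * (N * (S * ((1 + entrySum (Cmat V θ) ^ 2) * q))) := by positivity
    have hterm : ∀ i : Fin n, entrySum (fromBlocks (bandProj V i θ) 0 0 (bandProj V i θ) *
        (Mplus hk V μ i θ + Complex.I • Mminus hk V μ i θ) *
        fromBlocks (bandProj V i θ) 0 0 (bandProj V i θ))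
        ≤ (2 * n ^ 2) * (2 * (N * (S * ((1 + entrySum (Cmat V θ) ^ 2) * q)))) * (2 * n ^ 2) := by
      intro i
      have h1 : entrySum (fromBlocks (bandProj V i θ) 0 0 (bandProj V i θ)) ≤ 2 * n ^ 2 := by
        rw [entrySum_fromBlocks, entrySum_zero]
        linarith [entrySum_bandProj_le (V := V) i θ]
      have h2 := hsum θ (fun nn => 1 + Seven hk V nn i θ) _ (fun nn _ => hS1 nn i θ) (hL1 θ)
      have h3 := hsum θ (fun nn => Sodd hk V nn i θ) _ (fun nn _ => hS2 nn i θ) (hL2 θ)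
      have h4 : entrySum (Mplus hk V μ i θ + Complex.I • Mminus hk V μ i θ)
          ≤ 2 * (N * (S * ((1 + entrySum (Cmat V θ) ^ 2) * q))) := by
        refine (entrySum_add_le _ _).trans ?_
        rw [entrySum_smul, Complex.norm_I, one_mul, two_mul]
        exact add_le_add h2 h3
      refine (entrySum_mul_le _ _).trans ?_
      refine mul_le_mul ((entrySum_mul_le _ _).trans ?_) h1 (entrySum_nonneg _) (by positivity)
      exact mul_le_mul h1 h4 (entrySum_nonneg _) (by positivity)
    refine (Finset.sum_le_card_nsmul _ _ _ fun i _ => hterm i).trans ?_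
    rw [nsmul_eq_mul]
    gcongr
    exact (Finset.card_le_univ _).trans_eq (Fintype.card_fin n)
  refine ⟨n * ((2 * n ^ 2) * (2 * (N * (S * ((1 + 2 * n ^ 4 * (B + 1)) * q)))) * (2 * n ^ 2)),
    by positivity, fun θ => (hmain θ).trans ?_⟩
  have hD := entrySum_nonneg (fourier V θ)⁻¹
  have h5 : 1 + entrySum (Cmat V θ) ^ 2
      ≤ (1 + 2 * n ^ 4 * (B + 1)) * (1 + entrySum (fourier V θ)⁻¹) := by
    have h6 : 0 ≤ 2 * (n : ℝ) ^ 4 * B * entrySum (fourier V θ)⁻¹ := by positivity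
    have h7 : 0 ≤ 2 * (n : ℝ) ^ 4 := by positivity
    nlinarith [hκ θ]
  calc _ ≤ n * ((2 * n ^ 2) * (2 * (N * (S * (((1 + 2 * n ^ 4 * (B + 1)) *
        (1 + entrySum (fourier V θ)⁻¹)) * q)))) * (2 * n ^ 2)) := by gcongr
    _ = _ := by ring

/-- The weighted integrability of `q̂^+_∞`. -/
lemma integrableOn_sin_sq_mul_qInfHat (hk : k ≤ d) (hS : ∀ a b, Summable fun x => V x a b)
    (hP : ∀ θ, (fourier V θ).PosSemidef) (hW : WeakInverseIntegrability V)
    {μ : (Fin k → ℕ) → Measure (Config d n)}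
    (hq : ∀ nn ∈ halfIndex k, ∀ a b, Summable fun z => corr (μ nn) z a b)
    (a b : Fin n ⊕ Fin n) :
    IntegrableOn (fun θ => Real.sin (θ 0) ^ 2 * ‖qInfHat hk V μ θ a b‖) (torus d) := by
  obtain ⟨C, hC, hb⟩ := entrySum_qInfHat_le hk hS hP hq
  have hm := measurableEntries_qInfHat hk hS (fun θ => (hP θ).isHermitian) hq a b
  have hsin : Continuous fun θ : Fin d → ℝ => Real.sin (θ 0) ^ 2 := by fun_prop
  have h1 : IntegrableOn (fun θ : Fin d → ℝ => Real.sin (θ 0) ^ 2) (torus d) :=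
    hsin.continuousOn.integrableOn_compact isCompact_torus
  have h2 : IntegrableOn (fun θ : Fin d → ℝ => C * (Real.sin (θ 0) ^ 2 +
      ∑ a, ∑ b, Real.sin (θ 0) ^ 2 * ‖(fourier V θ)⁻¹ a b‖)) (torus d) :=
    (h1.add (integrable_finsetSum _ fun a _ => integrable_finsetSum _ fun b _ =>
      hW.2 a b)).const_mul C
  refine Integrable.mono' h2 ?_ (Filter.Eventually.of_forall fun θ => ?_)
  · exact (hsin.measurable.mul hm.norm).aestronglyMeasurable
  · rw [Real.norm_of_nonneg (by positivity)]
    calc _ ≤ Real.sin (θ 0) ^ 2 * (C * (1 + entrySum (fourier V θ)⁻¹)) := by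
          gcongr
          exact (norm_apply_le_entrySum _ _ _).trans (hb θ)
      _ = _ := by
          simp only [entrySum, ← Finset.mul_sum]; ring

end Bounds

/-! ### Half-space covariances obtained from a symbol by the method of images. -/

section ImageCovariance

variable {d : ℕ} [NeZero d] {ι : Type*}

/-- The properties of a matrix density on the torus needed to define a half-space covariance. -/
structure IsSineDensity (q : (Fin d → ℝ) → Matrix ι ι ℂ) : Prop where
  measurable : MeasurableEntries q
  integrable : ∀ a b, IntegrableOn (fun θ => Real.sin (θ 0) ^ 2 * ‖q θ a b‖) (torus d)
  map_neg : ∀ θ, q (-θ) = (q θ).map star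

/-- The covariance on the half-space with density `q`, by the method of images. -/
def imageCov (q : (Fin d → ℝ) → Matrix ι ι ℂ) (x y : Lattice d) : Matrix ι ι ℂ :=
  Matrix.of fun a b =>
    (1 / (2 * Real.pi) ^ d : ℂ) * ∫ θ in torus d, imagePhase x y θ * q θ a b

variable {q : (Fin d → ℝ) → Matrix ι ι ℂ}

lemma IsSineDensity.norm_imagePhase_mul_le (x y : Lattice d) (θ : Fin d → ℝ) (a b : ι) :
    ‖imagePhase x y θ * q θ a b‖
      ≤ 4 * |(x 0 : ℝ)| * |(y 0 : ℝ)| * (Real.sin (θ 0) ^ 2 * ‖q θ a b‖) := by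
  rw [norm_mul]
  calc _ ≤ 4 * |(x 0 : ℝ)| * |(y 0 : ℝ)| * Real.sin (θ 0) ^ 2 * ‖q θ a b‖ := by
        gcongr; exact norm_imagePhase_le x y θ
    _ = _ := by ring

lemma IsSineDensity.integrableOn_imagePhase_mul (hq : IsSineDensity q) (x y : Lattice d) (a b : ι) :
    IntegrableOn (fun θ => imagePhase x y θ * q θ a b) (torus d) := by
  refine Integrable.mono' ((hq.integrable a b).const_mul (4 * |(x 0 : ℝ)| * |(y 0 : ℝ)|)) ?_
    (Filter.Eventually.of_forall fun θ => norm_imagePhase_mul_le x y θ a b)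
  exact ((continuous_imagePhase x y).measurable.mul (hq.measurable a b)).aestronglyMeasurable

lemma IsSineDensity.exists_norm_imageCov_le [Fintype ι] (hq : IsSineDensity q) :
    ∃ C, 0 ≤ C ∧ ∀ x y a b, ‖imageCov q x y a b‖ ≤ C * (|(x 0 : ℝ)| * |(y 0 : ℝ)|) := by
  set c : ℝ := ‖(1 / (2 * Real.pi) ^ d : ℂ)‖
  have hI : ∀ a b, 0 ≤ ∫ θ in torus d, Real.sin (θ 0) ^ 2 * ‖q θ a b‖ := fun a b =>
    integral_nonneg fun θ => by positivity
  refine ⟨c * (4 * ∑ a, ∑ b, ∫ θ in torus d, Real.sin (θ 0) ^ 2 * ‖q θ a b‖), ?_, ?_⟩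
  · have : 0 ≤ ∑ a, ∑ b, ∫ θ in torus d, Real.sin (θ 0) ^ 2 * ‖q θ a b‖ :=
      Finset.sum_nonneg fun a _ => Finset.sum_nonneg fun b _ => hI a b
    positivity
  · intro x y a b
    have h1 : ‖∫ θ in torus d, imagePhase x y θ * q θ a b‖
        ≤ 4 * |(x 0 : ℝ)| * |(y 0 : ℝ)| * ∫ θ in torus d, Real.sin (θ 0) ^ 2 * ‖q θ a b‖ := by
      rw [← integral_const_mul]
      exact norm_integral_le_of_norm_le ((hq.integrable a b).const_mul _)
        (Filter.Eventually.of_forall fun θ => norm_imagePhase_mul_le x y θ a b)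
    have h2 : ∫ θ in torus d, Real.sin (θ 0) ^ 2 * ‖q θ a b‖
        ≤ ∑ a, ∑ b, ∫ θ in torus d, Real.sin (θ 0) ^ 2 * ‖q θ a b‖ :=
      (Finset.single_le_sum (f := fun b => ∫ θ in torus d, Real.sin (θ 0) ^ 2 * ‖q θ a b‖)
        (fun b _ => hI a b) (Finset.mem_univ b)).trans
      (Finset.single_le_sum (f := fun a => ∑ b, ∫ θ in torus d, Real.sin (θ 0) ^ 2 * ‖q θ a b‖)
        (fun a _ => Finset.sum_nonneg fun b _ => hI a b) (Finset.mem_univ a))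
    rw [imageCov, of_apply, norm_mul]
    calc _ ≤ c * (4 * |(x 0 : ℝ)| * |(y 0 : ℝ)| *
          ∑ a, ∑ b, ∫ θ in torus d, Real.sin (θ 0) ^ 2 * ‖q θ a b‖) := by
          gcongr
          exact h1.trans (by gcongr)
      _ = _ := by ring

/-- The substitution `θ ↦ -θ` preserves the torus and conjugates the integrand, so the integral
equals its own conjugate. -/
lemma IsSineDensity.imageCov_im (hq : IsSineDensity q) (x y : Lattice d) (a b : ι) :
    (imageCov q x y a b).im = 0 := by
  have h1 : star (∫ θ in torus d, imagePhase x y θ * q θ a b)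
      = ∫ θ in torus d, imagePhase x y θ * q θ a b := by
    rw [Complex.star_def, ← integral_conj, ← setIntegral_torus_flip Finset.univ]
    refine integral_congr_ae (Filter.Eventually.of_forall fun θ => ?_)
    simp only [flip_univ, hq.map_neg, imagePhase_neg, map_apply, map_mul, Complex.star_def,
      Complex.conj_conj]
  have h2 : star (imageCov q x y a b) = imageCov q x y a b := by
    rw [imageCov, of_apply, star_mul', h1]
    congr 1
    simp
  exact Complex.conj_eq_iff_im.1 h2

lemma imageCov_reflect_right (x y : Lattice d) (a b : ι) :
    imageCov q x (reflect y) a b = -imageCov q x y a b := by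
  simp only [imageCov, of_apply, imagePhase_reflect_right, neg_mul, integral_neg, mul_neg]

lemma imageCov_add (x y v : Lattice d) (hv : v 0 = 0) :
    imageCov q (x + v) (y + v) = imageCov q x y := by
  simp only [imageCov, imagePhase_add x y v hv]

lemma imageCov_congr {x y x' y' : Lattice d} (h : ∀ θ, imagePhase x y θ = imagePhase x' y' θ) :
    imageCov q x y = imageCov q x' y' := by
  simp only [imageCov, h]

end ImageCovariance

/-! ### Absolute convergence of the current series. -/

section CurrentBound

variable {d n : ℕ} [NeZero d] {V : Lattice d → Matrix (Fin n) (Fin n) ℝ}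

omit [NeZero d] in
lemma shift_apply_self (l : Fin d) (x : Lattice d) (m : ℤ) : shift l x m l = x l + m := by
  simp [shift]

omit [NeZero d] in
lemma abs_shift_apply_le (l j : Fin d) (x : Lattice d) (m : ℤ) :
    1 + |(shift l x m j : ℝ)| ≤ (1 + |(x j : ℝ)|) * (1 + |(m : ℝ)|) := by
  have h1 : |(shift l x m j : ℝ)| ≤ |(x j : ℝ)| + |(m : ℝ)| := by
    by_cases h : j = l
    · subst h
      rw [shift_apply_self]; push_cast; exact abs_add_le _ _
    · rw [shift, Function.update_of_ne h]
      linarith [abs_nonneg (m : ℝ)]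
  nlinarith [mul_nonneg (abs_nonneg (x j : ℝ)) (abs_nonneg (m : ℝ))]

lemma cutSign_eq_zero_of_not {l : Fin d} {x : Lattice d} {m : ℤ} {y : Lattice d}
    (h : ¬(0 ≤ shift l x m 0 ∧ 0 ≤ y 0)) : cutSign l x m y = 0 := if_neg h

lemma abs_cutSign_le (l : Fin d) (x : Lattice d) (m : ℤ) (y : Lattice d) :
    |cutSign l x m y| ≤ 1 := by
  unfold cutSign; split_ifs <;> simp

/-- The two ends of a contributing bond lie on opposite sides of the cut, so its extent along `e_l`
is at least `|m|`. -/
lemma natAbs_le_of_cutSign_ne_zero {l : Fin d} {x : Lattice d} {m : ℤ} {y : Lattice d}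
    (h : cutSign l x m y ≠ 0) : m.natAbs ≤ ((shift l x m - y) l).natAbs := by
  rw [Pi.sub_apply, shift_apply_self]
  unfold cutSign at h
  split_ifs at h <;> first | omega | exact absurd rfl h

omit [NeZero d] in
-- In the variables `(m, X - y)` the weight is a product of a function on `ℤ` and a function on the
-- lattice.
lemma summable_geometric_mul_polyWeight {r : ℝ} (hr0 : 0 < r) (hr1 : r < 1) (l : Fin d)
    (x : Lattice d) : Summable fun p : ℤ × Lattice d =>
      ((1 + |(p.1 : ℝ)|) ^ 2 * r ^ p.1.natAbs) * polyWeight r (shift l x p.1 - p.2) := by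
  have h1 : Summable fun p : ℤ × Lattice d =>
      ((1 + |(p.1 : ℝ)|) ^ 2 * r ^ p.1.natAbs) * polyWeight r p.2 :=
    Summable.mul_of_nonneg (f := fun t : ℤ => (1 + |(t : ℝ)|) ^ 2 * r ^ t.natAbs)
      (g := fun z : Lattice d => polyWeight r z)
      (summable_poly_geometric hr0.le hr1) (summable_polyWeight hr0.le hr1)
      (fun t => mul_nonneg (sq_nonneg _) (pow_nonneg hr0.le _))
      (fun z => (expWeight_nonneg hr0.le z).trans (expWeight_le_polyWeight hr0.le z))
  have hinj : Function.Injective fun p : ℤ × Lattice d => (p.1, shift l x p.1 - p.2) := by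
    rintro ⟨m, y⟩ ⟨m', y'⟩ h
    simp only [Prod.mk.injEq] at h
    obtain ⟨rfl, h⟩ := h
    simpa using h
  have h2 := h1.comp_injective hinj
  simp only [Function.comp_def] at h2
  exact h2

/-- A summable majorant for the terms of the current. -/
lemma exists_summable_current_bound (hV : ExpDecay V) (l : Fin d) (x : Lattice d) :
    ∃ G : ℤ × Lattice d → ℝ, Summable G ∧ ∀ p a b,
      |cutSign l x p.1 p.2| * ((shift l x p.1 0 : ℝ) ^ 2 + (p.2 0 : ℝ) ^ 2) *
        |halfKernel V (shift l x p.1) p.2 a b| ≤ G p := by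
  obtain ⟨C, hC, r, hr0, hr1, hb⟩ := hV.exists_expWeight
  refine ⟨_, (summable_geometric_mul_polyWeight hr0 hr1 l x).mul_left
    (4 * C * (1 + |(x 0 : ℝ)|) ^ 2), ?_⟩
  rintro ⟨m, y⟩ a b
  simp only []
  have hnn : 0 ≤ polyWeight r (shift l x m - y) :=
    (expWeight_nonneg hr0.le _).trans (expWeight_le_polyWeight hr0.le _)
  by_cases hc : cutSign l x m y = 0
  · rw [hc, abs_zero, zero_mul, zero_mul]
    positivity
  · have hpos : 0 ≤ shift l x m 0 ∧ 0 ≤ y 0 := by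
      by_contra h; exact hc (cutSign_eq_zero_of_not h)
    set X := shift l x m with hX
    have hK : |halfKernel V X y a b| ≤ 2 * C * (expWeight r (X - y) * expWeight r (X - y)) := by
      have h1 := hb (X - y) a b
      have h2 := hb (X - reflect y) a b
      -- Both sites lie in the half-space, so the image of `y` is at least as far from `X` as `y`
      -- is: `X_1 + y_1 ≥ |X_1 - y_1|`.
      have h3 : expWeight (r ^ 2) (X - reflect y) ≤ expWeight (r ^ 2) (X - y) := by
        refine expWeight_mono (by positivity) (by nlinarith) fun j => ?_
        by_cases hj : j = 0
        · subst hj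
          simp only [Pi.sub_apply, reflect_apply_zero]
          omega
        · simp [reflect_apply_of_ne _ hj]
      rw [← expWeight_sq]
      have h4 := mul_le_mul_of_nonneg_left h3 hC.le
      calc _ = |V (X - y) a b - V (X - reflect y) a b| := rfl
        _ ≤ |V (X - y) a b| + |V (X - reflect y) a b| := abs_sub _ _
        _ ≤ _ := by linarith
    -- Half of the decay becomes decay in `m`. The other half is kept for `X - y`, where it absorbs
    -- the quadratic growth of the covariance.
    have hE : expWeight r (X - y) ≤ r ^ m.natAbs :=
      expWeight_le_pow hr0.le hr1.le _ l (natAbs_le_of_cutSign_ne_zero hc)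
    have hEnn := expWeight_nonneg hr0.le (X - y)
    have hX0 := abs_shift_apply_le l 0 x m
    rw [← hX] at hX0
    have hy0 : 1 + |(y 0 : ℝ)| ≤ (1 + |(X 0 : ℝ)|) * (1 + |((X - y) 0 : ℝ)|) := by
      have h5 : |(y 0 : ℝ)| ≤ |(X 0 : ℝ)| + |((X - y) 0 : ℝ)| := by
        have : (y 0 : ℝ) = X 0 - ((X - y) 0 : ℤ) := by rw [Pi.sub_apply]; push_cast; ring
        rw [this]
        exact abs_sub _ _
      nlinarith [mul_nonneg (abs_nonneg (X 0 : ℝ)) (abs_nonneg ((X - y) 0 : ℝ))]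
    have hsq : (X 0 : ℝ) ^ 2 + (y 0 : ℝ) ^ 2
        ≤ 2 * ((1 + |(x 0 : ℝ)|) ^ 2 * (1 + |(m : ℝ)|) ^ 2 *
          ((1 + |((X - y) 0 : ℝ)|) * (1 + |((X - y) 0 : ℝ)|))) := by
      have hz : (1 : ℝ) ≤ 1 + |((X - y) 0 : ℝ)| := by linarith [abs_nonneg ((X - y) 0 : ℝ)]
      set u := 1 + |((X - y) 0 : ℝ)|
      set v := (1 + |(x 0 : ℝ)|) * (1 + |(m : ℝ)|)
      have hv0 : 0 ≤ v := by positivity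
      have h6 : 1 + |(X 0 : ℝ)| ≤ v * u := hX0.trans (le_mul_of_one_le_right hv0 hz)
      have h7 : 1 + |(y 0 : ℝ)| ≤ v * u := hy0.trans (by gcongr)
      have h8 : (X 0 : ℝ) ^ 2 ≤ (v * u) ^ 2 := by
        rw [← sq_abs (X 0 : ℝ)]
        have := abs_nonneg (X 0 : ℝ)
        gcongr; linarith
      have h9 : (y 0 : ℝ) ^ 2 ≤ (v * u) ^ 2 := by
        rw [← sq_abs (y 0 : ℝ)]
        have := abs_nonneg (y 0 : ℝ)
        gcongr; linarith
      calc _ ≤ 2 * (v * u) ^ 2 := by linarith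
        _ = _ := by simp only [v]; ring
    have hW := mul_expWeight_le_polyWeight hr0.le (X - y) 0 0
    set u := 1 + |((X - y) 0 : ℝ)|
    have hu : 0 ≤ u := by positivity
    set M := (1 + |(x 0 : ℝ)|) ^ 2 * (1 + |(m : ℝ)|) ^ 2
    have hM : 0 ≤ M := by positivity
    calc |cutSign l x m y| * ((X 0 : ℝ) ^ 2 + (y 0 : ℝ) ^ 2) * |halfKernel V X y a b|
        ≤ 1 * (2 * (M * (u * u))) *
          (2 * C * (expWeight r (X - y) * expWeight r (X - y))) := by
          gcongr
          exact abs_cutSign_le l x m y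
      _ = 4 * C * M * (expWeight r (X - y) * (u * u * expWeight r (X - y))) := by ring
      _ ≤ 4 * C * M * (r ^ m.natAbs * polyWeight r (X - y)) := by gcongr
      _ = _ := by simp only [M]; ring

end CurrentBound

/-! ### The current of a general sine density, and its vanishing along `e_1`. -/

section GeneralCurrent

variable {d n : ℕ} [NeZero d] {V : Lattice d → Matrix (Fin n) (Fin n) ℝ}
  {q : (Fin d → ℝ) → Matrix (Fin n ⊕ Fin n) (Fin n ⊕ Fin n) ℂ}

/-- The terms of the current for the half-space covariance with density `q`. -/
def densityCurrentTerm (V : Lattice d → Matrix (Fin n) (Fin n) ℝ)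
    (q : (Fin d → ℝ) → Matrix (Fin n ⊕ Fin n) (Fin n ⊕ Fin n) ℂ) (l : Fin d) (x : Lattice d)
    (my : ℤ × Lattice d) : ℂ :=
  (cutSign l x my.1 my.2 : ℂ) * ∑ a, ∑ b, imageCov q (shift l x my.1) my.2 (Sum.inr a) (Sum.inl b) *
    (halfKernel V (shift l x my.1) my.2 a b : ℂ)

lemma currentTerm_eq {k : ℕ} [NeZero k] (hk : k ≤ d) (μ : (Fin k → ℕ) → Measure (Config d n))
    (l : Fin d) (x : Lattice d) (my : ℤ × Lattice d) :
    currentTerm hk V μ l x my = densityCurrentTerm V (qInfHat hk V μ) l x my := by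
  simp only [currentTerm, densityCurrentTerm, Matrix.trace, Matrix.diag, Matrix.mul_apply,
    toBlocks₂₁, of_apply, map_apply, transpose_apply]
  rfl

lemma summable_densityCurrentTerm (hV : ExpDecay V) (hq : IsSineDensity q) (l : Fin d)
    (x : Lattice d) : Summable (densityCurrentTerm V q l x) := by
  obtain ⟨G, hG, hb⟩ := exists_summable_current_bound hV l x
  obtain ⟨C, hC, hQ⟩ := hq.exists_norm_imageCov_le
  refine Summable.of_norm_bounded (g := fun p => ∑ _a : Fin n, ∑ _b : Fin n, C * G p)
    (summable_sum fun _ _ => summable_sum fun _ _ => hG.mul_left C) fun p => ?_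
  rw [densityCurrentTerm, norm_mul, Complex.norm_real, Real.norm_eq_abs]
  calc _ ≤ |cutSign l x p.1 p.2| * ∑ a, ∑ b,
        (C * (|(shift l x p.1 0 : ℝ)| * |(p.2 0 : ℝ)|)) *
          |halfKernel V (shift l x p.1) p.2 a b| := by
        gcongr
        refine (norm_sum_le _ _).trans (Finset.sum_le_sum fun a _ => ?_)
        refine (norm_sum_le _ _).trans (Finset.sum_le_sum fun b _ => ?_)
        rw [norm_mul, Complex.norm_real, Real.norm_eq_abs]
        gcongr
        exact hQ _ _ _ _
    _ = ∑ a, ∑ b, C * (|cutSign l x p.1 p.2| * (|(shift l x p.1 0 : ℝ)| * |(p.2 0 : ℝ)|) *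
          |halfKernel V (shift l x p.1) p.2 a b|) := by
        simp_rw [Finset.mul_sum]
        exact Finset.sum_congr rfl fun a _ => Finset.sum_congr rfl fun b _ => by ring
    _ ≤ _ := by
        refine Finset.sum_le_sum fun a _ => Finset.sum_le_sum fun b _ => ?_
        gcongr
        refine le_trans ?_ (hb p a b)
        gcongr
        rw [← sq_abs (shift l x p.1 0 : ℝ), ← sq_abs (p.2 0 : ℝ)]
        nlinarith [sq_nonneg (|(shift l x p.1 0 : ℝ)| - |(p.2 0 : ℝ)|),
          sq_nonneg (|(shift l x p.1 0 : ℝ)|), sq_nonneg (|(p.2 0 : ℝ)|)]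

lemma densityCurrentTerm_im (hq : IsSineDensity q) (l : Fin d) (x : Lattice d)
    (p : ℤ × Lattice d) : (densityCurrentTerm V q l x p).im = 0 := by
  rw [densityCurrentTerm, Complex.im_ofReal_mul, Complex.im_sum]
  simp only [Complex.im_sum, Complex.im_mul_ofReal, hq.imageCov_im, zero_mul,
    Finset.sum_const_zero, mul_zero]

/-- The exchange of the first coordinates of `x + m e_1` and `y`. -/
def swapFirst (x : Lattice d) : ℤ × Lattice d ≃ ℤ × Lattice d :=
  Function.Involutive.toPerm (fun p => (p.2 0 - x 0, Function.update p.2 0 (x 0 + p.1))) fun p => by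
    rcases p with ⟨m, y⟩
    simp

/-- The exchange reverses the direction of the crossing. The image phase depends on the first
coordinates only through a symmetric product of sines; `X - y` turns into its reflection, under
which `V` is invariant; and `X - y_-` has first coordinate `X_1 + y_1`, which does not change. -/
lemma densityCurrentTerm_swapFirst (hrefl : ∀ x, V (reflect x) = V x) (x : Lattice d)
    (p : ℤ × Lattice d) :
    densityCurrentTerm V q 0 x (swapFirst x p) = -densityCurrentTerm V q 0 x p := by
  rcases p with ⟨m, y⟩
  have e : swapFirst x (m, y) = (y 0 - x 0, Function.update y 0 (x 0 + m)) := rfl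
  rw [e]
  set y' := Function.update y 0 (x 0 + m) with hy'
  have hX'0 : shift 0 x (y 0 - x 0) 0 = y 0 := by rw [shift_apply_self]; ring
  have hX0 : shift 0 x m 0 = x 0 + m := shift_apply_self _ _ _
  have hy'0 : y' 0 = x 0 + m := by simp [hy']
  have htail : ∀ j, j ≠ 0 → shift 0 x (y 0 - x 0) j = x j := fun j hj => by simp [shift, hj]
  have htail' : ∀ j, j ≠ 0 → shift 0 x m j = x j := fun j hj => by simp [shift, hj]
  have hty : ∀ j, j ≠ 0 → y' j = y j := fun j hj => by simp [hy', hj]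
  have hcut : cutSign 0 x (y 0 - x 0) y' = -cutSign 0 x m y := by
    unfold cutSign
    rw [hX'0, hy'0, hX0]
    split_ifs <;> first | omega | norm_num
  have hcov : imageCov q (shift 0 x (y 0 - x 0)) y' = imageCov q (shift 0 x m) y := by
    refine imageCov_congr fun θ => ?_
    rw [imagePhase_eq, imagePhase_eq, hX'0, hy'0, hX0,
      tailPairing_congr (y := shift 0 x m - y) fun j hj => by
        rw [Pi.sub_apply, Pi.sub_apply, htail j hj, htail' j hj, hty j hj]]
    congr 2
    ring
  have hker : halfKernel V (shift 0 x (y 0 - x 0)) y' = halfKernel V (shift 0 x m) y := by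
    unfold halfKernel
    have h1 : shift 0 x (y 0 - x 0) - y' = reflect (shift 0 x m - y) := by
      funext j
      by_cases hj : j = 0
      · subst hj
        simp only [Pi.sub_apply, reflect_apply_zero, hX'0, hy'0, hX0]; ring
      · simp only [Pi.sub_apply, reflect_apply_of_ne _ hj, htail j hj, htail' j hj, hty j hj]
    have h2 : shift 0 x (y 0 - x 0) - reflect y' = shift 0 x m - reflect y := by
      funext j
      by_cases hj : j = 0
      · subst hj
        simp only [Pi.sub_apply, reflect_apply_zero, hX'0, hy'0, hX0]; ring
      · simp only [Pi.sub_apply, reflect_apply_of_ne _ hj, htail j hj, htail' j hj, hty j hj]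
    rw [h1, h2, hrefl]
  rw [densityCurrentTerm, densityCurrentTerm]
  simp only [hcut, hcov, hker]
  push_cast
  rw [neg_mul]

/-- The sum equals its own negative. Reindexing and negation hold for `tsum` without summability, so
none is required. -/
lemma tsum_densityCurrentTerm_zero (hrefl : ∀ x, V (reflect x) = V x) (x : Lattice d) :
    ∑' p, densityCurrentTerm V q 0 x p = 0 := by
  have h : ∑' p, densityCurrentTerm V q 0 x p = -∑' p, densityCurrentTerm V q 0 x p := by
    conv_lhs => rw [← (swapFirst x).tsum_eq]
    simp only [densityCurrentTerm_swapFirst hrefl, tsum_neg]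
  exact self_eq_neg.1 h

end GeneralCurrent

/-! ### The expected energy current. -/

section Mean

/-- By Tonelli the series of norms has finite integral, so the series converges absolutely almost
everywhere and the integral of its norm is finite. It supplies the integrability of the energy
current itself. -/
lemma integrable_tsum_of_summable_integral_norm {α ι E : Type*} [MeasurableSpace α] {μ : Measure α}
    [NormedAddCommGroup E] [NormedSpace ℝ E] [CompleteSpace E] [Countable ι] {F : ι → α → E}
    (hF : ∀ i, Integrable (F i) μ) (hs : Summable fun i => ∫ a, ‖F i a‖ ∂μ) :
    Integrable (fun a => ∑' i, F i a) μ := by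
  have h1 : ∑' i, ∫⁻ a, ‖F i a‖ₑ ∂μ ≠ ⊤ := by
    have : ∀ i, ∫⁻ a, ‖F i a‖ₑ ∂μ = ENNReal.ofReal (∫ a, ‖F i a‖ ∂μ) := fun i => by
      rw [ofReal_integral_norm_eq_lintegral_enorm (hF i)]
    simp only [this]
    exact hs.tsum_ofReal_ne_top
  rw [← lintegral_tsum fun i => (hF i).1.enorm] at h1
  have hsum : ∀ᵐ a ∂μ, Summable fun i => F i a := by
    filter_upwards [ae_lt_top' (AEMeasurable.tsum fun i => (hF i).1.enorm) h1] with a ha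
    refine Summable.of_norm ?_
    have h2 : ∑' i, (‖F i a‖₊ : ENNReal) ≠ ⊤ := ha.ne
    exact NNReal.summable_coe.2 (ENNReal.tsum_coe_ne_top_iff_summable.1 h2)
  refine ⟨?_, ?_⟩
  · refine aestronglyMeasurable_of_tendsto_ae (Filter.atTop : Filter (Finset ι))
      (f := fun s a => ∑ i ∈ s, F i a) (fun s => Finset.aestronglyMeasurable_fun_sum s
        fun i _ => (hF i).1) ?_
    filter_upwards [hsum] with a ha using ha.hasSum
  · refine lt_of_le_of_lt (lintegral_mono_ae ?_) (lt_top_iff_ne_top.2 h1)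
    filter_upwards with a
    exact enorm_tsum_le_tsum_enorm

variable {d n : ℕ} [NeZero d] {V : Lattice d → Matrix (Fin n) (Fin n) ℝ}
  {q : (Fin d → ℝ) → Matrix (Fin n ⊕ Fin n) (Fin n ⊕ Fin n) ℂ}

/-- The mean of the energy current in a state with half-space covariance of density `q`. -/
lemma integral_energyCurrent (hV : ExpDecay V) (hq : IsSineDensity q) {P : Measure (Config d n)}
    (hL2 : ∀ x a, 0 ≤ x 0 → MemLp (fun Y : Config d n => Y x a) 2 P)
    (hcov : ∀ x y a b, 0 ≤ x 0 → 0 ≤ y 0 →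
      ((∫ Y, Y x a * Y y b ∂P : ℝ) : ℂ) = imageCov q x y a b) (l : Fin d) (x : Lattice d) :
    Integrable (energyCurrent V l x) P ∧ ((∫ Y, energyCurrent V l x Y ∂P : ℝ) : ℂ)
      = 1 / 2 * ∑' p, densityCurrentTerm V q l x p := by
  obtain ⟨G, hG, hb⟩ := exists_summable_current_bound hV l x
  obtain ⟨C, hC, hQ⟩ := hq.exists_norm_imageCov_le
  let F : ℤ × Lattice d → Config d n → ℝ := fun my Y => cutSign l x my.1 my.2 *
    ∑ a, ∑ b, Y (shift l x my.1) (Sum.inr a) * halfKernel V (shift l x my.1) my.2 a b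
      * Y my.2 (Sum.inl b)
  have hint2 : ∀ y z a b, 0 ≤ y 0 → 0 ≤ z 0 → Integrable (fun Y : Config d n => Y y a * Y z b) P :=
    fun y z a b hy hz => MemLp.integrable_mul (hL2 y a hy) (hL2 z b hz)
  have hsq : ∀ y a, 0 ≤ y 0 → ∫ Y, Y y a * Y y a ∂P ≤ C * (y 0 : ℝ) ^ 2 := fun y a hy => by
    have h1 := hQ y y a a
    rw [← hcov y y a a hy hy, Complex.norm_real, Real.norm_eq_abs, ← sq, sq_abs] at h1
    exact (le_abs_self _).trans h1
  -- The inequality `|st| ≤ s² + t²` reduces mixed moments to variances, which the covariance bound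
  -- on the diagonal controls. This is why the majorant was set up for `X_1² + y_1²`.
  have hprod : ∀ y z a b, 0 ≤ y 0 → 0 ≤ z 0 →
      ∫ Y, ‖Y y a * Y z b‖ ∂P ≤ C * ((y 0 : ℝ) ^ 2 + (z 0 : ℝ) ^ 2) := fun y z a b hy hz => by
    have h1 : ∫ Y, ‖Y y a * Y z b‖ ∂P ≤ ∫ Y, (Y y a * Y y a + Y z b * Y z b) ∂P := by
      refine integral_mono (hint2 y z a b hy hz).norm
        ((hint2 y y a a hy hy).add (hint2 z z b b hz hz)) fun Y => ?_
      simp only [norm_mul, Real.norm_eq_abs]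
      nlinarith [sq_nonneg (|Y y a| - |Y z b|), abs_mul_abs_self (Y y a), abs_mul_abs_self (Y z b),
        mul_self_nonneg (Y y a), mul_self_nonneg (Y z b)]
    rw [integral_add (hint2 y y a a hy hy) (hint2 z z b b hz hz)] at h1
    linarith [hsq y a hy, hsq z b hz]
  have hterm : ∀ my : ℤ × Lattice d, 0 ≤ shift l x my.1 0 → 0 ≤ my.2 0 → ∀ a b,
      Integrable (fun Y : Config d n => Y (shift l x my.1) (Sum.inr a) *
        halfKernel V (shift l x my.1) my.2 a b * Y my.2 (Sum.inl b)) P := fun my h1 h2 a b => by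
    refine ((hint2 _ _ (Sum.inr a) (Sum.inl b) h1 h2).const_mul
      (halfKernel V (shift l x my.1) my.2 a b)).congr (Filter.Eventually.of_forall fun Y => ?_)
    simp only []; ring
  have hFint : ∀ my, Integrable (F my) P := fun my => by
    -- Moments are assumed only at sites of the half-space; for all other pairs the cut sign makes
    -- the term zero.
    by_cases h : 0 ≤ shift l x my.1 0 ∧ 0 ≤ my.2 0
    · exact (integrable_finsetSum _ fun a _ => integrable_finsetSum _ fun b _ =>
        hterm my h.1 h.2 a b).const_mul _
    · simp only [F, cutSign_eq_zero_of_not h, zero_mul]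
      exact integrable_zero _ _ _
  have hFsum : Summable fun my => ∫ Y, ‖F my Y‖ ∂P := by
    refine Summable.of_nonneg_of_le (fun my => integral_nonneg fun Y => norm_nonneg _) (fun my => ?_)
      (g := fun my => ∫ Y, ‖F my Y‖ ∂P) (f := fun my => ∑ _a : Fin n, ∑ _b : Fin n, C * G my)
      (summable_sum fun _ _ => summable_sum fun _ _ => hG.mul_left C)
    by_cases h : 0 ≤ shift l x my.1 0 ∧ 0 ≤ my.2 0
    · calc ∫ Y, ‖F my Y‖ ∂P ≤ ∫ Y, |cutSign l x my.1 my.2| * ∑ a, ∑ b,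
            (|halfKernel V (shift l x my.1) my.2 a b| *
              ‖Y (shift l x my.1) (Sum.inr a) * Y my.2 (Sum.inl b)‖) ∂P := by
            refine integral_mono (hFint my).norm ((integrable_finsetSum _ fun a _ =>
              integrable_finsetSum _ fun b _ => (hint2 _ _ _ _ h.1 h.2).norm.const_mul _).const_mul _)
              fun Y => ?_
            simp only [F]
            rw [norm_mul, Real.norm_eq_abs]
            gcongr
            refine (norm_sum_le _ _).trans (Finset.sum_le_sum fun a _ => ?_)
            refine (norm_sum_le _ _).trans (Finset.sum_le_sum fun b _ => ?_)
            simp only [norm_mul, Real.norm_eq_abs]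
            exact le_of_eq (by ring)
        _ = |cutSign l x my.1 my.2| * ∑ a, ∑ b, (|halfKernel V (shift l x my.1) my.2 a b| *
              ∫ Y, ‖Y (shift l x my.1) (Sum.inr a) * Y my.2 (Sum.inl b)‖ ∂P) := by
            rw [integral_const_mul, integral_finsetSum _ fun a _ => integrable_finsetSum _
              fun b _ => (hint2 _ _ _ _ h.1 h.2).norm.const_mul _]
            congr 1
            refine Finset.sum_congr rfl fun a _ => ?_
            rw [integral_finsetSum _ fun b _ => (hint2 _ _ _ _ h.1 h.2).norm.const_mul _]
            exact Finset.sum_congr rfl fun b _ => integral_const_mul _ _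
        _ = ∑ a, ∑ b, |cutSign l x my.1 my.2| * (|halfKernel V (shift l x my.1) my.2 a b| *
              ∫ Y, ‖Y (shift l x my.1) (Sum.inr a) * Y my.2 (Sum.inl b)‖ ∂P) := by
            simp_rw [Finset.mul_sum]
        _ ≤ ∑ _a : Fin n, ∑ _b : Fin n, C * G my := by
            refine Finset.sum_le_sum fun a _ => Finset.sum_le_sum fun b _ => ?_
            calc _ ≤ |cutSign l x my.1 my.2| * (|halfKernel V (shift l x my.1) my.2 a b| *
                  (C * ((shift l x my.1 0 : ℝ) ^ 2 + (my.2 0 : ℝ) ^ 2))) := by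
                  gcongr
                  exact hprod _ _ _ _ h.1 h.2
              _ = C * (|cutSign l x my.1 my.2| * ((shift l x my.1 0 : ℝ) ^ 2 + (my.2 0 : ℝ) ^ 2) *
                  |halfKernel V (shift l x my.1) my.2 a b|) := by ring
              _ ≤ C * G my := by gcongr; exact hb my a b
    · have h0 : ∀ a b : Fin n, 0 ≤ C * G my := fun a b => by
        have := hb my a b
        rw [cutSign_eq_zero_of_not h, abs_zero, zero_mul, zero_mul] at this
        positivity
      simp only [F, cutSign_eq_zero_of_not h, zero_mul, norm_zero, integral_zero]
      exact Finset.sum_nonneg fun a _ => Finset.sum_nonneg fun b _ => h0 a b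
  have hFcov : ∀ my, ((∫ Y, F my Y ∂P : ℝ) : ℂ) = densityCurrentTerm V q l x my := fun my => by
    by_cases h : 0 ≤ shift l x my.1 0 ∧ 0 ≤ my.2 0
    · simp only [F, densityCurrentTerm]
      rw [integral_const_mul, integral_finsetSum _ fun a _ => integrable_finsetSum _
        fun b _ => hterm my h.1 h.2 a b]
      push_cast
      congr 1
      refine Finset.sum_congr rfl fun a _ => ?_
      rw [integral_finsetSum _ fun b _ => hterm my h.1 h.2 a b]
      push_cast
      refine Finset.sum_congr rfl fun b _ => ?_
      rw [← hcov _ _ _ _ h.1 h.2, ← Complex.ofReal_mul, ← integral_mul_const]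
      congr 2
      funext Y
      ring
    · simp only [F, densityCurrentTerm, cutSign_eq_zero_of_not h, zero_mul, integral_zero,
        Complex.ofReal_zero]
  have hE : energyCurrent V l x = fun Y => 1 / 2 * ∑' my, F my Y := rfl
  refine ⟨?_, ?_⟩
  · rw [hE]
    exact (integrable_tsum_of_summable_integral_norm hFint hFsum).const_mul _
  · rw [hE, integral_const_mul, ← integral_tsum_of_summable_integral_norm hFint hFsum]
    push_cast
    simp only [hFcov]

end Mean

/-! ### The transverse current as a Fourier integral. -/

section TransverseCurrent

variable {d n : ℕ} [NeZero d] {V : Lattice d → Matrix (Fin n) (Fin n) ℝ}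
  {q : (Fin d → ℝ) → Matrix (Fin n ⊕ Fin n) (Fin n ⊕ Fin n) ℂ}

lemma _root_.HasSum.of_eq {ι : Type*} {f g : ι → ℂ} {s : ℂ} (h : HasSum f s)
    (e : ∀ i, g i = f i) : HasSum g s := by
  rwa [show g = f from funext e]

/-- Counting the bonds of length `r` which cross a cut, with their sign. -/
lemma hasSum_crossings (r : ℤ) :
    HasSum (fun m : ℤ => if m ≤ -1 ∧ 0 ≤ r + m then (1 : ℂ) else
      if 0 ≤ m ∧ r + m ≤ -1 then -1 else 0) (r : ℂ) := by
  rcases le_total 0 r with hr | hr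
  · have h := hasSum_sum_of_ne_finset_zero (L := .unconditional ℤ) (f := fun m : ℤ => if m ≤ -1 ∧ 0 ≤ r + m then (1 : ℂ) else
      if 0 ≤ m ∧ r + m ≤ -1 then -1 else 0) (s := Finset.Ico (-r) 0) (fun m hm => by
        rw [Finset.mem_Ico] at hm
        rw [if_neg (by omega), if_neg (by omega)])
    rw [Finset.sum_congr rfl (g := fun _ => (1 : ℂ)) fun m hm => by
      rw [Finset.mem_Ico] at hm
      rw [if_pos (by omega)]] at h
    have hc : ((Finset.Ico (-r) 0).card : ℂ) = r := by
      rw [Int.card_Ico, zero_sub, neg_neg, ← Int.cast_natCast, Int.toNat_of_nonneg hr]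
    rw [Finset.sum_const, nsmul_eq_mul, hc, mul_one] at h
    exact h
  · have h := hasSum_sum_of_ne_finset_zero (L := .unconditional ℤ) (f := fun m : ℤ => if m ≤ -1 ∧ 0 ≤ r + m then (1 : ℂ) else
      if 0 ≤ m ∧ r + m ≤ -1 then -1 else 0) (s := Finset.Ico 0 (-r)) (fun m hm => by
        rw [Finset.mem_Ico] at hm
        rw [if_neg (by omega), if_neg (by omega)])
    rw [Finset.sum_congr rfl (g := fun _ => (-1 : ℂ)) fun m hm => by
      rw [Finset.mem_Ico] at hm
      rw [if_neg (by omega), if_pos (by omega)]] at h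
    have hc : ((Finset.Ico 0 (-r)).card : ℂ) = -r := by
      rw [Int.card_Ico, sub_zero, ← Int.cast_natCast, Int.toNat_of_nonneg (by omega)]
      push_cast; ring
    rw [Finset.sum_const, nsmul_eq_mul, hc] at h
    simpa using h

/-- The contribution of the pair `x`, `w` to the current. -/
def bondTerm (V : Lattice d → Matrix (Fin n) (Fin n) ℝ)
    (q : (Fin d → ℝ) → Matrix (Fin n ⊕ Fin n) (Fin n ⊕ Fin n) ℂ) (x w : Lattice d) : ℂ :=
  ∑ a, ∑ b, imageCov q x w (Sum.inr a) (Sum.inl b) * (V (x - w) a b : ℂ)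

/-- Simultaneous translation of the second site along the cut. -/
def shiftEquiv (l : Fin d) : Lattice d × ℤ ≃ ℤ × Lattice d where
  toFun p := (p.2, shift l p.1 p.2)
  invFun p := (shift l p.2 (-p.1), p.1)
  left_inv p := by simp [shift]
  right_inv p := by simp [shift]

omit [NeZero d] in
lemma shift_eq_add (l : Fin d) (x : Lattice d) (m : ℤ) :
    shift l x m = x + Pi.single l m := by
  funext j
  by_cases h : j = l
  · subst h; simp [shift]
  · simp [shift, h]

/-- Covariance and kernel are invariant under simultaneous translation along `e_l`, so `m` enters
only through the sign of the crossing. The minus sign before `V(x - w_-)` is absorbed by the oddness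
of the covariance under `w ↦ w_-`, which leaves a sum over `w` and its mirror image. -/
lemma densityCurrentTerm_shift {l : Fin d} (hl : l ≠ 0) {x : Lattice d} (hx : 0 ≤ x 0)
    (w : Lattice d) (m : ℤ) :
    densityCurrentTerm V q l x (m, shift l w m) =
      (if m ≤ -1 ∧ 0 ≤ (w l - x l) + m then (1 : ℂ) else
        if 0 ≤ m ∧ (w l - x l) + m ≤ -1 then -1 else 0) *
      (if 0 ≤ w 0 then bondTerm V q x w + bondTerm V q x (reflect w) else 0) := by
  have hv : (Pi.single l m : Lattice d) 0 = 0 := by simp [hl.symm]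
  have h0 : ∀ z : Lattice d, shift l z m 0 = z 0 := fun z => by simp [shift, hl.symm]
  have hker : halfKernel V (shift l x m) (shift l w m) = halfKernel V x w := by
    simp only [halfKernel, shift_eq_add, reflect_add_of_zero _ _ hv, add_sub_add_right_eq_sub]
  have hcov : imageCov q (shift l x m) (shift l w m) = imageCov q x w := by
    rw [shift_eq_add, shift_eq_add, imageCov_add _ _ _ hv]
  have hcut : (cutSign l x m (shift l w m) : ℂ)
      = (if m ≤ -1 ∧ 0 ≤ (w l - x l) + m then (1 : ℂ) else
        if 0 ≤ m ∧ (w l - x l) + m ≤ -1 then -1 else 0) * if 0 ≤ w 0 then 1 else 0 := by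
    unfold cutSign
    rw [h0, h0, shift_apply_self, show w l + m - x l = (w l - x l) + m by ring]
    by_cases hw : 0 ≤ w 0
    · simp only [hx, hw, and_self, if_true, mul_one]
      split_ifs <;> simp
    · simp only [hw, and_false, if_false, mul_zero, Complex.ofReal_zero]
  have hb : ∑ a, ∑ b, imageCov q x w (Sum.inr a) (Sum.inl b) * (halfKernel V x w a b : ℂ)
      = bondTerm V q x w + bondTerm V q x (reflect w) := by
    simp only [bondTerm, ← Finset.sum_add_distrib, imageCov_reflect_right, halfKernel, Matrix.sub_apply]
    refine Finset.sum_congr rfl fun a _ => Finset.sum_congr rfl fun b _ => ?_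
    push_cast; ring
  rw [densityCurrentTerm]
  simp only [hker, hcov, hcut, hb]
  rw [mul_assoc]
  congr 1
  split_ifs <;> simp

lemma summable_coord_bondTerm (hV : ExpDecay V) (hq : IsSineDensity q) (l : Fin d) (x : Lattice d) :
    Summable fun w : Lattice d => ((w l - x l : ℤ) : ℂ) * bondTerm V q x w := by
  obtain ⟨C, hC, hQ⟩ := hq.exists_norm_imageCov_le
  have hs : ∀ a b, Summable fun w : Lattice d => (1 + |((x - w) l : ℝ)|) *
      (1 + |((x - w) 0 : ℝ)|) * |V (x - w) a b| := fun a b =>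
    (Equiv.subLeft x).summable_iff.2 (hV.summable_mul l 0 a b)
  refine Summable.of_norm_bounded (g := fun w => ∑ a, ∑ b, C * |(x 0 : ℝ)| * (1 + |(x 0 : ℝ)|) *
    ((1 + |((x - w) l : ℝ)|) * (1 + |((x - w) 0 : ℝ)|) * |V (x - w) a b|))
    (summable_sum fun a _ => summable_sum fun b _ => (hs a b).mul_left _) fun w => ?_
  rw [norm_mul, bondTerm]
  have h1 : ‖((w l - x l : ℤ) : ℂ)‖ = |((x - w) l : ℝ)| := by
    rw [Complex.norm_intCast, Pi.sub_apply]; push_cast; exact abs_sub_comm _ _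
  have h2 : |(w 0 : ℝ)| ≤ (1 + |(x 0 : ℝ)|) * (1 + |((x - w) 0 : ℝ)|) := by
    have h3 : |(w 0 : ℝ)| ≤ |(x 0 : ℝ)| + |((x - w) 0 : ℝ)| := by
      have : (w 0 : ℝ) = x 0 - ((x - w) 0 : ℤ) := by rw [Pi.sub_apply]; push_cast; ring
      rw [this]
      exact abs_sub _ _
    nlinarith [mul_nonneg (abs_nonneg (x 0 : ℝ)) (abs_nonneg ((x - w) 0 : ℝ))]
  rw [h1]
  calc _ ≤ |((x - w) l : ℝ)| * ∑ a, ∑ b, C * (|(x 0 : ℝ)| * |(w 0 : ℝ)|) * |V (x - w) a b| := by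
        gcongr
        refine (norm_sum_le _ _).trans (Finset.sum_le_sum fun a _ => ?_)
        refine (norm_sum_le _ _).trans (Finset.sum_le_sum fun b _ => ?_)
        rw [norm_mul, Complex.norm_real, Real.norm_eq_abs]
        gcongr
        exact hQ _ _ _ _
    _ = ∑ a, ∑ b, C * |(x 0 : ℝ)| * |(w 0 : ℝ)| * (|((x - w) l : ℝ)| * |V (x - w) a b|) := by
        simp_rw [Finset.mul_sum]
        exact Finset.sum_congr rfl fun a _ => Finset.sum_congr rfl fun b _ => by ring
    _ ≤ ∑ a, ∑ b, C * |(x 0 : ℝ)| * ((1 + |(x 0 : ℝ)|) * (1 + |((x - w) 0 : ℝ)|)) *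
          ((1 + |((x - w) l : ℝ)|) * |V (x - w) a b|) := by
        gcongr
        linarith
    _ = _ := Finset.sum_congr rfl fun a _ => Finset.sum_congr rfl fun b _ => by ring

/-- A site on the wall is its own mirror image, so a covariance odd under reflection vanishes there.
-/
lemma bondTerm_eq_zero (x : Lattice d) {w : Lattice d} (hw : w 0 = 0) : bondTerm V q x w = 0 := by
  have h : reflect w = w := by
    funext j
    by_cases hj : j = 0
    · subst hj; simp [reflect_apply_zero, hw]
    · simp [reflect_apply_of_ne _ hj]
  refine Finset.sum_eq_zero fun a _ => Finset.sum_eq_zero fun b _ => ?_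
  have h1 := imageCov_reflect_right (q := q) x w (Sum.inr a) (Sum.inl b)
  rw [h] at h1
  rw [self_eq_neg.1 h1, zero_mul]

/-- Reflection carries the half `w_1 ≥ 0` onto `w_1 ≤ 0`. The two halves cover the lattice and
overlap only in the wall, where `S` vanishes. -/
lemma tsum_half_space_eq {S : Lattice d → ℂ} (hS : Summable S) (h0 : ∀ w, w 0 = 0 → S w = 0) :
    ∑' w : Lattice d, (if 0 ≤ w 0 then S w + S (reflect w) else 0) = ∑' w, S w := by
  have hSr : Summable fun w => S (reflect w) := (reflectEquiv d).summable_iff.2 hS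
  have hA : Summable fun w : Lattice d => if 0 ≤ w 0 then S w else 0 :=
    (hS.indicator {w : Lattice d | 0 ≤ w 0}).congr fun w => by simp [Set.indicator]
  have hB : Summable fun w : Lattice d => if 0 ≤ w 0 then S (reflect w) else 0 :=
    (hSr.indicator {w : Lattice d | 0 ≤ w 0}).congr fun w => by simp [Set.indicator]
  have h4 : ∑' w : Lattice d, (if 0 ≤ w 0 then S (reflect w) else 0)
      = ∑' w : Lattice d, if 0 ≤ w 0 then 0 else S w := by
    rw [← (reflectEquiv d).tsum_eq]
    refine tsum_congr fun w => ?_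
    have e : reflectEquiv d w = reflect w := rfl
    rw [e, reflect_reflect, reflect_apply_zero]
    by_cases h : w 0 = 0
    · simp [h0 w h]
    · split_ifs <;> first | rfl | omega
  have hC : Summable fun w : Lattice d => if 0 ≤ w 0 then 0 else S w :=
    (hS.indicator {w : Lattice d | 0 ≤ w 0}ᶜ).congr fun w => by
      simp only [Set.indicator, Set.mem_compl_iff, Set.mem_ofPred_eq]
      split_ifs <;> rfl
  calc ∑' w : Lattice d, (if 0 ≤ w 0 then S w + S (reflect w) else 0)
      = ∑' w : Lattice d, ((if 0 ≤ w 0 then S w else 0) + if 0 ≤ w 0 then S (reflect w) else 0) :=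
        tsum_congr fun w => by split_ifs <;> simp
    _ = ∑' w : Lattice d, (if 0 ≤ w 0 then S w else 0)
          + ∑' w : Lattice d, (if 0 ≤ w 0 then 0 else S w) := by rw [hA.tsum_add hB, h4]
    _ = ∑' w : Lattice d, S w := by
        rw [← hA.tsum_add hC]
        exact tsum_congr fun w => by split_ifs <;> simp

/-- The transverse current as a sum over all pairs through `x`. -/
lemma tsum_densityCurrentTerm (hV : ExpDecay V) (hq : IsSineDensity q) {l : Fin d} (hl : l ≠ 0)
    {x : Lattice d} (hx : 0 ≤ x 0) :
    ∑' p, densityCurrentTerm V q l x p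
      = ∑' w : Lattice d, ((w l - x l : ℤ) : ℂ) * bondTerm V q x w := by
  have hs := summable_densityCurrentTerm hV hq l x
  generalize hF : densityCurrentTerm V q l x = F at hs
  have hsum : Summable fun p => F (shiftEquiv l p) := (shiftEquiv l).summable_iff.2 hs
  have h2 : ∀ w m, F (shiftEquiv l (w, m)) =
      (if m ≤ -1 ∧ 0 ≤ (w l - x l) + m then (1 : ℂ) else
        if 0 ≤ m ∧ (w l - x l) + m ≤ -1 then -1 else 0) *
      (if 0 ≤ w 0 then bondTerm V q x w + bondTerm V q x (reflect w) else 0) := fun w m => by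
    rw [← hF]
    exact densityCurrentTerm_shift hl hx w m
  -- Absolute convergence allows summing first over the translates `m` of a fixed bond, which gives
  -- the signed number of crossings `w_l - x_l`. This weight is the same for `w` and its mirror
  -- image, as `l` is transverse.
  rw [← (shiftEquiv l).tsum_eq F, Summable.tsum_prod hsum,
    ← tsum_half_space_eq (summable_coord_bondTerm hV hq l x)
      fun w hw => by rw [bondTerm_eq_zero x hw, mul_zero]]
  refine tsum_congr fun w => ?_
  rw [tsum_congr (h2 w), tsum_mul_right, (hasSum_crossings (w l - x l)).tsum_eq,
    reflect_apply_of_ne _ hl]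
  split_ifs <;> ring

/-- The lattice sum of the image phases against the interaction. -/
lemma hasSum_imagePhase_mul (hV : ExpDecay V) (hsymm : SymmetricInteraction V)
    (hrefl : ∀ x, V (reflect x) = V x) {l : Fin d} (hl : l ≠ 0) (x : Lattice d) (θ : Fin d → ℝ)
    (a b : Fin n) :
    HasSum (fun w : Lattice d => ((w l - x l : ℤ) : ℂ) * (imagePhase x w θ * (V (x - w) a b : ℂ)))
      (4 * ((Real.sin (θ 0 * x 0) ^ 2 : ℝ) : ℂ) * (-Complex.I * dFourier V l θ b a)) := by
  set D : ℂ := -Complex.I * dFourier V l θ b a with hD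
  have hS : Summable fun z : Lattice d => Complex.I * (z l : ℂ) *
      (Complex.exp (Complex.I * (pairing z θ : ℂ)) * (V z b a : ℂ)) := by
    refine Summable.of_norm ?_
    simp only [norm_dFourier_term]
    exact hV.summable_coord_mul l b a
  have h1 : HasSum (fun z : Lattice d => (z l : ℂ) *
      (Complex.exp (Complex.I * (pairing z θ : ℂ)) * (V z b a : ℂ))) D := by
    have h2 := hS.hasSum
    rw [← hV.dFourier_eq] at h2
    refine (h2.mul_left (-Complex.I)).of_eq ?_
    intro z
    linear_combination ((z l : ℂ) * (Complex.exp (Complex.I * (pairing z θ : ℂ)) *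
      (V z b a : ℂ))) * Complex.I_sq
  have h2 : HasSum (fun z : Lattice d => (z l : ℂ) *
      (Complex.exp (Complex.I * (pairing (reflect z) θ : ℂ)) * (V z b a : ℂ))) D := by
    have h3 := (reflectEquiv d).hasSum_iff.2 h1
    refine h3.of_eq ?_
    intro z
    have e : reflectEquiv d z = reflect z := rfl
    simp only [Function.comp_apply, e, reflect_apply_of_ne _ hl, hrefl]
  -- For `w = x + z` the four phases are those of `z` and of its reflection. The direct term and the
  -- term with both sites reflected carry no dependence on `x`; the two mixed terms carry `e^{∓2i
  -- x_1 θ_1}`. Each of the four sums over `z` equals `D`, as `V` is reflection invariant, and the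
  -- total factor `2 - 2 cos(2 x_1 θ_1)` is `4 sin²(x_1 θ_1)`.
  set e2 : ℂ := Complex.exp (-(2 * Complex.I * (x 0 * θ 0 : ℂ))) with he2
  set e3 : ℂ := Complex.exp (2 * Complex.I * (x 0 * θ 0 : ℂ)) with he3
  have h5 : HasSum (fun z : Lattice d => (z l : ℂ) * (imagePhase x (x + z) θ * (V z b a : ℂ)))
      (D - e2 * D - e3 * D + D) := by
    refine (((h1.sub (h2.mul_left e2)).sub (h1.mul_left e3)).add h2).of_eq ?_
    intro z
    have p0 : ∀ z : Lattice d, pairing (reflect z) θ = pairing z θ - 2 * (z 0 * θ 0) := fun z => by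
      rw [pairing_eq_add_tail, pairing_eq_add_tail, reflect_apply_zero,
        tailPairing_congr fun j hj => reflect_apply_of_ne z hj]
      push_cast; ring
    have hph : imagePhase x (x + z) θ = Complex.exp (Complex.I * (pairing z θ : ℂ))
        - e2 * Complex.exp (Complex.I * (pairing (reflect z) θ : ℂ))
        - e3 * Complex.exp (Complex.I * (pairing z θ : ℂ))
        + Complex.exp (Complex.I * (pairing (reflect z) θ : ℂ)) := by
      simp only [imagePhase, pairing_sub_left, p0, he2, he3, ← Complex.exp_add, pairing_add_left,
        Pi.add_apply]
      push_cast
      congr 1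
      · congr 1
        · congr 1
          · congr 1; ring
          · congr 1; ring
        · congr 1; ring
      · congr 1; ring
    rw [hph]; ring
  have h6 : D - e2 * D - e3 * D + D = 4 * ((Real.sin (θ 0 * x 0) ^ 2 : ℝ) : ℂ) * D := by
    push_cast
    rw [Complex.sin, div_pow, mul_pow, Complex.I_sq, he2, he3]
    have f1 : Complex.exp (-(θ 0 * x 0 : ℂ) * Complex.I) ^ 2
        = Complex.exp (-(2 * Complex.I * (x 0 * θ 0 : ℂ))) := by
      rw [← Complex.exp_nat_mul]; congr 1; push_cast; ring
    have f2 : Complex.exp ((θ 0 * x 0 : ℂ) * Complex.I) ^ 2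
        = Complex.exp (2 * Complex.I * (x 0 * θ 0 : ℂ)) := by
      rw [← Complex.exp_nat_mul]; congr 1; push_cast; ring
    have f3 : Complex.exp (-(θ 0 * x 0 : ℂ) * Complex.I) *
        Complex.exp ((θ 0 * x 0 : ℂ) * Complex.I) = 1 := by
      rw [← Complex.exp_add, ← Complex.exp_zero]; congr 1; ring
    rw [sub_sq, f1, f2]
    linear_combination (-2 * D) * f3
  rw [← h6]
  refine ((Equiv.addLeft x).hasSum_iff.1 ?_)
  refine h5.of_eq ?_
  intro z
  have e : (Equiv.addLeft x) z = x + z := rfl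
  -- The interaction at `-z` is the transpose of that at `z`. The exchanged indices are those needed
  -- for the trace of a matrix product.
  have hVz : V (x - (x + z)) a b = V z b a := by
    rw [show x - (x + z) = -z by abel, hsymm]; rfl
  simp only [Function.comp_apply, e, hVz, Pi.add_apply, add_sub_cancel_left]

/-- The density of the contribution of the pair `x`, `w` to the current. -/
def bondDensity (V : Lattice d → Matrix (Fin n) (Fin n) ℝ)
    (q : (Fin d → ℝ) → Matrix (Fin n ⊕ Fin n) (Fin n ⊕ Fin n) ℂ) (l : Fin d) (x w : Lattice d)
    (θ : Fin d → ℝ) : ℂ :=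
  ((w l - x l : ℤ) : ℂ) *
    ∑ a, ∑ b, imagePhase x w θ * q θ (Sum.inr a) (Sum.inl b) * (V (x - w) a b : ℂ)

lemma integrableOn_imagePhase_mul_interaction (hq : IsSineDensity q) (x w : Lattice d)
    (a b : Fin n) : Integrable (fun θ => imagePhase x w θ * q θ (Sum.inr a) (Sum.inl b) *
      (V (x - w) a b : ℂ)) (volume.restrict (torus d)) :=
  Integrable.mul_const (hq.integrableOn_imagePhase_mul x w (Sum.inr a) (Sum.inl b)) _

lemma integrable_bondDensity (hq : IsSineDensity q) (l : Fin d) (x w : Lattice d) :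
    Integrable (bondDensity V q l x w) (volume.restrict (torus d)) :=
  Integrable.const_mul (integrable_finsetSum _ fun a _ => integrable_finsetSum _ fun b _ =>
    integrableOn_imagePhase_mul_interaction hq x w a b) _

lemma two_pi_pow_ne_zero (d : ℕ) : (2 * Real.pi : ℂ) ^ d ≠ 0 :=
  pow_ne_zero _ (mul_ne_zero two_ne_zero (by exact_mod_cast Real.pi_ne_zero))

lemma integral_bondDensity (hq : IsSineDensity q) (l : Fin d) (x w : Lattice d) :
    ∫ θ in torus d, bondDensity V q l x w θ
      = (2 * Real.pi : ℂ) ^ d * (((w l - x l : ℤ) : ℂ) * bondTerm V q x w) := by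
  have hpi := two_pi_pow_ne_zero d
  unfold bondDensity
  rw [integral_const_mul, integral_finsetSum _ fun a _ => integrable_finsetSum _ fun b _ =>
    integrableOn_imagePhase_mul_interaction hq x w a b, mul_left_comm]
  refine congrArg _ ?_
  rw [bondTerm, Finset.mul_sum]
  refine Finset.sum_congr rfl fun a _ => ?_
  rw [integral_finsetSum _ fun b _ => integrableOn_imagePhase_mul_interaction hq x w a b,
    Finset.mul_sum]
  refine Finset.sum_congr rfl fun b _ => ?_
  rw [integral_mul_const, imageCov, of_apply]
  field_simp

lemma norm_bondDensity_le (l : Fin d) (x w : Lattice d) (θ : Fin d → ℝ) :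
    ‖bondDensity V q l x w θ‖ ≤ ∑ a, ∑ b, (4 * |(x 0 : ℝ)| * (1 + |(x 0 : ℝ)|) *
        ((1 + |((x - w) l : ℝ)|) * (1 + |((x - w) 0 : ℝ)|) * |V (x - w) a b|)) *
        (Real.sin (θ 0) ^ 2 * ‖q θ (Sum.inr a) (Sum.inl b)‖) := by
  have h1 : ‖((w l - x l : ℤ) : ℂ)‖ = |((x - w) l : ℝ)| := by
    rw [Complex.norm_intCast, Pi.sub_apply]; push_cast; exact abs_sub_comm _ _
  have h2 : |(w 0 : ℝ)| ≤ (1 + |(x 0 : ℝ)|) * (1 + |((x - w) 0 : ℝ)|) := by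
    have h3 : |(w 0 : ℝ)| ≤ |(x 0 : ℝ)| + |((x - w) 0 : ℝ)| := by
      have : (w 0 : ℝ) = x 0 - ((x - w) 0 : ℤ) := by rw [Pi.sub_apply]; push_cast; ring
      rw [this]
      exact abs_sub _ _
    nlinarith [mul_nonneg (abs_nonneg (x 0 : ℝ)) (abs_nonneg ((x - w) 0 : ℝ))]
  rw [bondDensity, norm_mul, h1]
  refine (mul_le_mul_of_nonneg_left (norm_sum_le _ _) (abs_nonneg _)).trans ?_
  rw [Finset.mul_sum]
  refine Finset.sum_le_sum fun a _ => ?_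
  refine (mul_le_mul_of_nonneg_left (norm_sum_le _ _) (abs_nonneg _)).trans ?_
  rw [Finset.mul_sum]
  refine Finset.sum_le_sum fun b _ => ?_
  rw [norm_mul, Complex.norm_real, Real.norm_eq_abs]
  calc _ ≤ |((x - w) l : ℝ)| * (4 * |(x 0 : ℝ)| * |(w 0 : ℝ)| *
        (Real.sin (θ 0) ^ 2 * ‖q θ (Sum.inr a) (Sum.inl b)‖) * |V (x - w) a b|) := by
        gcongr
        exact IsSineDensity.norm_imagePhase_mul_le x w θ _ _
    _ ≤ (1 + |((x - w) l : ℝ)|) * (4 * |(x 0 : ℝ)| * ((1 + |(x 0 : ℝ)|) *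
        (1 + |((x - w) 0 : ℝ)|)) *
        (Real.sin (θ 0) ^ 2 * ‖q θ (Sum.inr a) (Sum.inl b)‖) * |V (x - w) a b|) := by
        gcongr
        linarith
    _ = _ := by ring

lemma summable_integral_norm_bondDensity (hV : ExpDecay V) (hq : IsSineDensity q) (l : Fin d)
    (x : Lattice d) : Summable fun w => ∫ θ in torus d, ‖bondDensity V q l x w θ‖ := by
  have hs : ∀ a b, Summable fun w : Lattice d => (1 + |((x - w) l : ℝ)|) *
      (1 + |((x - w) 0 : ℝ)|) * |V (x - w) a b| := fun a b =>
    (Equiv.subLeft x).summable_iff.2 (hV.summable_mul l 0 a b)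
  have hG : Summable fun w : Lattice d => ∑ a, ∑ b, (4 * |(x 0 : ℝ)| * (1 + |(x 0 : ℝ)|) *
      ((1 + |((x - w) l : ℝ)|) * (1 + |((x - w) 0 : ℝ)|) * |V (x - w) a b|)) *
      ∫ θ in torus d, Real.sin (θ 0) ^ 2 * ‖q θ (Sum.inr a) (Sum.inl b)‖ :=
    summable_sum fun a _ => summable_sum fun b _ => ((hs a b).mul_left _).mul_right _
  refine Summable.of_nonneg_of_le (fun w => integral_nonneg fun θ => norm_nonneg _)
    (fun w => ?_) hG
  have hI : ∀ (c : Fin n → Fin n → ℝ) a b, Integrable (fun θ => c a b *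
      (Real.sin (θ 0) ^ 2 * ‖q θ (Sum.inr a) (Sum.inl b)‖)) (volume.restrict (torus d)) :=
    fun c a b => Integrable.const_mul (hq.integrable (Sum.inr a) (Sum.inl b)) (c a b)
  have hR : ∀ c : Fin n → Fin n → ℝ, ∑ a, ∑ b, c a b *
      ∫ θ in torus d, Real.sin (θ 0) ^ 2 * ‖q θ (Sum.inr a) (Sum.inl b)‖
      = ∫ θ in torus d, ∑ a, ∑ b, c a b *
        (Real.sin (θ 0) ^ 2 * ‖q θ (Sum.inr a) (Sum.inl b)‖) := fun c => by
    rw [integral_finsetSum _ fun a _ => integrable_finsetSum _ fun b _ => hI c a b]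
    refine Finset.sum_congr rfl fun a _ => ?_
    rw [integral_finsetSum _ fun b _ => hI c a b]
    exact Finset.sum_congr rfl fun b _ => (integral_const_mul _ _).symm
  rw [hR fun a b => 4 * |(x 0 : ℝ)| * (1 + |(x 0 : ℝ)|) *
    ((1 + |((x - w) l : ℝ)|) * (1 + |((x - w) 0 : ℝ)|) * |V (x - w) a b|)]
  exact integral_mono (integrable_bondDensity hq l x w).norm (integrable_finsetSum _ fun a _ =>
    integrable_finsetSum _ fun b _ => hI (fun a b => 4 * |(x 0 : ℝ)| * (1 + |(x 0 : ℝ)|) *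
    ((1 + |((x - w) l : ℝ)|) * (1 + |((x - w) 0 : ℝ)|) * |V (x - w) a b|)) a b)
    fun θ => norm_bondDensity_le l x w θ

/-- The transverse current as an integral. -/
lemma tsum_coord_bondTerm (hV : ExpDecay V) (hsymm : SymmetricInteraction V)
    (hrefl : ∀ x, V (reflect x) = V x) (hq : IsSineDensity q) {l : Fin d} (hl : l ≠ 0)
    (x : Lattice d) :
    ∑' w : Lattice d, ((w l - x l : ℤ) : ℂ) * bondTerm V q x w
      = -(4 * Complex.I / (2 * Real.pi) ^ d) * ∫ θ in torus d,
        ((Real.sin (θ 0 * x 0) ^ 2 : ℝ) : ℂ) * ((q θ).toBlocks₂₁ * dFourier V l θ).trace := by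
  have hFtsum : ∀ θ, ∑' w, bondDensity V q l x w θ = -(4 * Complex.I) * (((Real.sin (θ 0 * x 0) ^ 2 : ℝ) : ℂ) *
      ((q θ).toBlocks₂₁ * dFourier V l θ).trace) := fun θ => by
    have h1 : HasSum (fun w => bondDensity V q l x w θ) (∑ a, ∑ b, q θ (Sum.inr a) (Sum.inl b) *
        (4 * ((Real.sin (θ 0 * x 0) ^ 2 : ℝ) : ℂ) * (-Complex.I * dFourier V l θ b a))) := by
      refine (hasSum_sum fun a _ => hasSum_sum fun b _ =>
        (hasSum_imagePhase_mul hV hsymm hrefl hl x θ a b).mul_left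
          (q θ (Sum.inr a) (Sum.inl b))).of_eq ?_
      intro w
      simp only [bondDensity, Finset.mul_sum]
      exact Finset.sum_congr rfl fun a _ => Finset.sum_congr rfl fun b _ => by ring
    rw [h1.tsum_eq]
    simp only [Matrix.trace, Matrix.diag, Matrix.mul_apply, toBlocks₂₁, of_apply, Finset.mul_sum]
    exact Finset.sum_congr rfl fun a _ => Finset.sum_congr rfl fun b _ => by ring
  -- Interchange of the lattice sum with the integral over the torus; under the integral the lattice
  -- sum is known explicitly.
  have h1 := (hasSum_integral_of_summable_integral_norm (fun w => integrable_bondDensity hq l x w)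
    (summable_integral_norm_bondDensity hV hq l x)).tsum_eq
  simp only [integral_bondDensity hq, hFtsum] at h1
  rw [tsum_mul_left, integral_const_mul] at h1
  have hpi := two_pi_pow_ne_zero d
  rw [← inv_mul_cancel_left₀ hpi (∑' w : Lattice d, ((w l - x l : ℤ) : ℂ) * bondTerm V q x w), h1]
  ring

lemma integrableOn_trace (hV : ExpDecay V) (hq : IsSineDensity q) (l : Fin d) (m : ℤ) :
    IntegrableOn (fun θ => ((Real.sin (θ 0 * m) ^ 2 : ℝ) : ℂ) *
      ((q θ).toBlocks₂₁ * dFourier V l θ).trace) (torus d) := by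
  simp only [Matrix.trace, Matrix.diag, Matrix.mul_apply, toBlocks₂₁, of_apply, Finset.mul_sum]
  refine integrable_finsetSum _ fun a _ => integrable_finsetSum _ fun b _ => ?_
  refine Integrable.mono' ((hq.integrable (Sum.inr a) (Sum.inl b)).const_mul
    ((m : ℝ) ^ 2 * ∑' x : Lattice d, |(x l : ℝ)| * |V x b a|)) ?_
    (Filter.Eventually.of_forall fun θ => ?_)
  · have hs : Continuous fun θ : Fin d → ℝ => ((Real.sin (θ 0 * m) ^ 2 : ℝ) : ℂ) := by fun_prop
    exact (hs.measurable.mul ((hq.measurable _ _).mul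
      (hV.continuous_dFourier l b a).measurable)).aestronglyMeasurable
  · rw [norm_mul, norm_mul, Complex.norm_real, Real.norm_of_nonneg (sq_nonneg _)]
    have h1 : Real.sin (θ 0 * m) ^ 2 ≤ (m : ℝ) ^ 2 * Real.sin (θ 0) ^ 2 := by
      have h2 := abs_sin_int_mul_le m (θ 0)
      rw [mul_comm (θ 0), ← sq_abs, ← sq_abs (m : ℝ), ← sq_abs (Real.sin (θ 0)), ← mul_pow]
      gcongr
    calc _ ≤ (m : ℝ) ^ 2 * Real.sin (θ 0) ^ 2 * (‖q θ (Sum.inr a) (Sum.inl b)‖ *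
          ∑' x : Lattice d, |(x l : ℝ)| * |V x b a|) := by
          gcongr
          exact hV.norm_dFourier_le θ l b a
      _ = _ := by ring

end TransverseCurrent

/-! ### Lipschitz dispersion relations when the symbol is invertible everywhere. -/

section Regularity

variable {d n : ℕ} {V : Lattice d → Matrix (Fin n) (Fin n) ℝ}

lemma exists_add_two_pi_mem_torus (θ : Fin d → ℝ) :
    ∃ m : Fin d → ℤ, (fun j => θ j + m j * (2 * Real.pi)) ∈ torus d := by
  have hp : (0 : ℝ) < 2 * Real.pi := by positivity
  refine ⟨fun j => -⌊(θ j + Real.pi) / (2 * Real.pi)⌋, fun j => ?_, fun j => ?_⟩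
  · have := Int.floor_le ((θ j + Real.pi) / (2 * Real.pi))
    rw [le_div_iff₀ hp] at this
    push_cast
    linarith
  · have := (Int.lt_floor_add_one ((θ j + Real.pi) / (2 * Real.pi))).le
    rw [div_le_iff₀ hp] at this
    push_cast
    linarith

/-- A continuous positive function attains its minimum on the compact torus, and periodicity carries
the bound to all `θ`. The gap keeps the square root away from its singularity at 0. -/
lemma exists_pos_le_sortedEig (hS : ∀ a b, Summable fun x => V x a b)
    (hP : ∀ θ, (fourier V θ).PosSemidef) (hdet : ∀ θ, (fourier V θ).det ≠ 0) (i : Fin n) :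
    ∃ c > 0, ∀ θ, c ≤ sortedEig (fourier V θ) i := by
  have hne : (torus d).Nonempty := ⟨0, fun _ => by simp [Real.pi_pos.le],
    fun _ => by simp [Real.pi_pos.le]⟩
  obtain ⟨θ₀, -, h₀⟩ := isCompact_torus.exists_isMinOn hne
    (continuous_sortedEig_fourier hS (fun θ => (hP θ).isHermitian) i).continuousOn
  refine ⟨_, sortedEig_pos (hP θ₀) (hdet θ₀) i, fun θ => ?_⟩
  obtain ⟨m, hm⟩ := exists_add_two_pi_mem_torus θ
  have := h₀ hm
  simpa only [Set.mem_ofPred_eq, fourier_add_two_pi] using this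

lemma exists_lipschitzWith_sortedEig [NeZero d] (hV : ExpDecay V)
    (hH : ∀ θ, (fourier V θ).IsHermitian) (i : Fin n) :
    ∃ K : NNReal, LipschitzWith K fun θ => sortedEig (fourier V θ) i := by
  obtain ⟨L, hL⟩ := hV.exists_lipschitz
  refine ⟨2 * n * (n * (n * L)), LipschitzWith.of_dist_le_mul fun θ η => ?_⟩
  rw [Real.dist_eq]
  refine (abs_sortedEig_sub_le (hH η) (hH θ) i).trans ?_
  have : ∑ a, ∑ b, ‖fourier V θ a b - fourier V η a b‖ ≤ ∑ a : Fin n, ∑ b : Fin n, L * dist θ η :=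
    Finset.sum_le_sum fun a _ => Finset.sum_le_sum fun b _ => by
      rw [← dist_eq_norm]; exact (hL a b).dist_le_mul θ η
  refine (mul_le_mul_of_nonneg_left this (by positivity)).trans_eq ?_
  simp
  ring

lemma abs_sqrt_sub_sqrt_le {c s t : ℝ} (hc : 0 < c) (hs : c ≤ s) (ht : c ≤ t) :
    |√s - √t| ≤ (√c)⁻¹ * |s - t| := by
  have h1 : s - t = (√s - √t) * (√s + √t) := by
    have := Real.mul_self_sqrt (hc.le.trans hs)
    have := Real.mul_self_sqrt (hc.le.trans ht)
    linarith
  have hc' := Real.sqrt_pos.2 hc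
  have h2 : √c ≤ √s + √t := (Real.sqrt_le_sqrt hs).trans (by linarith [Real.sqrt_nonneg t])
  rw [h1, abs_mul, abs_of_pos (hc'.trans_le h2), le_inv_mul_iff₀ hc', mul_comm]
  exact mul_le_mul_of_nonneg_left h2 (abs_nonneg _)

variable [NeZero d]

/-- The dispersion relations of a gapped crystal are Lipschitz. -/
lemma exists_lipschitzWith_omega (hV : ExpDecay V) (hP : ∀ θ, (fourier V θ).PosSemidef)
    (hdet : ∀ θ, (fourier V θ).det ≠ 0) (i : Fin n) : ∃ K : NNReal, LipschitzWith K (omega V i) := by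
  obtain ⟨c, hc, hle⟩ := exists_pos_le_sortedEig hV.summable hP hdet i
  obtain ⟨K, hK⟩ := exists_lipschitzWith_sortedEig hV (fun θ => (hP θ).isHermitian) i
  refine ⟨(Real.toNNReal √c)⁻¹ * K, LipschitzWith.of_dist_le_mul fun θ η => ?_⟩
  rw [Real.dist_eq, omega_eq, omega_eq]
  refine (abs_sqrt_sub_sqrt_le hc (hle θ) (hle η)).trans ?_
  have := hK.dist_le_mul θ η
  rw [Real.dist_eq] at this
  refine (mul_le_mul_of_nonneg_left this (by positivity)).trans_eq ?_
  rw [NNReal.coe_mul, NNReal.coe_inv, Real.coe_toNNReal _ (Real.sqrt_nonneg c), mul_assoc]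

omit [NeZero d] in
lemma lipschitzWith_omega_update {i : Fin n} {K : NNReal} (hK : LipschitzWith K (omega V i))
    (θ : Fin d → ℝ) (l : Fin d) : LipschitzWith K fun t : ℝ => omega V i (Function.update θ l t) := by
  refine LipschitzWith.of_dist_le_mul fun s t => (hK.dist_le_mul _ _).trans ?_
  refine mul_le_mul_of_nonneg_left ((dist_pi_le_iff dist_nonneg).2 fun j => ?_) K.2
  by_cases h : j = l
  · subst h; simp
  · simp [h]

omit [NeZero d] in
lemma abs_dOmega_le {i : Fin n} {K : NNReal} (hK : LipschitzWith K (omega V i)) (l : Fin d)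
    (θ : Fin d → ℝ) : |dOmega V i l θ| ≤ K :=
  norm_deriv_le_of_lipschitz (lipschitzWith_omega_update hK θ l)

lemma exists_abs_dOmega_le (hV : ExpDecay V) (hP : ∀ θ, (fourier V θ).PosSemidef)
    (hdet : ∀ θ, (fourier V θ).det ≠ 0) (i : Fin n) :
    ∃ K : ℝ, 0 ≤ K ∧ ∀ l θ, |dOmega V i l θ| ≤ K :=
  let ⟨K, hK⟩ := exists_lipschitzWith_omega hV hP hdet i
  ⟨K, K.2, abs_dOmega_le hK⟩

/-- Rademacher's theorem. It makes the pointwise identities for derivatives available almost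
everywhere, without excluding band crossings. -/
lemma ae_differentiableAt_omega (hV : ExpDecay V) (hP : ∀ θ, (fourier V θ).PosSemidef)
    (hdet : ∀ θ, (fourier V θ).det ≠ 0) :
    ∀ᵐ θ : Fin d → ℝ, ∀ i, DifferentiableAt ℝ (omega V i) θ :=
  ae_all_iff.2 fun i =>
    let ⟨_, hK⟩ := exists_lipschitzWith_omega hV hP hdet i
    hK.ae_differentiableAt

end Regularity

/-! ### Hellmann–Feynman for the dispersion relations. -/

section BandDerivatives

variable {d n : ℕ} {V : Lattice d → Matrix (Fin n) (Fin n) ℝ} {θ : Fin d → ℝ}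

lemma hasDerivAt_omega_update {i : Fin n} (h : DifferentiableAt ℝ (omega V i) θ) (l : Fin d) :
    HasDerivAt (fun t => omega V i (Function.update θ l t)) (dOmega V i l θ) (θ l) := by
  have h1 : DifferentiableAt ℝ (omega V i) (Function.update θ l (θ l)) := by
    rwa [Function.update_eq_self]
  exact (h1.comp (θ l) (hasDerivAt_update θ l (θ l)).differentiableAt).hasDerivAt

/-- Coinciding dispersion relations have coinciding derivatives, as they are ordered. -/
lemma dOmega_eq_of_omega_eq (hd : ∀ i, DifferentiableAt ℝ (omega V i) θ) {i j : Fin n}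
    (hij : omega V i θ = omega V j θ) (l : Fin d) : dOmega V i l θ = dOmega V j l θ := by
  wlog h : i ≤ j generalizing i j
  · exact (this hij.symm (le_of_not_ge h)).symm
  refine deriv_eq_of_le (fun t => omega_mono V _ h) ?_
    (hasDerivAt_omega_update (hd i) l).differentiableAt
    (hasDerivAt_omega_update (hd j) l).differentiableAt
  simpa using hij

lemma sortedEig_eq_omega_sq (hP : (fourier V θ).PosSemidef) (i : Fin n) :
    sortedEig (fourier V θ) i = omega V i θ ^ 2 := by
  rw [omega_eq, Real.sq_sqrt (sortedEig_nonneg hP i)]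

variable [NeZero d]

lemma dFourier_isHermitian (hV : ExpDecay V) (hH : ∀ θ, (fourier V θ).IsHermitian) (l : Fin d) :
    (dFourier V l θ).IsHermitian := by
  ext a b
  have h1 := (hV.hasDerivAt_dFourier θ l b a).star
  have h2 : (fun t => star (fourier V (Function.update θ l t) b a))
      = fun t => fourier V (Function.update θ l t) a b := by
    funext t
    exact (hH _).apply a b
  exact (h1.congr_of_eventuallyEq (Filter.Eventually.of_forall fun t => (congrFun h2 t).symm)).unique
    (hV.hasDerivAt_dFourier θ l a b)

/-- The Hellmann–Feynman formula for the squared dispersion relations. -/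
lemma conj_dFourier_apply_self (hV : ExpDecay V) (hP : ∀ θ, (fourier V θ).PosSemidef)
    (hd : ∀ i, DifferentiableAt ℝ (omega V i) θ) {U : Matrix (Fin n) (Fin n) ℂ}
    (hU : Diagonalizes U (fourier V θ)) (l : Fin d) (j : Fin n) :
    (Uᴴ * dFourier V l θ * U) j j = ((2 * omega V j θ * dOmega V j l θ : ℝ) : ℂ) := by
  have hH := fun θ => (hP θ).isHermitian
  have he : ∀ i, (fun t => sortedEig (fourier V (Function.update θ l t)) i)
      = fun t => omega V i (Function.update θ l t) ^ 2 :=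
    fun i => funext fun t => sortedEig_eq_omega_sq (hP _) i
  have hder : ∀ i, HasDerivAt (fun t => sortedEig (fourier V (Function.update θ l t)) i)
      (2 * omega V i θ * dOmega V i l θ) (θ l) := fun i => by
    rw [he i]
    have := (hasDerivAt_omega_update (hd i) l).fun_pow 2
    simpa using this
  have h1 := deriv_sortedEig (A := fun t => fourier V (Function.update θ l t))
    (t₀ := θ l) (U := U) (fun t => hH _) (fun a b => hV.hasDerivAt_dFourier θ l a b)
    (fun i => (hder i).differentiableAt) (by simpa using hU) j
  rw [(hder j).deriv] at h1
  have h2 : (Uᴴ * dFourier V l θ * U).IsHermitian :=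
    isHermitian_conjTranspose_mul_mul U (dFourier_isHermitian hV hH l)
  rw [h1]
  exact (h2.coe_re_apply_self j).symm

omit [NeZero d] in
lemma bandProj_mul_Omega_inv_mul_bandProj (hP : (fourier V θ).PosSemidef)
    (hH : ∀ θ, (fourier V θ).IsHermitian)
    (hdet : (fourier V θ).det ≠ 0) {U : Matrix (Fin n) (Fin n) ℂ}
    (hU : Diagonalizes U (fourier V θ)) (i : Fin n) :
    bandProj V i θ * (Omega V θ)⁻¹ * bandProj V i θ
      = U * diagonal (fun j => if omega V j θ = omega V i θ then ((omega V j θ)⁻¹ : ℂ) else 0) * Uᴴ := by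
  have hpos : ∀ j, (omega V j θ : ℂ) ≠ 0 := fun j => by
    rw [omega_eq]
    exact_mod_cast (Real.sqrt_pos.2 (sortedEig_pos hP hdet j)).ne'
  have hO : Omega V θ = U * diagonal (fun j => (omega V j θ : ℂ)) * Uᴴ := by
    rw [Omega, hU.cfc_eq]; simp only [omega_eq]
  have hI : (Omega V θ)⁻¹ = U * diagonal (fun j => ((omega V j θ)⁻¹ : ℂ)) * Uᴴ := by
    refine Matrix.inv_eq_right_inv ?_
    rw [hO, hU.conj_mul, diagonal_mul_diagonal]
    simp [hpos, hU.mul_star]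
  have hB : bandProj V i θ
      = U * diagonal (fun j => if omega V j θ = omega V i θ then (1 : ℂ) else 0) * Uᴴ := by
    rw [bandProj_eq hH, hU.cfc_eq]
    congr 3
    funext j
    rw [← omega_eq]
    split_ifs <;> simp
  rw [hB, hI, hU.conj_mul, hU.conj_mul, diagonal_mul_diagonal, diagonal_mul_diagonal]
  congr 3
  funext j
  split_ifs <;> simp

/-- In an eigenbasis of the symbol, `Π Ω⁻¹ Π` is diagonal with entries `1/ω_j` on the band. So only
the diagonal entries `2 ω_j ∂ω_j` of the derivative enter, and `ω_j` cancels. -/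
lemma trace_bandProj_Omega_inv_dFourier (hV : ExpDecay V) (hP : ∀ θ, (fourier V θ).PosSemidef)
    (hdet : (fourier V θ).det ≠ 0) (hd : ∀ i, DifferentiableAt ℝ (omega V i) θ)
    (l : Fin d) (i : Fin n) :
    (bandProj V i θ * (Omega V θ)⁻¹ * bandProj V i θ * dFourier V l θ).trace
      = ∑ j, if omega V j θ = omega V i θ then ((2 * dOmega V j l θ : ℝ) : ℂ) else 0 := by
  have hH := fun θ => (hP θ).isHermitian
  obtain ⟨U, hU⟩ := exists_diagonalizes (hH θ)
  rw [bandProj_mul_Omega_inv_mul_bandProj (hP θ) hH hdet hU, Matrix.mul_assoc, Matrix.mul_assoc,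
    Matrix.trace_mul_comm, Matrix.mul_assoc, Matrix.trace]
  refine Finset.sum_congr rfl fun j _ => ?_
  rw [Matrix.diag_apply, Matrix.diagonal_mul, conj_dFourier_apply_self hV hP hd hU]
  have hpos : (omega V j θ : ℂ) ≠ 0 := by
    rw [omega_eq]
    exact_mod_cast (Real.sqrt_pos.2 (sortedEig_pos (hP θ) hdet j)).ne'
  split_ifs
  · push_cast; field_simp
  · simp

end BandDerivatives

/-! ### Sums over bands versus sums over indices. -/

section BandSums

variable {d n : ℕ} (V : Lattice d → Matrix (Fin n) (Fin n) ℝ) (θ : Fin d → ℝ)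

lemma exists_unique_band (j : Fin n) :
    ∃ i ∈ bands V θ, omega V j θ = omega V i θ ∧
      ∀ i' ∈ bands V θ, omega V j θ = omega V i' θ → i' = i := by
  classical
  let s := Finset.univ.filter fun i => omega V j θ = omega V i θ
  have hs : s.Nonempty := ⟨j, by simp [s]⟩
  have hm := s.min'_mem hs
  have hm' : omega V j θ = omega V (s.min' hs) θ := (Finset.mem_filter.1 hm).2
  refine ⟨s.min' hs, ?_, hm', fun i' hi' h => ?_⟩
  · refine Finset.mem_filter.2 ⟨Finset.mem_univ _, fun k hk he => ?_⟩
    exact absurd (s.min'_le k (Finset.mem_filter.2 ⟨Finset.mem_univ _, hm'.trans he.symm⟩)) (not_le.2 hk)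
  · refine le_antisymm (le_of_not_gt fun hlt => ?_) (s.min'_le i' (Finset.mem_filter.2 ⟨Finset.mem_univ _, h⟩))
    exact (Finset.mem_filter.1 hi').2 _ hlt (hm'.symm.trans h)

/-- Summation over all indices, band by band. -/
lemma sum_bands_sum_eq {M : Type*} [AddCommMonoid M] (F : Fin n → M) :
    ∑ i ∈ bands V θ, ∑ j, (if omega V j θ = omega V i θ then F j else 0) = ∑ j, F j := by
  rw [Finset.sum_comm]
  refine Finset.sum_congr rfl fun j _ => ?_
  obtain ⟨i, hi, hij, hu⟩ := exists_unique_band V θ j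
  rw [Finset.sum_eq_single_of_mem i hi fun i' hi' hne => if_neg fun h => hne (hu i' hi' h),
    if_pos hij]

variable {V θ}

/-- Equal dispersion relations have equal derivatives at a point of differentiability, so a band of
multiplicity `r` may be replaced by its `r` indices. This removes the `θ`-dependent set of bands
from the integrals. -/
lemma sum_bands_bandMult_mul (hd : ∀ i, DifferentiableAt ℝ (omega V i) θ) (l : Fin d)
    (c : ℝ) : ∑ i ∈ bands V θ, (bandMult V i θ : ℝ) * c * |dOmega V i l θ|
      = c * ∑ j, |dOmega V j l θ| := by
  rw [Finset.mul_sum, ← sum_bands_sum_eq V θ fun j => c * |dOmega V j l θ|]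
  refine Finset.sum_congr rfl fun i _ => ?_
  rw [bandMult, ← Finset.sum_filter, Finset.sum_congr rfl (g := fun _ => c * |dOmega V i l θ|)
    fun j hj => by rw [dOmega_eq_of_omega_eq hd (Finset.mem_filter.1 hj).2 l]]
  simp [mul_assoc]

end BandSums

/-! ### The current integrand for Gibbs reservoirs. -/

section GibbsTrace

variable {d n k : ℕ} {V : Lattice d → Matrix (Fin n) (Fin n) ℝ} {θ : Fin d → ℝ}

lemma Omega_mul_fourier_inv (hP : (fourier V θ).PosSemidef) (hdet : (fourier V θ).det ≠ 0) :
    Omega V θ * (fourier V θ)⁻¹ = (Omega V θ)⁻¹ := by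
  have hO : IsUnit (Omega V θ).det := by
    have := congrArg Matrix.det (Omega_mul_self hP)
    rw [det_mul] at this
    refine isUnit_iff_ne_zero.2 fun h => hdet ?_
    rw [← this, h, zero_mul]
  rw [← Omega_inv_mul_self hP, ← Matrix.mul_assoc, Matrix.mul_nonsing_inv _ hO, Matrix.one_mul]

/-- The Gibbs symbol is block diagonal, and multiplication by the off-diagonal matrices `C` and `C*`
on its two sides keeps it so. Hence the even sign sums do not contribute to the current. -/
lemma L1plus_gibbsHat_toBlocks₂₁ (T : ℝ) : (L1plus V θ (gibbsHat V T θ)).toBlocks₂₁ = 0 := by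
  simp only [L1plus, Cmat, CmatStar, gibbsHat, fromBlocks_multiply, fromBlocks_add, fromBlocks_smul,
    toBlocks_fromBlocks₂₁]
  simp

/-- Since `Ω V̂⁻¹ = Ω⁻¹`, the displacement and the velocity block contribute equally, which cancels
the factor 1/2. -/
lemma L2minus_gibbsHat_toBlocks₂₁ (hP : (fourier V θ).PosSemidef) (hdet : (fourier V θ).det ≠ 0)
    (T : ℝ) : (L2minus V θ (gibbsHat V T θ)).toBlocks₂₁ = (-T : ℂ) • (Omega V θ)⁻¹ := by
  simp only [L2minus, Cmat, CmatStar, gibbsHat, fromBlocks_multiply, sub_eq_add_neg, fromBlocks_neg,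
    fromBlocks_add, fromBlocks_smul, toBlocks_fromBlocks₂₁]
  have := Omega_mul_fourier_inv hP hdet
  simp only [Matrix.mul_smul, Matrix.neg_mul, this, Matrix.smul_mul, Matrix.one_mul,
    Matrix.mul_zero, add_zero, zero_add]
  ext a b
  simp
  ring

lemma toBlocks₂₁_conj (B : Matrix (Fin n) (Fin n) ℂ)
    (M : Matrix (Fin n ⊕ Fin n) (Fin n ⊕ Fin n) ℂ) :
    (fromBlocks B 0 0 B * M * fromBlocks B 0 0 B).toBlocks₂₁ = B * M.toBlocks₂₁ * B := by
  conv_lhs => rw [← fromBlocks_toBlocks M]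
  simp [fromBlocks_multiply]

lemma toBlocks₂₁_sum {ι : Type*} (s : Finset ι)
    (M : ι → Matrix (Fin n ⊕ Fin n) (Fin n ⊕ Fin n) ℂ) :
    (∑ i ∈ s, M i).toBlocks₂₁ = ∑ i ∈ s, (M i).toBlocks₂₁ := by
  ext a b; simp [toBlocks₂₁, Matrix.sum_apply]

lemma toBlocks₂₁_smul (c : ℂ) (M : Matrix (Fin n ⊕ Fin n) (Fin n ⊕ Fin n) ℂ) :
    (c • M).toBlocks₂₁ = c • M.toBlocks₂₁ := rfl

lemma toBlocks₂₁_add (M N : Matrix (Fin n ⊕ Fin n) (Fin n ⊕ Fin n) ℂ) :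
    (M + N).toBlocks₂₁ = M.toBlocks₂₁ + N.toBlocks₂₁ := rfl

variable [NeZero k]

lemma qInfHat_toBlocks₂₁_of_gibbs (hk : k ≤ d) {μ : (Fin k → ℕ) → Measure (Config d n)}
    {T : (Fin k → ℕ) → ℝ} (hP : (fourier V θ).PosSemidef) (hdet : (fourier V θ).det ≠ 0)
    (hG : ∀ nn ∈ halfIndex k, fourier (corr (μ nn)) θ = gibbsHat V (T nn) θ) :
    (qInfHat hk V μ θ).toBlocks₂₁ = ∑ i ∈ bands V θ,
      (-(Complex.I / 2 ^ k) * ((∑ nn ∈ halfIndex k, T nn * Sodd hk V nn i θ : ℝ) : ℂ)) •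
        (bandProj V i θ * (Omega V θ)⁻¹ * bandProj V i θ) := by
  rw [qInfHat, toBlocks₂₁_sum]
  refine Finset.sum_congr rfl fun i _ => ?_
  rw [toBlocks₂₁_conj, toBlocks₂₁_add, toBlocks₂₁_smul, Mplus, Mminus, toBlocks₂₁_smul,
    toBlocks₂₁_smul, toBlocks₂₁_sum, toBlocks₂₁_sum]
  rw [Finset.sum_eq_zero fun nn hn => by
    rw [toBlocks₂₁_smul, hG nn hn, L1plus_gibbsHat_toBlocks₂₁, smul_zero], smul_zero, zero_add,
    Finset.sum_congr rfl fun nn hn => by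
      rw [toBlocks₂₁_smul, hG nn hn, L2minus_gibbsHat_toBlocks₂₁ hP hdet, smul_smul],
    ← Finset.sum_smul, smul_smul, smul_smul, Matrix.mul_smul, Matrix.smul_mul]
  congr 1
  push_cast
  rw [Finset.mul_sum, Finset.mul_sum]
  refine Finset.sum_congr rfl fun nn _ => ?_
  ring

omit [NeZero k] in
lemma Sodd_eq_of_omega_eq (hk : k ≤ d) (hd : ∀ i, DifferentiableAt ℝ (omega V i) θ) {i j : Fin n}
    (hij : omega V i θ = omega V j θ) (nn : Fin k → ℕ) : Sodd hk V nn i θ = Sodd hk V nn j θ := by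
  simp only [Sodd, signProd, dOmega_eq_of_omega_eq hd hij]

/-- The integrand of the limiting current for Gibbs reservoirs. -/
lemma trace_qInfHat_of_gibbs [NeZero d] (hk : k ≤ d) {μ : (Fin k → ℕ) → Measure (Config d n)}
    {T : (Fin k → ℕ) → ℝ} (hV : ExpDecay V) (hP : ∀ θ, (fourier V θ).PosSemidef)
    (hdet : (fourier V θ).det ≠ 0) (hd : ∀ i, DifferentiableAt ℝ (omega V i) θ)
    (hG : ∀ nn ∈ halfIndex k, fourier (corr (μ nn)) θ = gibbsHat V (T nn) θ) (l : Fin d) :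
    ((qInfHat hk V μ θ).toBlocks₂₁ * dFourier V l θ).trace
      = -(2 * Complex.I / 2 ^ k) * ((∑ j, dOmega V j l θ *
          ∑ nn ∈ halfIndex k, T nn * Sodd hk V nn j θ : ℝ) : ℂ) := by
  rw [qInfHat_toBlocks₂₁_of_gibbs hk (hP θ) hdet hG, Matrix.sum_mul, Matrix.trace_sum,
    ← sum_bands_sum_eq V θ (fun j => dOmega V j l θ * ∑ nn ∈ halfIndex k, T nn * Sodd hk V nn j θ),
    Complex.ofReal_sum, Finset.mul_sum]
  refine Finset.sum_congr rfl fun i _ => ?_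
  rw [Matrix.smul_mul, Matrix.trace_smul,
    trace_bandProj_Omega_inv_dFourier hV hP hdet hd,
    smul_eq_mul, Complex.ofReal_sum Finset.univ, Finset.mul_sum Finset.univ,
    Finset.mul_sum Finset.univ]
  refine Finset.sum_congr rfl fun j _ => ?_
  split_ifs with h
  · simp only [Sodd_eq_of_omega_eq hk hd h]
    push_cast
    ring
  · simp

end GibbsTrace

/-! ### Integration over one torus variable first. -/

section Slices

/-- A function on the torus vanishes in mean if its means in one variable vanish. -/
lemma setIntegral_torus_eq_zero_of_slices {d : ℕ} (l : Fin d) {f : (Fin d → ℝ) → ℝ}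
    (hf : IntegrableOn f (torus d))
    (h : ∀ θ, ∫ t in Set.Icc (-Real.pi) Real.pi, f (Function.update θ l t) = 0) :
    ∫ θ in torus d, f θ = 0 := by
  obtain _ | d := d
  · exact l.elim0
  let e : ℝ × (Fin d → ℝ) ≃ᵐ (Fin (d + 1) → ℝ) :=
    (MeasurableEquiv.piFinSuccAbove (fun _ : Fin (d + 1) => ℝ) l).symm
  have he : MeasurePreserving e volume volume :=
    (volume_preserving_piFinSuccAbove (fun _ : Fin (d + 1) => ℝ) l).symm _
  have hpre : e ⁻¹' torus (d + 1) = Set.Icc (-Real.pi) Real.pi ×ˢ torus d :=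
    ((Fin.insertNthOrderIso (fun _ : Fin (d + 1) => ℝ) l).preimage_Icc _ _).trans
      (Set.Icc_prod_eq _ _)
  rw [← he.setIntegral_preimage_emb e.measurableEmbedding, hpre]
  rw [← he.integrableOn_comp_preimage e.measurableEmbedding, hpre] at hf
  have hf' : Integrable (fun z => f (e z)) ((volume.restrict (Set.Icc (-Real.pi) Real.pi)).prod
      (volume.restrict (torus d))) := by
    rw [Measure.prod_restrict]; exact hf
  rw [Measure.volume_eq_prod, ← Measure.prod_restrict, integral_prod_symm _ hf']
  refine integral_eq_zero_of_ae (Filter.Eventually.of_forall fun y => ?_)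
  have := h (l.insertNth 0 y)
  simp only [Fin.update_insertNth] at this
  exact this

end Slices

/-! ### Parity of the dispersion relations and of their derivatives. -/

section Flips

variable {d n : ℕ} {V : Lattice d → Matrix (Fin n) (Fin n) ℝ} {i : Fin n}

lemma flip_singleton (p : Fin d) (θ : Fin d → ℝ) : flip {p} θ = Function.update θ p (-θ p) := by
  funext j
  by_cases h : j = p
  · subst h; simp [flip]
  · simp [flip, h]

lemma EvenIn.omega_flip {p : Fin d} (h : EvenIn V i p) (θ : Fin d → ℝ) :
    omega V i (flip {p} θ) = omega V i θ := by
  rw [flip_singleton]; exact h θ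

lemma omega_flip_of_forall_evenIn {s : Finset (Fin d)} (h : ∀ p ∈ s, EvenIn V i p)
    (θ : Fin d → ℝ) : omega V i (flip s θ) = omega V i θ := by
  induction s using Finset.induction_on generalizing θ with
  | empty => exact congrArg _ (funext fun j => by simp [flip])
  | insert p s hp ih =>
    have : flip (insert p s) θ = flip {p} (flip s θ) := by
      funext j
      by_cases h : j = p
      · subst h; simp [flip, hp]
      · simp [flip, h]
    rw [this, (h p (by simp)).omega_flip, ih fun q hq => h q (by simp [hq])]

/-- Evenness in all variables but one implies evenness in the last one. -/
lemma evenIn_of_forall_ne (hH : ∀ θ, (fourier V θ).IsHermitian) {p : Fin d}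
    (h : ∀ q, q ≠ p → EvenIn V i q) : EvenIn V i p := fun θ => by
  -- Reversing `θ_p` alone is the total reflection `θ ↦ -θ` composed with the reversal of all the
  -- other variables.
  rw [← flip_singleton, ← omega_neg hH,
    ← omega_flip_of_forall_evenIn (s := Finset.univ.erase p) (fun q hq => h q (by simpa using hq)) θ]
  congr 1
  funext j
  by_cases hj : j = p
  · subst hj; simp [flip]
  · simp [flip, hj]

lemma EvenIn.dOmega_flip_self {p : Fin d} (h : EvenIn V i p) (θ : Fin d → ℝ) :
    dOmega V i p (flip {p} θ) = -dOmega V i p θ := by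
  have h1 : (fun t => omega V i (Function.update (flip {p} θ) p t))
      = fun t => (fun t => omega V i (Function.update θ p t)) (-t) := by
    funext t
    have := h (Function.update θ p t)
    rw [Function.update_self, Function.update_idem] at this
    rw [flip_singleton, Function.update_idem, ← h (Function.update θ p t)]
    simp
  rw [dOmega, h1]
  refine (deriv_comp_neg (fun t => omega V i (Function.update θ p t)) (flip {p} θ p)).trans ?_
  simp [flip, dOmega]

lemma EvenIn.dOmega_flip_of_ne {p l : Fin d} (h : EvenIn V i p) (hl : l ≠ p) (θ : Fin d → ℝ) :
    dOmega V i l (flip {p} θ) = dOmega V i l θ := by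
  have h1 : (fun t => omega V i (Function.update (flip {p} θ) l t))
      = fun t => omega V i (Function.update θ l t) := by
    funext t
    rw [← h.omega_flip]
    congr 1
    funext j
    by_cases hj : j = l
    · subst hj; simp [flip, hl]
    · by_cases hj' : j = p
      · subst hj'; simp [flip, hj]
      · simp [flip, hj, hj']
  rw [dOmega, h1, dOmega]
  simp [flip, hl]

end Flips

/-! ### Integrals of band derivatives against products of signs. -/

section SignIntegrals

variable {d n k : ℕ} [NeZero d] {V : Lattice d → Matrix (Fin n) (Fin n) ℝ} {i : Fin n}

/-- The product of `sin²(θ_1 x_1)`, of `∂_l ω_i`, and of the signs of `∂_p ω_i`, `p ∈ P`. -/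
def signDensity (hk : k ≤ d) (V : Lattice d → Matrix (Fin n) (Fin n) ℝ) (i : Fin n) (l : Fin d)
    (x1 : ℤ) (P : Finset (Fin k)) (θ : Fin d → ℝ) : ℝ :=
  Real.sin (θ 0 * x1) ^ 2 *
    (dOmega V i l θ * ∏ p ∈ P, Real.sign (dOmega V i (Fin.castLE hk p) θ))

lemma sin_flip_sq (s : Finset (Fin d)) (x1 : ℤ) (θ : Fin d → ℝ) :
    Real.sin (flip s θ 0 * x1) ^ 2 = Real.sin (θ 0 * x1) ^ 2 := by
  simp only [flip]
  split_ifs <;> simp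

omit [NeZero d] in
lemma EvenIn.prod_sign_flip (hk : k ≤ d) {p : Fin k} (h : EvenIn V i (Fin.castLE hk p))
    (P : Finset (Fin k)) (θ : Fin d → ℝ) :
    ∏ q ∈ P, Real.sign (dOmega V i (Fin.castLE hk q) (flip {Fin.castLE hk p} θ))
      = (if p ∈ P then -1 else 1) * ∏ q ∈ P, Real.sign (dOmega V i (Fin.castLE hk q) θ) := by
  have hne : ∀ q, q ≠ p → Real.sign (dOmega V i (Fin.castLE hk q) (flip {Fin.castLE hk p} θ))
      = Real.sign (dOmega V i (Fin.castLE hk q) θ) := fun q hq => by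
    rw [h.dOmega_flip_of_ne (fun he => hq (Fin.castLE_inj.1 he))]
  split_ifs with hp
  · rw [← Finset.mul_prod_erase _ _ hp, ← Finset.mul_prod_erase _ _ hp, h.dOmega_flip_self,
      Real.sign_neg, Finset.prod_congr rfl fun q hq => hne q (Finset.ne_of_mem_erase hq)]
    ring
  · rw [one_mul]
    exact Finset.prod_congr rfl fun q hq => hne q fun he => hp (he ▸ hq)

/-- Reversing `θ_p` changes the sign of exactly one factor, `sgn ∂_p ω`, so the density is odd under
a measure-preserving reflection of the torus. -/
lemma EvenIn.setIntegral_signDensity_eq_zero (hk : k ≤ d) {p : Fin k}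
    (h : EvenIn V i (Fin.castLE hk p)) {l : Fin d} (hl : l ≠ Fin.castLE hk p) (x1 : ℤ)
    {P : Finset (Fin k)} (hp : p ∈ P) : ∫ θ in torus d, signDensity hk V i l x1 P θ = 0 := by
  have h1 : ∀ θ, signDensity hk V i l x1 P (flip {Fin.castLE hk p} θ)
      = -signDensity hk V i l x1 P θ := fun θ => by
    rw [signDensity, signDensity, sin_flip_sq, h.dOmega_flip_of_ne hl, h.prod_sign_flip, if_pos hp]
    ring
  have h2 := setIntegral_torus_flip {Fin.castLE hk p} (signDensity hk V i l x1 P)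
  simp only [h1] at h2
  rw [integral_neg] at h2
  linarith

lemma measurable_signDensity (hk : k ≤ d) (hS : ∀ a b, Summable fun x => V x a b)
    (hH : ∀ θ, (fourier V θ).IsHermitian) (i : Fin n) (l : Fin d) (x1 : ℤ) (P : Finset (Fin k)) :
    Measurable (signDensity hk V i l x1 P) := by
  have h1 : Measurable fun θ : Fin d → ℝ => Real.sin (θ 0 * x1) ^ 2 := by fun_prop
  exact h1.mul ((measurable_dOmega hS hH i l).mul (Finset.measurable_prod P fun p _ =>
    measurable_real_sign.comp (measurable_dOmega hS hH i _)))

lemma abs_prod_sign_le (f : Fin k → ℝ) (P : Finset (Fin k)) : |∏ p ∈ P, Real.sign (f p)| ≤ 1 := by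
  rw [Finset.abs_prod]
  refine Finset.prod_le_one (fun _ _ => abs_nonneg _) fun p _ => ?_
  rcases Real.sign_apply_eq (f p) with h | h | h <;> simp [h]

lemma integrableOn_signDensity (hk : k ≤ d) (hV : ExpDecay V)
    (hP : ∀ θ, (fourier V θ).PosSemidef) (hdet : ∀ θ, (fourier V θ).det ≠ 0) (i : Fin n)
    (l : Fin d) (x1 : ℤ) (P : Finset (Fin k)) :
    IntegrableOn (signDensity hk V i l x1 P) (torus d) := by
  obtain ⟨K, hK, hle⟩ := exists_abs_dOmega_le hV hP hdet i
  refine Integrable.of_bound (measurable_signDensity hk hV.summable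
    (fun θ => (hP θ).isHermitian) i l x1 P).aestronglyMeasurable K
    (Filter.Eventually.of_forall fun θ => ?_)
  rw [Real.norm_eq_abs, signDensity, abs_mul, abs_mul, abs_of_nonneg (sq_nonneg _)]
  calc _ ≤ 1 * (K * 1) := by
        gcongr
        · exact Real.sin_sq_le_one _
        · exact hle l θ
        · exact abs_prod_sign_le _ P
    _ = K := by ring

/-- Over a period, the derivative of a Lipschitz dispersion relation has mean zero. -/
lemma setIntegral_dOmega_update (hV : ExpDecay V) (hP : ∀ θ, (fourier V θ).PosSemidef)
    (hdet : ∀ θ, (fourier V θ).det ≠ 0) (i : Fin n) (l : Fin d) (θ : Fin d → ℝ) :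
    ∫ t in Set.Icc (-Real.pi) Real.pi, dOmega V i l (Function.update θ l t) = 0 := by
  obtain ⟨K, hK⟩ := exists_lipschitzWith_omega hV hP hdet i
  -- A Lipschitz function of one variable is absolutely continuous, so the integral of its
  -- derivative is the difference of the boundary values, and these agree by periodicity.
  have h1 := ((lipschitzWith_omega_update hK θ l).lipschitzOnWith
    (s := Set.uIcc (-Real.pi) Real.pi)).absolutelyContinuousOnInterval.integral_deriv_eq_sub
  have h2 : omega V i (Function.update θ l Real.pi) = omega V i (Function.update θ l (-Real.pi)) := by
    rw [← omega_add_two_pi i (Function.update θ l (-Real.pi)) (Pi.single l 1)]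
    congr 1
    funext j
    by_cases hj : j = l
    · subst hj; simp; ring
    · simp [hj]
  rw [h2, sub_self, intervalIntegral.integral_of_le (by linarith [Real.pi_pos]),
    ← integral_Icc_eq_integral_Ioc] at h1
  rw [← h1]
  refine integral_congr_ae (Filter.Eventually.of_forall fun t => ?_)
  simp [dOmega]

/-- The signs depend on variables other than `θ_l`, and so does `sin²(θ_1 x_1)` because `l` is
transverse. They come out of the `θ_l`-integral, and `∂_l ω` has mean zero over a period. -/
lemma setIntegral_signDensity_eq_zero_of_sign (hk : k ≤ d) (hV : ExpDecay V)
    (hP : ∀ θ, (fourier V θ).PosSemidef) (hdet : ∀ θ, (fourier V θ).det ≠ 0)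
    (hs : ∀ p : Fin k, ∃ s : ℝ → ℝ, ∀ᵐ θ : Fin d → ℝ,
      Real.sign (dOmega V i (Fin.castLE hk p) θ) = s (θ (Fin.castLE hk p)))
    {l : Fin d} (hl0 : l ≠ 0) (x1 : ℤ) {P : Finset (Fin k)}
    (hl : ∀ p ∈ P, l ≠ Fin.castLE hk p) :
    ∫ θ in torus d, signDensity hk V i l x1 P θ = 0 := by
  choose s hs using hs
  let g : (Fin d → ℝ) → ℝ := fun θ => Real.sin (θ 0 * x1) ^ 2 * ∏ p ∈ P, s p (θ (Fin.castLE hk p))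
  have hg : ∀ θ t, g (Function.update θ l t) = g θ := fun θ t => by
    simp only [g]
    rw [Function.update_of_ne hl0.symm, Finset.prod_congr rfl fun p hp => by
      rw [Function.update_of_ne (hl p hp).symm]]
  have hae : signDensity hk V i l x1 P =ᵐ[volume.restrict (torus d)]
      fun θ => g θ * dOmega V i l θ := by
    filter_upwards [ae_restrict_of_ae (ae_all_iff.2 hs)] with θ hθ
    simp only [signDensity, g, hθ]
    ring
  rw [integral_congr_ae hae]
  refine setIntegral_torus_eq_zero_of_slices l
    ((integrableOn_signDensity hk hV hP hdet i l x1 P).congr hae) fun θ => ?_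
  simp only [hg, integral_const_mul, setIntegral_dOmega_update hV hP hdet, mul_zero]

omit [NeZero d] in
lemma exists_eq_univ_erase {P : Finset (Fin k)} (hk1 : 1 ≤ k) (hP : P.card = k - 1) :
    ∃ p, ∀ q, q ≠ p → q ∈ P := by
  have h : Pᶜ.card = 1 := by rw [Finset.card_compl, hP, Fintype.card_fin]; omega
  obtain ⟨p, hp⟩ := Finset.card_eq_one.1 h
  refine ⟨p, fun q hq => ?_⟩
  by_contra hqP
  have : q ∈ Pᶜ := Finset.mem_compl.2 hqP
  rw [hp, Finset.mem_singleton] at this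
  exact hq this

omit [NeZero d] in
/-- In the first case of the symmetry condition the dispersion relations are even in all
variables. -/
lemma evenIn_castLE_of_evenInAllButOne [NeZero k] (hk : k ≤ d)
    (hH : ∀ θ, (fourier V θ).IsHermitian) (h1 : ∀ l : Fin d, k ≤ l.val → EvenIn V i l)
    (h2 : 2 ≤ k → EvenInAllButOne hk V i) (p : Fin k) : EvenIn V i (Fin.castLE hk p) := by
  obtain ⟨p₀, hp₀⟩ : ∃ p₀ : Fin k, ∀ q, q ≠ p₀ → EvenIn V i (Fin.castLE hk q) := by
    rcases Nat.lt_or_ge k 2 with hk2 | hk2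
    · refine ⟨p, fun q hq => absurd (Fin.ext ?_) hq⟩
      omega
    · obtain ⟨E, hE, hev⟩ := h2 hk2
      obtain ⟨p₀, hp₀⟩ := exists_eq_univ_erase (by omega) hE
      exact ⟨p₀, fun q hq => hev q (hp₀ q hq)⟩
  by_cases hp : p = p₀
  · subst hp
    refine evenIn_of_forall_ne hH fun q hq => ?_
    rcases Nat.lt_or_ge q.val k with hqk | hqk
    · exact hp₀ ⟨q, hqk⟩ fun he => hq (by rw [← he]; rfl)
    · exact h1 q hqk
  · exact hp₀ p hp

/-- Under the symmetry condition only the one-element sets of signs contribute to the current. -/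
lemma setIntegral_signDensity_eq_zero [NeZero k] (hk : k ≤ d) (hV : ExpDecay V)
    (hP : ∀ θ, (fourier V θ).PosSemidef) (hdet : ∀ θ, (fourier V θ).det ≠ 0)
    (hSC : SymmetryCondition hk V) (i : Fin n) {l : Fin d} (hl0 : l ≠ 0) (x1 : ℤ)
    {P : Finset (Fin k)} (hodd : Odd P.card) (hPl : ∀ p, P = {p} → l ≠ Fin.castLE hk p) :
    ∫ θ in torus d, signDensity hk V i l x1 P θ = 0 := by
  have hH := fun θ => (hP θ).isHermitian
  have hne : P.Nonempty := Finset.card_pos.1 hodd.pos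
  -- If all of `θ_1, …, θ_k` are variables of evenness, it suffices to find some `p ∈ P` different
  -- from `l`; it exists because `P` is nonempty and not `{l}`.
  have hb : (∀ p : Fin k, EvenIn V i (Fin.castLE hk p)) →
      ∫ θ in torus d, signDensity hk V i l x1 P θ = 0 := fun h => by
    obtain ⟨p, hp, hpl⟩ : ∃ p ∈ P, l ≠ Fin.castLE hk p := by
      by_contra! hcon
      obtain ⟨p, hp⟩ := hne
      refine hPl p (Finset.eq_singleton_iff_unique_mem.2 ⟨hp, fun q hq => ?_⟩) (hcon p hp)
      exact Fin.castLE_inj.1 ((hcon q hq).symm.trans (hcon p hp))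
    exact (h p).setIntegral_signDensity_eq_zero hk hpl x1 hp
  rcases hSC with h | h | h
  · exact hb fun p => evenIn_castLE_of_evenInAllButOne hk hH (h i).1 (h i).2 p
  · exact hb (h i)
  · by_cases hl : ∀ p ∈ P, l ≠ Fin.castLE hk p
    · exact setIntegral_signDensity_eq_zero_of_sign hk hV hP hdet (h i).1 hl0 x1 hl
    push Not at hl
    obtain ⟨p, hp, hpl⟩ := hl
    -- Here `l` belongs to `P` but `P ≠ {l}`, and the size is odd. Three elements suffice to find
    -- one that is neither `l` nor the possible exceptional variable of evenness; reversing that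
    -- variable kills the integral.
    have hcard : 3 ≤ P.card := by
      have h1 : P.card ≠ 1 := fun h1 => by
        obtain ⟨q, hq⟩ := Finset.card_eq_one.1 h1
        have : p = q := by rw [hq] at hp; exact Finset.mem_singleton.1 hp
        exact hPl q hq (this ▸ hpl)
      obtain ⟨m, hm⟩ := hodd
      omega
    have hk3 : 3 ≤ k := hcard.trans ((Finset.card_le_univ P).trans_eq (Fintype.card_fin k))
    obtain ⟨E, hE, hev⟩ := (h i).2 hk3
    obtain ⟨p₀, hp₀⟩ := exists_eq_univ_erase (by omega) hE
    obtain ⟨q, hq⟩ : ((P.erase p).erase p₀).Nonempty := by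
      rw [← Finset.card_pos]
      have := Finset.pred_card_le_card_erase (s := P.erase p) (a := p₀)
      rw [Finset.card_erase_of_mem hp] at this
      omega
    simp only [Finset.mem_erase] at hq
    refine (hev q (hp₀ q hq.1)).setIntegral_signDensity_eq_zero hk (fun he => ?_) x1 hq.2.2
    exact hq.2.1 (Fin.castLE_inj.1 (he.symm.trans hpl))

lemma mul_real_sign (a : ℝ) : a * Real.sign a = |a| := by
  rcases lt_trichotomy a 0 with h | h | h
  · rw [Real.sign_of_neg h, abs_of_neg h]; ring
  · simp [h]
  · rw [Real.sign_of_pos h, abs_of_pos h, mul_one]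

lemma signDensity_singleton (hk : k ≤ d) (i : Fin n) (p : Fin k) (x1 : ℤ) (θ : Fin d → ℝ) :
    signDensity hk V i (Fin.castLE hk p) x1 {p} θ
      = Real.sin (θ 0 * x1) ^ 2 * |dOmega V i (Fin.castLE hk p) θ| := by
  rw [signDensity, Finset.prod_singleton, mul_real_sign]

lemma sin_sq_mul_dOmega_mul_Sodd (hk : k ≤ d) (nn : Fin k → ℕ) (i : Fin n) (l : Fin d) (x1 : ℤ)
    (θ : Fin d → ℝ) : Real.sin (θ 0 * x1) ^ 2 * (dOmega V i l θ * Sodd hk V nn i θ)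
      = ∑ m ∈ (Finset.Icc 1 k).filter Odd,
        ∑ P ∈ Finset.powersetCard m (Finset.univ : Finset (Fin k)),
          (-1) ^ (∑ p ∈ P, nn p) * signDensity hk V i l x1 P θ := by
  simp only [Sodd, Finset.mul_sum, signProd, signDensity]
  refine Finset.sum_congr rfl fun m _ => Finset.sum_congr rfl fun P _ => ?_
  ring

lemma integrableOn_sin_sq_mul_Sodd (hk : k ≤ d) (hV : ExpDecay V)
    (hP : ∀ θ, (fourier V θ).PosSemidef) (hdet : ∀ θ, (fourier V θ).det ≠ 0)
    (nn : Fin k → ℕ) (i : Fin n) (l : Fin d) (x1 : ℤ) :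
    IntegrableOn (fun θ => Real.sin (θ 0 * x1) ^ 2 * (dOmega V i l θ * Sodd hk V nn i θ))
      (torus d) := by
  simp only [sin_sq_mul_dOmega_mul_Sodd]
  exact integrable_finsetSum _ fun m _ => integrable_finsetSum _ fun P _ =>
    (integrableOn_signDensity hk hV hP hdet i l x1 P).const_mul _

lemma setIntegral_sin_sq_mul_Sodd (hk : k ≤ d) (hV : ExpDecay V)
    (hP : ∀ θ, (fourier V θ).PosSemidef) (hdet : ∀ θ, (fourier V θ).det ≠ 0)
    (nn : Fin k → ℕ) (i : Fin n) (l : Fin d) (x1 : ℤ) :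
    ∫ θ in torus d, Real.sin (θ 0 * x1) ^ 2 * (dOmega V i l θ * Sodd hk V nn i θ)
      = ∑ m ∈ (Finset.Icc 1 k).filter Odd,
        ∑ P ∈ Finset.powersetCard m (Finset.univ : Finset (Fin k)),
          (-1) ^ (∑ p ∈ P, nn p) * ∫ θ in torus d, signDensity hk V i l x1 P θ := by
  simp only [sin_sq_mul_dOmega_mul_Sodd]
  rw [integral_finsetSum _ fun m _ => integrable_finsetSum _ fun P _ =>
    (integrableOn_signDensity hk hV hP hdet i l x1 P).const_mul _]
  refine Finset.sum_congr rfl fun m _ => ?_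
  rw [integral_finsetSum _ fun P _ =>
    (integrableOn_signDensity hk hV hP hdet i l x1 P).const_mul _]
  simp only [integral_const_mul]

lemma castLE_ne_zero [NeZero k] (hk : k ≤ d) {p : Fin k} (hp : p ≠ 0) : Fin.castLE hk p ≠ 0 :=
  fun h => hp (Fin.ext (by simpa using congrArg Fin.val h))

/-- Of all odd sets of signs only `{p}` survives, and there the derivative times its own sign is the
absolute value. -/
lemma setIntegral_sin_sq_mul_Sodd_castLE [NeZero k] (hk : k ≤ d) (hV : ExpDecay V)
    (hP : ∀ θ, (fourier V θ).PosSemidef) (hdet : ∀ θ, (fourier V θ).det ≠ 0)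
    (hSC : SymmetryCondition hk V) (nn : Fin k → ℕ) (i : Fin n) {p : Fin k} (hp : p ≠ 0) (x1 : ℤ) :
    ∫ θ in torus d, Real.sin (θ 0 * x1) ^ 2 * (dOmega V i (Fin.castLE hk p) θ * Sodd hk V nn i θ)
      = (-1) ^ nn p * ∫ θ in torus d, Real.sin (θ 0 * x1) ^ 2 * |dOmega V i (Fin.castLE hk p) θ| := by
  have hl0 := castLE_ne_zero hk hp
  have hz : ∀ P : Finset (Fin k), Odd P.card → P ≠ {p} →
      ∫ θ in torus d, signDensity hk V i (Fin.castLE hk p) x1 P θ = 0 := fun P hodd hne =>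
    setIntegral_signDensity_eq_zero hk hV hP hdet hSC i hl0 x1 hodd fun q hq h =>
      hne (by rw [hq, Fin.castLE_inj.1 h])
  rw [setIntegral_sin_sq_mul_Sodd hk hV hP hdet, Finset.sum_eq_single 1, Finset.sum_eq_single {p}]
  · simp only [signDensity_singleton, Finset.sum_singleton]
  · intro P hPm hne
    rw [hz P (by rw [(Finset.mem_powersetCard.1 hPm).2]; exact odd_one) hne, mul_zero]
  · intro h
    exact absurd (Finset.mem_powersetCard.2 ⟨Finset.subset_univ _, Finset.card_singleton p⟩) h
  · intro m hm hm1
    refine Finset.sum_eq_zero fun P hPm => ?_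
    have hc := (Finset.mem_powersetCard.1 hPm).2
    rw [hz P (by rw [hc]; exact (Finset.mem_filter.1 hm).2) fun h => hm1 (by rw [← hc, h]; simp),
      mul_zero]
  · intro h
    refine absurd (Finset.mem_filter.2 ⟨Finset.mem_Icc.2 ⟨le_rfl, ?_⟩, odd_one⟩) h
    exact Nat.one_le_iff_ne_zero.2 (NeZero.ne k)

/-- A direction beyond the first `k` belongs to no set `P`, so not even a one-element set survives.
-/
lemma setIntegral_sin_sq_mul_Sodd_of_le [NeZero k] (hk : k ≤ d) (hV : ExpDecay V)
    (hP : ∀ θ, (fourier V θ).PosSemidef) (hdet : ∀ θ, (fourier V θ).det ≠ 0)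
    (hSC : SymmetryCondition hk V) (nn : Fin k → ℕ) (i : Fin n) {l : Fin d} (hl : k ≤ l.val)
    (x1 : ℤ) :
    ∫ θ in torus d, Real.sin (θ 0 * x1) ^ 2 * (dOmega V i l θ * Sodd hk V nn i θ) = 0 := by
  have hl0 : l ≠ 0 := fun h => by
    subst h
    exact NeZero.ne k (Nat.le_zero.1 (by simpa using hl))
  rw [setIntegral_sin_sq_mul_Sodd hk hV hP hdet]
  refine Finset.sum_eq_zero fun m hm => Finset.sum_eq_zero fun P hPm => ?_
  rw [setIntegral_signDensity_eq_zero hk hV hP hdet hSC i hl0 x1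
    (by rw [(Finset.mem_powersetCard.1 hPm).2]; exact (Finset.mem_filter.1 hm).2)
    (fun p _ h => absurd hl (by rw [h]; simp)), mul_zero]

end SignIntegrals

/-! ### The alternating sum over reservoirs. -/

section Temperatures

variable {k : ℕ} [NeZero k]

lemma mem_halfIndex {nn : Fin k → ℕ} :
    nn ∈ halfIndex k ↔ ∀ j, nn j ∈ (if j = 0 then {2} else {1, 2} : Finset ℕ) :=
  Fintype.mem_piFinset

lemma update_mem_halfIndex {nn : Fin k → ℕ} (h : nn ∈ halfIndex k) {p : Fin k} (hp : p ≠ 0)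
    {a : ℕ} (ha : a = 1 ∨ a = 2) : Function.update nn p a ∈ halfIndex k := by
  rw [mem_halfIndex] at h ⊢
  intro j
  by_cases hj : j = p
  · subst hj
    rcases ha with rfl | rfl <;> simp [hp]
  · simpa [hj] using h j

/-- The index vectors with `n_p = 2` and with `n_p = 1` are paired by changing that one entry, which
is free because `p ≠ 0`; the sign `(-1)^{n_p}` turns each pair into a difference. -/
lemma sum_halfIndex_eq_tempDiff (T : (Fin k → ℕ) → ℝ) {p : Fin k} (hp : p ≠ 0) :
    ∑ nn ∈ halfIndex k, T nn * (-1) ^ nn p = tempDiff T p := by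
  have hv : ∀ nn ∈ halfIndex k, nn p = 1 ∨ nn p = 2 := fun nn h => by
    simpa [hp] using mem_halfIndex.1 h p
  rw [tempDiff, Finset.sum_sub_distrib, ← Finset.sum_filter_add_sum_filter_not _ fun nn => nn p = 2,
    sub_eq_add_neg, ← Finset.sum_neg_distrib]
  congr 1
  · refine Finset.sum_congr rfl fun nn h => ?_
    rw [(Finset.mem_filter.1 h).2]; ring
  · refine Finset.sum_bij' (fun nn _ => Function.update nn p 2) (fun nn _ => Function.update nn p 1)
      ?_ ?_ ?_ ?_ ?_
    · intro nn h
      exact Finset.mem_filter.2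
        ⟨update_mem_halfIndex (Finset.mem_filter.1 h).1 hp (Or.inr rfl), by simp⟩
    · intro nn h
      exact Finset.mem_filter.2
        ⟨update_mem_halfIndex (Finset.mem_filter.1 h).1 hp (Or.inl rfl), by simp⟩
    · intro nn h
      obtain ⟨h1, h2⟩ := Finset.mem_filter.1 h
      have := (hv nn h1).resolve_right h2
      rw [Function.update_idem, ← this, Function.update_eq_self]
    · intro nn h
      rw [Function.update_idem, ← (Finset.mem_filter.1 h).2, Function.update_eq_self]
    · intro nn h
      obtain ⟨h1, h2⟩ := Finset.mem_filter.1 h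
      have := (hv nn h1).resolve_right h2
      rw [Function.update_idem, this, ← this, Function.update_eq_self, this]
      ring

end Temperatures

/-! ### The limiting current of Gibbs reservoirs. -/

section GibbsCurrent

variable {d n k : ℕ} [NeZero d] {V : Lattice d → Matrix (Fin n) (Fin n) ℝ}

lemma integrableOn_sin_sq_mul_abs_dOmega (hV : ExpDecay V)
    (hP : ∀ θ, (fourier V θ).PosSemidef) (hdet : ∀ θ, (fourier V θ).det ≠ 0) (i : Fin n)
    (l : Fin d) (x1 : ℤ) :
    IntegrableOn (fun θ => Real.sin (θ 0 * x1) ^ 2 * |dOmega V i l θ|) (torus d) := by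
  obtain ⟨K, hK, hle⟩ := exists_abs_dOmega_le hV hP hdet i
  have h1 : Measurable fun θ : Fin d → ℝ => Real.sin (θ 0 * x1) ^ 2 := by fun_prop
  have h2 := (measurable_dOmega hV.summable (fun θ => (hP θ).isHermitian) i l).norm
  refine Integrable.of_bound (h1.mul h2).aestronglyMeasurable K
    (Filter.Eventually.of_forall fun θ => ?_)
  rw [Real.norm_eq_abs, abs_mul, abs_of_nonneg (sq_nonneg _), abs_abs]
  calc _ ≤ 1 * K := by
        gcongr
        · exact Real.sin_sq_le_one _
        · exact hle l θ
    _ = K := by ring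

lemma integrableOn_abs_dOmega (hV : ExpDecay V)
    (hP : ∀ θ, (fourier V θ).PosSemidef) (hdet : ∀ θ, (fourier V θ).det ≠ 0) (i : Fin n)
    (l : Fin d) : IntegrableOn (fun θ => |dOmega V i l θ|) (torus d) := by
  obtain ⟨K, hK, hle⟩ := exists_abs_dOmega_le hV hP hdet i
  have h2 := (measurable_dOmega hV.summable (fun θ => (hP θ).isHermitian) i l).norm
  refine Integrable.of_bound h2.aestronglyMeasurable K (Filter.Eventually.of_forall fun θ => ?_)
  rw [Real.norm_eq_abs, abs_abs]
  exact hle l θ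

lemma cHalf_eq (hV : ExpDecay V) (hP : ∀ θ, (fourier V θ).PosSemidef)
    (hdet : ∀ θ, (fourier V θ).det ≠ 0) (l : Fin d) (x1 : ℤ) :
    cHalf V l x1 = 2 / (2 * Real.pi) ^ d *
      ∫ θ in torus d, Real.sin (θ 0 * x1) ^ 2 * ∑ j, |dOmega V j l θ| := by
  rw [cHalf]
  congr 1
  refine integral_congr_ae ?_
  filter_upwards [ae_restrict_of_ae (ae_differentiableAt_omega hV hP hdet)] with θ hθ
  exact sum_bands_bandMult_mul hθ l _

lemma cFull_eq (hV : ExpDecay V) (hP : ∀ θ, (fourier V θ).PosSemidef)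
    (hdet : ∀ θ, (fourier V θ).det ≠ 0) (l : Fin d) :
    cFull V l = 1 / (2 * Real.pi) ^ d * ∫ θ in torus d, ∑ j, |dOmega V j l θ| := by
  rw [cFull]
  congr 1
  refine integral_congr_ae ?_
  filter_upwards [ae_restrict_of_ae (ae_differentiableAt_omega hV hP hdet)] with θ hθ
  simpa using sum_bands_bandMult_mul hθ l 1

variable [NeZero k]

lemma setIntegral_trace_of_gibbs (hk : k ≤ d) {μ : (Fin k → ℕ) → Measure (Config d n)}
    {T : (Fin k → ℕ) → ℝ} (hV : ExpDecay V) (hP : ∀ θ, (fourier V θ).PosSemidef)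
    (hdet : ∀ θ, (fourier V θ).det ≠ 0)
    (hG : ∀ nn ∈ halfIndex k, ∀ θ, fourier (corr (μ nn)) θ = gibbsHat V (T nn) θ) (l : Fin d)
    (x1 : ℤ) :
    ∫ θ in torus d, ((Real.sin (θ 0 * x1) ^ 2 : ℝ) : ℂ) *
        ((qInfHat hk V μ θ).toBlocks₂₁ * dFourier V l θ).trace
      = -(2 * Complex.I / 2 ^ k) * ((∑ j, ∑ nn ∈ halfIndex k, T nn *
          ∫ θ in torus d, Real.sin (θ 0 * x1) ^ 2 * (dOmega V j l θ * Sodd hk V nn j θ) : ℝ) : ℂ) := by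
  have h1 : ∀ᵐ θ ∂volume.restrict (torus d), ((Real.sin (θ 0 * x1) ^ 2 : ℝ) : ℂ) *
        ((qInfHat hk V μ θ).toBlocks₂₁ * dFourier V l θ).trace
      = -(2 * Complex.I / 2 ^ k) * ((∑ j, ∑ nn ∈ halfIndex k, T nn *
          (Real.sin (θ 0 * x1) ^ 2 * (dOmega V j l θ * Sodd hk V nn j θ)) : ℝ) : ℂ) := by
    filter_upwards [ae_restrict_of_ae (ae_differentiableAt_omega hV hP hdet)] with θ hθ
    rw [trace_qInfHat_of_gibbs hk hV hP (hdet θ) hθ (fun nn hn => hG nn hn θ), mul_left_comm,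
      ← Complex.ofReal_mul, Finset.mul_sum]
    congr 2
    refine Finset.sum_congr rfl fun j _ => ?_
    rw [Finset.mul_sum, Finset.mul_sum]
    refine Finset.sum_congr rfl fun nn _ => ?_
    ring
  have hi := fun j nn => (integrableOn_sin_sq_mul_Sodd hk hV hP hdet nn j l x1).const_mul (T nn)
  rw [integral_congr_ae h1, integral_const_mul, integral_complex_ofReal,
    integral_finsetSum _ fun j _ => integrable_finsetSum _ fun nn _ => hi j nn]
  congr 3
  funext j
  rw [integral_finsetSum _ fun nn _ => hi j nn]
  simp only [integral_const_mul]

lemma current_of_gibbs (hk : k ≤ d) {μ : (Fin k → ℕ) → Measure (Config d n)}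
    {T : (Fin k → ℕ) → ℝ} (hV : ExpDecay V) (hP : ∀ θ, (fourier V θ).PosSemidef)
    (hdet : ∀ θ, (fourier V θ).det ≠ 0)
    (hG : ∀ nn ∈ halfIndex k, ∀ θ, fourier (corr (μ nn)) θ = gibbsHat V (T nn) θ)
    (hSC : SymmetryCondition hk V) {p : Fin k} (hp : p ≠ 0) (x1 : ℤ) :
    -(2 * Complex.I / (2 * Real.pi) ^ d) * ∫ θ in torus d, ((Real.sin (θ 0 * x1) ^ 2 : ℝ) : ℂ) *
        ((qInfHat hk V μ θ).toBlocks₂₁ * dFourier V (Fin.castLE hk p) θ).trace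
      = ((-(cHalf V (Fin.castLE hk p) x1) * (1 / 2 ^ (k - 1)) * tempDiff T p : ℝ) : ℂ) := by
  rw [setIntegral_trace_of_gibbs hk hV hP hdet hG]
  have h : ∑ j, ∑ nn ∈ halfIndex k, T nn * ∫ θ in torus d, Real.sin (θ 0 * x1) ^ 2 *
        (dOmega V j (Fin.castLE hk p) θ * Sodd hk V nn j θ)
      = tempDiff T p * ∑ j, ∫ θ in torus d, Real.sin (θ 0 * x1) ^ 2 *
        |dOmega V j (Fin.castLE hk p) θ| := by
    rw [Finset.mul_sum]
    refine Finset.sum_congr rfl fun j _ => ?_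
    rw [← sum_halfIndex_eq_tempDiff T hp, Finset.sum_mul]
    refine Finset.sum_congr rfl fun nn _ => ?_
    rw [setIntegral_sin_sq_mul_Sodd_castLE hk hV hP hdet hSC _ _ hp, mul_assoc]
  rw [h, cHalf_eq hV hP hdet]
  simp only [Finset.mul_sum]
  rw [integral_finsetSum _ fun j _ => integrableOn_sin_sq_mul_abs_dOmega hV hP hdet j _ x1,
    ← Finset.mul_sum]
  -- With `2^k = 2 · 2^{k-1}`, the two prefactors multiply to `(2i)(2i)/2^k = -2/2^{k-1}`; the
  -- remaining 2 is the one in `cHalf`.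
  obtain ⟨m, rfl⟩ : ∃ m, k = m + 1 := ⟨k - 1, (Nat.succ_pred_eq_of_pos (NeZero.pos k)).symm⟩
  generalize ∑ j, ∫ θ in torus d, Real.sin (θ 0 * x1) ^ 2 * |dOmega V j (Fin.castLE hk p) θ| = S
  have := two_pi_pow_ne_zero d
  push_cast
  rw [pow_succ]
  field_simp
  linear_combination ((tempDiff T p : ℂ) * S) * Complex.I_sq

lemma current_of_gibbs_of_le (hk : k ≤ d) {μ : (Fin k → ℕ) → Measure (Config d n)}
    {T : (Fin k → ℕ) → ℝ} (hV : ExpDecay V) (hP : ∀ θ, (fourier V θ).PosSemidef)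
    (hdet : ∀ θ, (fourier V θ).det ≠ 0)
    (hG : ∀ nn ∈ halfIndex k, ∀ θ, fourier (corr (μ nn)) θ = gibbsHat V (T nn) θ)
    (hSC : SymmetryCondition hk V) {l : Fin d} (hl : k ≤ l.val) (x1 : ℤ) :
    ∫ θ in torus d, ((Real.sin (θ 0 * x1) ^ 2 : ℝ) : ℂ) *
        ((qInfHat hk V μ θ).toBlocks₂₁ * dFourier V l θ).trace = 0 := by
  rw [setIntegral_trace_of_gibbs hk hV hP hdet hG]
  simp [setIntegral_sin_sq_mul_Sodd_of_le hk hV hP hdet hSC _ _ hl]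

end GibbsCurrent

/-! ### Positivity of the coefficients for nonflat bands. -/

section Positivity

variable {d n : ℕ} [NeZero d] {V : Lattice d → Matrix (Fin n) (Fin n) ℝ}

omit [NeZero d] in
-- Countably many translates of the fundamental domain cover the space, the derivative is periodic,
-- and translations preserve null sets; vanishing almost everywhere on the torus would spread
-- everywhere.
lemma not_ae_dOmega_eq_zero (hN : NonflatBands V) (l : Fin d) (i : Fin n) :
    ¬ ∀ᵐ θ ∂volume.restrict (torus d), dOmega V i l θ = 0 := fun h => by
  refine hN l i ?_
  rw [ae_restrict_iff' measurableSet_torus] at h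
  have h2 : ∀ m : Fin d → ℤ, ∀ᵐ θ : Fin d → ℝ, (fun j => θ j + m j * (2 * Real.pi)) ∈ torus d →
      dOmega V i l (fun j => θ j + m j * (2 * Real.pi)) = 0 := fun m =>
    (measurePreserving_add_right (volume : Measure (Fin d → ℝ))
      (fun j => m j * (2 * Real.pi))).quasiMeasurePreserving.ae h
  filter_upwards [ae_all_iff.2 h2] with θ hθ
  obtain ⟨m, hm⟩ := exists_add_two_pi_mem_torus θ
  rw [← dOmega_add_two_pi i l θ m]
  exact hθ m hm

/-- The zeros lie in countably many hyperplanes on which `θ 0` is constant. -/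
lemma ae_sin_sq_pos {x1 : ℤ} (hx : 0 < x1) :
    ∀ᵐ θ : Fin d → ℝ, 0 < Real.sin (θ 0 * x1) ^ 2 := by
  have h : ∀ᵐ θ : Fin d → ℝ, ∀ m : ℤ, θ 0 ≠ m * Real.pi / x1 :=
    ae_all_iff.2 fun m => Measure.ae_eval_ne (fun _ : Fin d => (volume : Measure ℝ)) 0 _
  filter_upwards [h] with θ hθ
  have hx' : (x1 : ℝ) ≠ 0 := by exact_mod_cast hx.ne'
  refine (sq_nonneg _).lt_of_ne' (pow_ne_zero 2 fun h0 => ?_)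
  obtain ⟨m, hm⟩ := Real.sin_eq_zero_iff.1 h0
  exact hθ m (by rw [hm, mul_div_cancel_right₀ _ hx'])

variable [NeZero n]

omit [NeZero d] in
-- A vanishing integral of a nonnegative function would force every `|∂_l ω_j|` to vanish almost
-- everywhere on the torus; one index, here 0, already contradicts nonflatness.
lemma setIntegral_mul_sum_abs_dOmega_pos (hN : NonflatBands V) (l : Fin d)
    {w : (Fin d → ℝ) → ℝ} (hw : ∀ᵐ θ : Fin d → ℝ, 0 < w θ)
    (hi : IntegrableOn (fun θ => w θ * ∑ j, |dOmega V j l θ|) (torus d)) :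
    0 < ∫ θ in torus d, w θ * ∑ j, |dOmega V j l θ| := by
  have h0 : 0 ≤ᵐ[volume.restrict (torus d)] fun θ => w θ * ∑ j, |dOmega V j l θ| := by
    filter_upwards [ae_restrict_of_ae hw] with θ hθ
    exact mul_nonneg hθ.le (Finset.sum_nonneg fun _ _ => abs_nonneg _)
  refine lt_of_le_of_ne (integral_nonneg_of_ae h0) fun he => ?_
  have h1 := (integral_eq_zero_iff_of_nonneg_ae h0 hi).1 he.symm
  refine not_ae_dOmega_eq_zero hN l (0 : Fin n) ?_
  filter_upwards [h1, ae_restrict_of_ae hw] with θ h2 h3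
  have h4 := (mul_eq_zero.1 h2).resolve_left h3.ne'
  exact abs_eq_zero.1 ((Finset.sum_eq_zero_iff_of_nonneg fun _ _ => abs_nonneg _).1 h4 0
    (Finset.mem_univ _))

lemma cHalf_pos (hV : ExpDecay V) (hP : ∀ θ, (fourier V θ).PosSemidef)
    (hdet : ∀ θ, (fourier V θ).det ≠ 0) (hN : NonflatBands V) (l : Fin d) {x1 : ℤ} (hx : 0 < x1) :
    0 < cHalf V l x1 := by
  rw [cHalf_eq hV hP hdet]
  refine mul_pos (by positivity) (setIntegral_mul_sum_abs_dOmega_pos hN l (ae_sin_sq_pos hx) ?_)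
  simp only [Finset.mul_sum]
  exact integrable_finsetSum _ fun j _ => integrableOn_sin_sq_mul_abs_dOmega hV hP hdet j l x1

lemma cFull_pos (hV : ExpDecay V) (hP : ∀ θ, (fourier V θ).PosSemidef)
    (hdet : ∀ θ, (fourier V θ).det ≠ 0) (hN : NonflatBands V) (l : Fin d) : 0 < cFull V l := by
  rw [cFull_eq hV hP hdet]
  refine mul_pos (by positivity) ?_
  have := setIntegral_mul_sum_abs_dOmega_pos hN l (w := fun _ => 1)
    (Filter.Eventually.of_forall fun _ => one_pos)
  simp only [one_mul] at this
  exact this (integrable_finsetSum _ fun j _ => integrableOn_abs_dOmega hV hP hdet j l)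

end Positivity

/-! ### The limit far from the wall. -/

section RiemannLebesgue

variable {d n : ℕ} [NeZero d] {V : Lattice d → Matrix (Fin n) (Fin n) ℝ}

/-- The Riemann–Lebesgue lemma for `cos(2 N θ_1)`. -/
lemma tendsto_setIntegral_cos_mul {f : (Fin d → ℝ) → ℝ} (hf : IntegrableOn f (torus d)) :
    Filter.Tendsto (fun N : ℕ => ∫ θ in torus d, Real.cos (2 * (θ 0 * N)) * f θ) Filter.atTop
      (nhds 0) := by
  let F : (Fin d → ℝ) → ℂ := (torus d).indicator fun θ => (f θ : ℂ)
  have h := tendsto_integral_exp_smul_cocompact F volume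
  let p : StrongDual ℝ (Fin d → ℝ) := ContinuousLinearMap.proj 0
  have hp : p ≠ 0 := fun h => by
    have := congrArg (fun q : StrongDual ℝ (Fin d → ℝ) => q 1) h
    simp [p] at this
  -- The Fourier character carries a factor `2π`, so the frequency `N/π` in the first variable
  -- yields `cos(2 N θ_1)` as real part.
  have hw : Filter.Tendsto (fun N : ℕ => ((N : ℝ) / Real.pi) • p) Filter.atTop
      (Filter.cocompact _) := by
    rw [← Metric.cobounded_eq_cocompact, ← tendsto_norm_atTop_iff_cobounded]
    simp only [norm_smul, Real.norm_eq_abs]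
    refine Filter.Tendsto.atTop_mul_const (norm_pos_iff.2 hp) ?_
    refine Filter.tendsto_abs_atTop_atTop.comp ?_
    exact tendsto_natCast_atTop_atTop.atTop_div_const Real.pi_pos
  have h2 := (Complex.continuous_re.tendsto 0).comp (h.comp hw)
  refine (h2.congr fun N => ?_).trans_eq ?_
  · have h3 : (fun v => Real.fourierChar (-((((N : ℝ) / Real.pi) • p) v)) • F v)
        = (torus d).indicator fun θ =>
          ((Real.fourierChar (-((N : ℝ) / Real.pi * θ 0)) : Circle) : ℂ) * (f θ : ℂ) := by
      funext θ
      by_cases hθ : θ ∈ torus d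
      · simp [F, hθ, p, Circle.smul_def]
      · simp [F, hθ]
    have h4 : IntegrableOn (fun θ : Fin d → ℝ =>
        ((Real.fourierChar (-((N : ℝ) / Real.pi * θ 0)) : Circle) : ℂ) * (f θ : ℂ)) (torus d) := by
      refine hf.ofReal.bdd_mul (c := 1) ?_ (Filter.Eventually.of_forall fun θ => (Circle.norm_coe _).le)
      refine Continuous.aestronglyMeasurable ?_
      exact continuous_subtype_val.comp (Real.continuous_fourierChar.comp (by fun_prop))
    simp only [Function.comp]
    rw [h3, integral_indicator measurableSet_torus]
    refine (integral_re h4).symm.trans ?_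
    congr 1
    funext θ
    have h5 : (2 * Real.pi * -((N : ℝ) / Real.pi * θ 0)) = -(2 * (θ 0 * N)) := by
      have := Real.pi_ne_zero
      field_simp
    rw [Real.fourierChar_apply, h5, RCLike.re_eq_complex_re, Complex.re_mul_ofReal,
      Complex.exp_ofReal_mul_I_re, Real.cos_neg]
  · simp

/-- By `2 sin² = 1 - cos 2(·)` the coefficient is `cFull` minus an oscillatory integral of an
integrable function. -/
lemma tendsto_cHalf (hV : ExpDecay V) (hP : ∀ θ, (fourier V θ).PosSemidef)
    (hdet : ∀ θ, (fourier V θ).det ≠ 0) (l : Fin d) :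
    Filter.Tendsto (fun N : ℕ => cHalf V l (N : ℤ)) Filter.atTop (nhds (cFull V l)) := by
  have hi : IntegrableOn (fun θ => ∑ j, |dOmega V j l θ|) (torus d) :=
    integrable_finsetSum _ fun j _ => integrableOn_abs_dOmega hV hP hdet j l
  have hc : ∀ N : ℕ, IntegrableOn (fun θ => Real.cos (2 * (θ 0 * N)) * ∑ j, |dOmega V j l θ|)
      (torus d) := fun N => by
    refine hi.bdd_mul (c := 1) ?_ (Filter.Eventually.of_forall fun θ => Real.abs_cos_le_one _)
    exact Continuous.aestronglyMeasurable (by fun_prop)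
  have h : ∀ N : ℕ, cHalf V l (N : ℤ) = 1 / (2 * Real.pi) ^ d *
      ((∫ θ in torus d, ∑ j, |dOmega V j l θ|)
        - ∫ θ in torus d, Real.cos (2 * (θ 0 * N)) * ∑ j, |dOmega V j l θ|) := fun N => by
    rw [cHalf_eq hV hP hdet, ← integral_sub hi (hc N)]
    rw [div_mul_eq_mul_div, div_mul_eq_mul_div, one_mul, ← integral_const_mul]
    congr 2
    funext θ
    rw [Real.cos_two_mul, Real.cos_sq']
    push_cast
    ring
  simp only [h]
  rw [cFull_eq hV hP hdet]
  have := (tendsto_setIntegral_cos_mul hi).const_sub (∫ θ in torus d, ∑ j, |dOmega V j l θ|)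
  rw [sub_zero] at this
  exact this.const_mul _

end RiemannLebesgue

/-! ### Specialization to the limiting symbol of the crystal. -/

section LimitingCurrent

variable {d n k : ℕ} [NeZero d] [NeZero k] {V : Lattice d → Matrix (Fin n) (Fin n) ℝ}
  {μ : (Fin k → ℕ) → Measure (Config d n)}

lemma isSineDensity_qInfHat (hk : k ≤ d) (hS : ∀ a b, Summable fun x => V x a b)
    (hP : ∀ θ, (fourier V θ).PosSemidef) (hW : WeakInverseIntegrability V)
    (hq : ∀ nn ∈ halfIndex k, ∀ a b, Summable fun z => corr (μ nn) z a b) :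
    IsSineDensity (qInfHat hk V μ) where
  measurable := measurableEntries_qInfHat hk hS (fun θ => (hP θ).isHermitian) hq
  integrable := integrableOn_sin_sq_mul_qInfHat hk hS hP hW hq
  map_neg := qInfHat_neg hk (fun θ => (hP θ).isHermitian) μ

lemma limitCurrent_eq_tsum (hk : k ≤ d) (l : Fin d) (x : Lattice d) :
    limitCurrent hk V μ l x = 1 / 2 * ∑' p, densityCurrentTerm V (qInfHat hk V μ) l x p := by
  simp only [limitCurrent, currentTerm_eq]

lemma limitCurrent_im (hk : k ≤ d) (hq : IsSineDensity (qInfHat hk V μ)) (l : Fin d)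
    (x : Lattice d) : (limitCurrent hk V μ l x).im = 0 := by
  have h : densityCurrentTerm V (qInfHat hk V μ) l x
      = fun p => (((densityCurrentTerm V (qInfHat hk V μ) l x p).re : ℝ) : ℂ) :=
    funext fun p => Complex.ext rfl (by simp [densityCurrentTerm_im hq])
  rw [limitCurrent_eq_tsum, h, ← Complex.ofReal_tsum]
  simp

lemma limitCurrent_eq_integral (hk : k ≤ d) (hV : ExpDecay V) (hsymm : SymmetricInteraction V)
    (hrefl : ∀ x, V (reflect x) = V x) (hq : IsSineDensity (qInfHat hk V μ)) {l : Fin d}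
    (hl : l ≠ 0) {x : Lattice d} (hx : 0 ≤ x 0) :
    limitCurrent hk V μ l x = -(2 * Complex.I / (2 * Real.pi) ^ d) * ∫ θ in torus d,
      ((Real.sin (θ 0 * x 0) ^ 2 : ℝ) : ℂ) *
        ((qInfHat hk V μ θ).toBlocks₂₁ * dFourier V l θ).trace := by
  rw [limitCurrent_eq_tsum, tsum_densityCurrentTerm hV hq hl hx,
    tsum_coord_bondTerm hV hsymm hrefl hq hl]
  ring

lemma limitCurrent_first (hk : k ≤ d) (hrefl : ∀ x, V (reflect x) = V x) (x : Lattice d) :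
    limitCurrent hk V μ 0 x = 0 := by
  rw [limitCurrent_eq_tsum, tsum_densityCurrentTerm_zero hrefl, mul_zero]

end LimitingCurrent

end HarmonicCrystal
end

/-! ### The main theorem. -/

open HarmonicCrystal in
theorem lemma6p6 {d n k : ℕ} [NeZero d] [NeZero n] [NeZero k] (hk : k ≤ d)
    (V : HarmonicCrystal.Lattice d → Matrix (Fin n) (Fin n) ℝ)
    (hE1 : HarmonicCrystal.ExpDecay V)
    (hE2 : HarmonicCrystal.SymmetricInteraction V)
    (hE3 : ∀ θ, (HarmonicCrystal.fourier V θ).PosSemidef)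
    (hrefl : ∀ x, V (HarmonicCrystal.reflect x) = V x)
    (hE6 : HarmonicCrystal.WeakInverseIntegrability V)
    (μ : (Fin k → ℕ) → MeasureTheory.Measure (HarmonicCrystal.Config d n))
    (hμ : ∀ nn ∈ HarmonicCrystal.halfIndex k, HarmonicCrystal.IsReservoir (μ nn))
    (hS2 : ∀ nn ∈ HarmonicCrystal.halfIndex k, ∀ a b,
      Summable fun z => HarmonicCrystal.corr (μ nn) z a b) :
    -- the limit covariance and the limiting current are well defined, and the current is real
    (∀ x y a b, MeasureTheory.IntegrableOn (fun θ =>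
      HarmonicCrystal.imagePhase x y θ * HarmonicCrystal.qInfHat hk V μ θ a b)
      (HarmonicCrystal.torus d)) ∧
    (∀ l x, 0 ≤ x 0 → Summable (HarmonicCrystal.currentTerm hk V μ l x) ∧
      (HarmonicCrystal.limitCurrent hk V μ l x).im = 0) ∧
    -- the limiting current is the mean of the energy current in each state with covariance `Q^+_∞`
    (∀ P : MeasureTheory.Measure (HarmonicCrystal.Config d n), MeasureTheory.IsProbabilityMeasure P →
      (∀ x a, 0 ≤ x 0 → MeasureTheory.MemLp (fun Y : HarmonicCrystal.Config d n => Y x a) 2 P) →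
      (∀ x y a b, 0 ≤ x 0 → 0 ≤ y 0 →
        ((∫ Y, Y x a * Y y b ∂P : ℝ) : ℂ) = HarmonicCrystal.QInf hk V μ x y a b) →
      ∀ l x, 0 ≤ x 0 → MeasureTheory.Integrable (HarmonicCrystal.energyCurrent V l x) P ∧
        ((∫ Y, HarmonicCrystal.energyCurrent V l x Y ∂P : ℝ) : ℂ)
          = HarmonicCrystal.limitCurrent hk V μ l x) ∧
    -- dimension one
    (d = 1 → ∀ l x, 0 ≤ x 0 → HarmonicCrystal.limitCurrent hk V μ l x = 0) ∧
    -- the first component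
    (∀ x, 0 ≤ x 0 → HarmonicCrystal.limitCurrent hk V μ 0 x = 0) ∧
    -- the other components
    (∀ l, l ≠ 0 → ∀ x, 0 ≤ x 0 →
      MeasureTheory.IntegrableOn (fun θ => ((Real.sin (θ 0 * x 0) ^ 2 : ℝ) : ℂ) *
        ((HarmonicCrystal.qInfHat hk V μ θ).toBlocks₂₁ * HarmonicCrystal.dFourier V l θ).trace)
        (HarmonicCrystal.torus d) ∧
      HarmonicCrystal.limitCurrent hk V μ l x =
        -(2 * Complex.I / (2 * Real.pi) ^ d) * ∫ θ in HarmonicCrystal.torus d,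
          ((Real.sin (θ 0 * x 0) ^ 2 : ℝ) : ℂ) *
          ((HarmonicCrystal.qInfHat hk V μ θ).toBlocks₂₁ * HarmonicCrystal.dFourier V l θ).trace) ∧
    -- the boundary
    (∀ l x, x 0 = 0 → HarmonicCrystal.limitCurrent hk V μ l x = 0) ∧
    -- Gibbs reservoirs under the symmetry condition
    (∀ T : (Fin k → ℕ) → ℝ, (∀ nn ∈ HarmonicCrystal.halfIndex k, 0 < T nn) →
      (∀ θ, (HarmonicCrystal.fourier V θ).det ≠ 0) →
      (∀ nn ∈ HarmonicCrystal.halfIndex k, ∀ θ,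
        HarmonicCrystal.fourier (HarmonicCrystal.corr (μ nn)) θ
          = HarmonicCrystal.gibbsHat V (T nn) θ) →
      HarmonicCrystal.SymmetryCondition hk V →
      (∀ p : Fin k, p ≠ 0 → ∀ x, 0 ≤ x 0 →
        HarmonicCrystal.limitCurrent hk V μ (Fin.castLE hk p) x =
          ((-(HarmonicCrystal.cHalf V (Fin.castLE hk p) (x 0)) * (1 / 2 ^ (k - 1))
            * HarmonicCrystal.tempDiff T p : ℝ) : ℂ)) ∧
      (∀ l : Fin d, l = 0 ∨ k ≤ l.val → ∀ x, 0 ≤ x 0 →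
        HarmonicCrystal.limitCurrent hk V μ l x = 0) ∧
      (HarmonicCrystal.NonflatBands V → ∀ p : Fin k, p ≠ 0 →
        (∀ x1 : ℤ, 0 < x1 → 0 < HarmonicCrystal.cHalf V (Fin.castLE hk p) x1) ∧
        0 < HarmonicCrystal.cFull V (Fin.castLE hk p)) ∧
      (∀ p : Fin k, p ≠ 0 → ∀ x : HarmonicCrystal.Lattice d,
        Filter.Tendsto (fun N : ℕ => HarmonicCrystal.limitCurrent hk V μ (Fin.castLE hk p)
            (Function.update x 0 (N : ℤ))) Filter.atTop
          (nhds ((-(HarmonicCrystal.cFull V (Fin.castLE hk p)) * (1 / 2 ^ (k - 1))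
            * HarmonicCrystal.tempDiff T p : ℝ) : ℂ)))) := by
  have hq := isSineDensity_qInfHat hk hE1.summable hE3 hE6 hS2
  have hformula := fun l (hl : l ≠ 0) x (hx : 0 ≤ x 0) =>
    limitCurrent_eq_integral hk hE1 hE2 hrefl hq hl (x := x) hx
  have hfirst := limitCurrent_first (μ := μ) hk hrefl
  refine ⟨hq.integrableOn_imagePhase_mul, fun l x _ => ⟨?_, limitCurrent_im hk hq l x⟩,
    fun P _ hL2 hcov l x _ => ?_, fun hd l x _ => ?_, fun x _ => hfirst x,
    fun l hl x hx => ⟨integrableOn_trace hE1 hq l (x 0), hformula l hl x hx⟩,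
    fun l x hx => ?_, fun T _ hdet hG hSC => ⟨fun p hp x hx => ?_, fun l hl x hx => ?_,
      fun hN p _ => ⟨fun x1 hx1 => cHalf_pos hE1 hE3 hdet hN _ hx1,
        cFull_pos hE1 hE3 hdet hN _⟩, fun p hp x => ?_⟩⟩
  · exact (summable_densityCurrentTerm hE1 hq l x).congr fun p => currentTerm_eq hk μ l x p
  · rw [limitCurrent_eq_tsum]
    exact integral_energyCurrent hE1 hq hL2 hcov l x
  · subst hd
    rw [Subsingleton.elim l 0]
    exact hfirst x
  · by_cases hl : l = 0
    · rw [hl]; exact hfirst x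
    -- On the wall the factor `sin²(θ_1 x_1)` vanishes identically.
    · rw [hformula l hl x hx.ge, hx]
      simp
  · rw [hformula _ (castLE_ne_zero hk hp) x hx, current_of_gibbs hk hE1 hE3 hdet hG hSC hp]
  · by_cases hl0 : l = 0
    · rw [hl0]; exact hfirst x
    · rw [hformula l hl0 x hx,
        current_of_gibbs_of_le hk hE1 hE3 hdet hG hSC (hl.resolve_left hl0), mul_zero]
  · have h1 : ∀ N : ℕ, limitCurrent hk V μ (Fin.castLE hk p) (Function.update x 0 (N : ℤ))
        = ((-(cHalf V (Fin.castLE hk p) N) * (1 / 2 ^ (k - 1)) * tempDiff T p : ℝ) : ℂ) := fun N => by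
      rw [hformula _ (castLE_ne_zero hk hp) _ (by simp),
        current_of_gibbs hk hE1 hE3 hdet hG hSC hp, Function.update_self]
    simp only [h1]
    exact (Complex.continuous_ofReal.tendsto _).comp
      (((tendsto_cHalf hE1 hE3 hdet _).neg.mul_const _).mul_const _)
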